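/- \textbf{Setting.} Let $\phi_j$, $j\in\frac12+\mathbb Z$, be free bosons, $\phi_i\phi_j-\phi_j\phi_i=(-1)^{j-\frac12}\delta_{i,-j}$, acting on the Fock space generated from $|0\rangle$, with $\phi_{-j}|0\rangle=0$, $\langle0|\phi_j=0$ $(j>0)$ and $\langle 0|0\rangle=1$; the Fock space is completed, i.e. all formal series in the vectors $\phi_{j_1}^{m_1}\cdots\phi_{j_n}^{m_n}|0\rangle$ $(j_i>0)$ are allowed, and a series of vectors converges if the series of coefficients of every basis vector converges absolutely. Put $\phi(z)=\sum_{j\in\mathbb Z}\phi_{j+\frac12}z^j$, $\sum_nH_nz^{-n-1}=-\frac12{:}\phi(-z)\phi(z){:}$ ($n$ odd), $H(t)=\sum_{k\ge0}t_{2k+1}H_{2k+1}$, $x=t_1$, $\partial=\partial_x$, $\xi(t,z)=\sum_{k\ge0}t_{2k+1}z^{2k+1}$, and $\langle1|=\frac12\langle0|\phi_{-\frac12}$. The expressions $\langle0|e^{H(t)}|\cdot\rangle$ and $\langle1|e^{H(t)}|\cdot\rangle$ are formal power series in $t=(t_1,t_3,\dots)$ over $\mathbb C$. Let $c_\infty$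 consist of the pairs of a band matrix $(a_{i,j})_{i,j\in\mathbb Z}$ with $a_{i,j}=(-1)^{i+j+1}a_{1-j,1-i}$ and a multiple $\lambda c$ of a central element, represented by $a+\lambda c\mapsto\frac12\sum_{i,j}a_{i,j}(-1)^{j-1}{:}\phi_{i-\frac12}\phi_{\frac12-j}{:}-\frac\lambda2$. Let $g=e^{a_1}\cdots e^{a_k}\in Sp_\infty$ with $a_i\in c_\infty$ be such that the exponential series defining $g|0\rangle$ (applied successively to $|0\rangle$) converge, and $\langle0|g|0\rangle\ne0$. Let $\beta\in V=\bigoplus_{l\in\frac12+\mathbb Z}\mathbb C\phi_l$. Put $$\tau_0(t)=\langle0|e^{H(t)}g|0\rangle,\qquad w(t,z)=\frac{2\langle1|e^{H(t)}\phi(z)g|0\rangle}{\tau_0(t)}=W(e^{\xi(t,z)}),\qquad q(t)=\frac{2\langle1|e^{H(t)}\beta g|0\rangle}{\tau_0(t)},$$ with $W=1+w_1\partial^{-1}+w_2\partial^{-2}+\cdots$, and $L=W\partial W^{-1}$. For a dressing operator $W'=1+w_1'\partial^{-1}+\cdots$ and $L'=W'\partial W'^{-1}$, a series $\tau$ with $\tau(0)\ne0$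 is called a tau function of $W'$ if $w_1'=2\partial_x\log\tau$ and $2\partial_{t_n}\partial_x\log\tau=-\mathrm{Res}_\partial L'^n$ for all odd $n\geq1$. A squared eigenfunction potential $\Omega(q,q)$ is a series $\Omega$ with $\Omega_x=q^2$ and $\Omega_{t_n}=\mathrm{Res}_\partial(\partial^{-1}q(L^n)_{\ge0}q\partial^{-1})$ for all odd $n\ge1$; it is unique up to an additive constant. For $q\ne0$, the Darboux operator $T(q)=T(q,q)$ formed with such a potential $\Omega'\neq 0$ is $T_I(q^{(1)})\,T_D(q)$, where $T_D(q)=q\partial q^{-1}$, $T_I(r)=r^{-1}\partial^{-1}r$ and $q^{(1)}=-\Omega'/q$; it transforms $W$ into $W^{[1]}=T(q)W$. \textbf{Proposition.} $\tau_0$ is a tau function of $W$, $q$ is an eigenfunction ($q_{t_n}=(L^n)_{\ge0}(q)$ for all odd $n\geq 1$), and there is a squared eigenfunction potential $\Omega=\Omega(q,q)$ such that, for all $m\ge0$, $$\langle0|e^{H(t)}\beta^{2m}g|0\rangle=(2m-1)!!\,\Omega(q,q)^m\,\tau_0(t).$$ The series $e^{\beta^2/2}g|0\rangle=\sum_{n\ge0}\frac1{n!}\big(\frac{\beta^2}2\big)^ng|0\rangle$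 converges if and only if $|\Omega(q,q)(0)|<1$. If it converges, then $$\tau_0^{[1]}(t)=\langle0|e^{H(t)}e^{\beta^2/2}g|0\rangle$$ satisfies $(\tau_0^{[1]})^2\,(1-\Omega(q,q))=\tau_0^2$, and, if $q\neq0$, it is a tau function of $W^{[1]}=T(q)W$, where $T(q)$ is the Darboux operator formed with the potential $\Omega(q,q)-1$. -/

import Mathlib

namespace CKP

/-! ### Free bosons on the (completed) Fock space -/

/-- The Fock space of the free bosons `φ_j`, `j ∈ 1/2 + ℤ`, completed with respect to the energy
`φ_{j₁}^{m₁} ⋯ φ_{jₙ}^{mₙ}|0⟩ ↦ ∑ jᵢ mᵢ`.  The variable `X n` stands for the creation operator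
`φ_{n+1/2}`, the monomial `∏ X n ^ m n` for the basis vector `∏ φ_{n+1/2}^{m n}|0⟩`, and `1` for
`|0⟩`.  As every energy is attained by finitely many basis vectors only, the completion consists
of all formal series in these monomials. -/
abbrev Fock : Type := MvPowerSeries ℕ ℂ

/-- The boson `φ_{k+1/2}`, `k ∈ ℤ`: `φ_{n+1/2}` is multiplication by `X n` and `φ_{-n-1/2}` is
`(-1)^n ∂/∂X n` for `n ≥ 0`. -/
noncomputable def phi : ℤ → Fock →ₗ[ℂ] Fock
  | Int.ofNat n => LinearMap.mulLeft ℂ (MvPowerSeries.X n : Fock)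
  | Int.negSucc n => ((-1 : ℂ) ^ n) • (MvPowerSeries.pderiv ℂ n).toLinearMap

/-- The pairing `⟨0|f⟩`. -/
noncomputable def vac (f : Fock) : ℂ := MvPowerSeries.constantCoeff f

/-- The canonical commutation relations `φ_i φ_j - φ_j φ_i = (-1)^{j-1/2} δ_{i,-j}`, with
`i = k + 1/2` and `j = l + 1/2`. -/
theorem phi_comm (k l : ℤ) (f : Fock) :
    phi k (phi l f) - phi l (phi k f) = if k + l + 1 = 0 then (-1 : ℂ) ^ l • f else 0 := by
  have key : ∀ i j : ℕ, MvPowerSeries.pderiv ℂ i (MvPowerSeries.X j : Fock) =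
      if i = j then 1 else 0 := by
    intro i j
    ext m
    rw [MvPowerSeries.coeff_pderiv, MvPowerSeries.coeff_X]
    by_cases h : i = j
    · subst h
      by_cases hm : m = 0
      · simp [hm]
      · have : m + Finsupp.single i 1 ≠ Finsupp.single i 1 := by simpa using hm
        simp [this, MvPowerSeries.coeff_one, hm]
    · have : m + Finsupp.single i 1 ≠ Finsupp.single j 1 := by
        intro e
        have := DFunLike.congr_fun e i
        simp [Ne.symm h] at this
      simp [this, h]
  rcases k with i | i <;> rcases l with j | j
  · have : (Int.ofNat i + Int.ofNat j + 1 : ℤ) ≠ 0 := by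
      simp only [Int.ofNat_eq_natCast]; omega
    rw [if_neg this]
    simp only [phi, LinearMap.mulLeft_apply]
    ring
  · simp only [phi, LinearMap.mulLeft_apply, LinearMap.smul_apply, Derivation.coeFn_coe,
      Derivation.leibniz, key, smul_eq_mul, mul_smul_comm, smul_add]
    by_cases h : j = i
    · subst h
      have h0 : (Int.ofNat j + Int.negSucc j + 1 : ℤ) = 0 := by
        simp only [Int.ofNat_eq_natCast, Int.negSucc_eq]; omega
      have h1 : (-1 : ℂ) ^ (Int.negSucc j) = -(-1) ^ j := by
        rw [zpow_negSucc, pow_succ, mul_inv]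
        rcases neg_one_pow_eq_or ℂ j with h | h <;> simp [h]
      rw [if_pos h0, h1]
      simp
    · have h0 : ¬ (Int.ofNat i + Int.negSucc j + 1 : ℤ) = 0 := by
        simp only [Int.ofNat_eq_natCast, Int.negSucc_eq]; omega
      rw [if_neg h0, if_neg h]
      simp
  · simp only [phi, LinearMap.mulLeft_apply, LinearMap.smul_apply, Derivation.coeFn_coe,
      Derivation.leibniz, key, smul_eq_mul, mul_smul_comm, smul_add]
    by_cases h : i = j
    · subst h
      have h0 : (Int.negSucc i + Int.ofNat i + 1 : ℤ) = 0 := by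
        simp only [Int.ofNat_eq_natCast, Int.negSucc_eq]; omega
      rw [if_pos h0]
      simp
    · have h0 : ¬ (Int.negSucc i + Int.ofNat j + 1 : ℤ) = 0 := by
        simp only [Int.ofNat_eq_natCast, Int.negSucc_eq]; omega
      rw [if_neg h0, if_neg h]
      simp
  · have h0 : ¬ (Int.negSucc i + Int.negSucc j + 1 : ℤ) = 0 := by
      simp only [Int.negSucc_eq]; omega
    rw [if_neg h0]
    simp only [phi, LinearMap.smul_apply, Derivation.coeFn_coe, map_smul, sub_eq_zero]
    rw [smul_comm]
    congr 2
    ext m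
    simp only [MvPowerSeries.coeff_pderiv]
    rw [add_right_comm]
    by_cases h : i = j
    · subst h; rfl
    · simp only [Finsupp.add_apply, Finsupp.single_apply, h, Ne.symm h, if_false]
      push_cast
      ring

/-- `⟨0|φ_j = 0` for `j > 0`. -/
theorem vac_phi (n : ℕ) (f : Fock) : vac (phi n f) = 0 := by
  simp [vac, show phi (n : ℤ) = LinearMap.mulLeft ℂ (MvPowerSeries.X n : Fock) from rfl]

/-- `φ_{-j}|0⟩ = 0` for `j > 0`. -/
theorem phi_one (n : ℕ) : phi (Int.negSucc n) (1 : Fock) = 0 := by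
  simp [phi]

/-- The normal ordered product `:φ_{k+1/2} φ_{l+1/2}: = φ_{k+1/2} φ_{l+1/2} -
⟨0|φ_{k+1/2} φ_{l+1/2}|0⟩`. -/
noncomputable def normalOrd (k l : ℤ) (f : Fock) : Fock :=
  phi k (phi l f) - vac (phi k (phi l 1)) • f

/-- The space `V = ∑_l ℂ φ_l`, `l ∈ 1/2 + ℤ`: the finitely supported family `b` stands for the
field `β = ∑ b k φ_{k+1/2}`. -/
noncomputable def field (b : ℤ →₀ ℂ) : Fock →ₗ[ℂ] Fock := b.sum fun k c => c • phi k

/-! ### The Lie algebra `c_∞` and its group -/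

/-- An element of `c_∞`: a band matrix `a` with `a_{i,j} = (-1)^{i+j+1} a_{1-j,1-i}`, and a
multiple of the central element. -/
structure CInf where
  mat : ℤ → ℤ → ℂ
  symm : ∀ i j, mat i j = (-1 : ℂ) ^ (i + j + 1) * mat (1 - j) (1 - i)
  band : ∃ N : ℤ, ∀ i j, N < |i - j| → mat i j = 0
  central : ℂ

/-- The representation of `c_∞` with `Z_{i,j} ↦ (-1)^{j-1} :φ_{i-1/2} φ_{1/2-j}:` for
`Z_{i,j} = E_{i,j} - (-1)^{i+j} E_{1-j,1-i}` and `c ↦ -1/2`.  A matrix `a` in `c_∞` is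
`(1/2) ∑ a_{i,j} Z_{i,j}`.  Because `a` is a band matrix, only finitely many terms contribute to
each coefficient of the result. -/
noncomputable def CInf.op (a : CInf) (f : Fock) : Fock := fun m =>
  (1 / 2) * (∑ᶠ p : ℤ × ℤ, a.mat p.1 p.2 * (-1) ^ (p.2 - 1) *
    MvPowerSeries.coeff m (normalOrd (p.1 - 1) (-p.2) f)) +
  a.central * (-1 / 2) * MvPowerSeries.coeff m f

/-- `f' = e^A f`: for every basis vector the series `∑ A^n f / n!` of coefficients converges
(absolutely) to the coefficient of `f'`. -/
def HasExp (A : Fock → Fock) (f f' : Fock) : Prop :=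
  ∀ m, HasSum (fun n : ℕ => ((n.factorial : ℂ))⁻¹ * MvPowerSeries.coeff m (A^[n] f))
    (MvPowerSeries.coeff m f')

/-- `SpVac u`: the vector `u` is `g|0⟩` for some `g = e^{a₁} ⋯ e^{a_k} ∈ Sp_∞` with `aᵢ ∈ c_∞`, for
which these exponentials converge. -/
inductive SpVac : Fock → Prop
  | one : SpVac 1
  | exp (a : CInf) {f f' : Fock} : SpVac f → HasExp a.op f f' → SpVac f'

/-! ### Vacuum expectation values as formal power series in the times -/

/-- Formal power series in the odd times; the variable `X k` stands for `t_{2k+1}`, so `X 0` is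
`t_1 = x`. -/
abbrev TSeries : Type := MvPowerSeries ℕ ℂ

/-- The Heisenberg operators: `∑_n H_n z^{-n-1} = -(1/2) :φ(-z) φ(z):` with
`φ(z) = ∑ φ_{j+1/2} z^j`.  Only finitely many terms contribute to each coefficient. -/
noncomputable def heis (n : ℤ) (f : Fock) : Fock := fun m =>
  -(1 / 2) * ∑ᶠ i : ℤ, (-1) ^ i * MvPowerSeries.coeff m (normalOrd i (-n - 1 - i) f)

/-- The operator `H(t) = ∑_{k ≥ 0} t_{2k+1} H_{2k+1}` on formal power series in the times with
coefficients in the Fock space. -/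
noncomputable def heisT (F : (ℕ →₀ ℕ) → Fock) : (ℕ →₀ ℕ) → Fock := fun α =>
  ∑ k ∈ α.support, heis (2 * k + 1) (F (α - Finsupp.single k 1))

/-- `e^{H(t)} f = ∑ H(t)^n f / n!`; to the coefficient of `t^α` only `n = |α|` contributes. -/
noncomputable def expHeis (f : Fock) : (ℕ →₀ ℕ) → Fock := fun α =>
  ∑ᶠ n : ℕ, ((n.factorial : ℂ))⁻¹ • (heisT^[n] (fun γ => if γ = 0 then f else 0)) α

/-- `⟨0|e^{H(t)}|f⟩`. -/
noncomputable def bra0 (f : Fock) : TSeries := fun α => vac (expHeis f α)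

/-- `⟨1|e^{H(t)}|f⟩`, where `⟨1| = ⟨0|H_{1/2}`.  The operator `H_{1/2}` is half the coefficient of
`z^{-1}` in `V_-(z)^{-1} φ(z) V_+(z)^{-1}`, where `V_±(z) = exp ∑_{±k>0, odd} (2/k) H_k z^{-k}`.
Since `⟨0|V_-(z)^{-1} = ⟨0|`, `V_+(z)^{-1} = 1 + O(z^{-1})` and `⟨0|φ(z) = O(z^{-1})`, one has
`⟨1| = (1/2) ⟨0|φ_{-1/2}`. -/
noncomputable def bra1 (f : Fock) : TSeries := fun α => (1 / 2) * vac (phi (-1) (expHeis f α))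

/-- The coefficient of `z^k` in `e^{-ξ(t,z)}`, where `ξ(t,z) = ∑ t_{2i+1} z^{2i+1}`. -/
noncomputable def expNegXi (k : ℕ) : TSeries := fun α =>
  if (α.sum fun i e => e * (2 * i + 1)) = k then
    α.prod fun _ e => (-1 : ℂ) ^ e / (e.factorial : ℂ) else 0

/-- The coefficient of `z^{-n}` in `2 ⟨1|e^{H(t)} φ(z)|u⟩ e^{-ξ(t,z)}`.  Only finitely many terms
contribute to each coefficient, because `t_{2i+1}` has weight `2i+1` in the `k`-th factor. -/
noncomputable def waveNum (u : Fock) (n : ℤ) : TSeries := fun α =>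
  ∑ᶠ k : ℕ, MvPowerSeries.coeff α (expNegXi k * (2 * bra1 (phi (-n - k) u)))

/-- The coefficient of `z^{-n}` in
`ŵ(t,z) = 2 ⟨1|e^{H(t)} φ(z)|u⟩ e^{-ξ(t,z)} / ⟨0|e^{H(t)}|u⟩`. -/
noncomputable def waveCoeff (u : Fock) (n : ℤ) : TSeries :=
  (bra0 u)⁻¹ * waveNum u n

/-- `q(t) = 2 ⟨1|e^{H(t)} β|u⟩ / ⟨0|e^{H(t)}|u⟩`. -/
noncomputable def eigen (u : Fock) (b : ℤ →₀ ℂ) : TSeries :=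
  (bra0 u)⁻¹ * (2 * bra1 (field b u))

/-! ### The differential field of quotients of formal power series -/

instance : IsDomain TSeries := NoZeroDivisors.to_isDomain _

/-- The field of fractions of the ring of formal power series in the times. -/
abbrev K : Type := FractionRing TSeries

/-- The ring homomorphism `a ↦ a + ∂_{t_{2k+1}}(a) ε` to the dual numbers over `K`. -/
noncomputable def dualHom (k : ℕ) : TSeries →+* DualNumber K where
  toFun a := TrivSqZeroExt.inl (algebraMap TSeries K a) +
    TrivSqZeroExt.inr (algebraMap TSeries K (MvPowerSeries.pderiv ℂ k a))
  map_one' := by ext <;> simp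
  map_mul' a b := by
    ext
    · simp only [TrivSqZeroExt.fst_mul, TrivSqZeroExt.fst_add, TrivSqZeroExt.fst_inl,
        TrivSqZeroExt.fst_inr, map_mul, add_zero]
    · simp only [TrivSqZeroExt.snd_mul, TrivSqZeroExt.fst_add, TrivSqZeroExt.snd_add, TrivSqZeroExt.fst_inl,
        TrivSqZeroExt.snd_inl, TrivSqZeroExt.fst_inr, TrivSqZeroExt.snd_inr, map_mul, Derivation.leibniz, smul_eq_mul,
        MulOpposite.smul_eq_mul_unop, MulOpposite.unop_op, map_add, add_zero, zero_add]
      ring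
  map_zero' := by ext <;> simp
  map_add' a b := by
    ext <;> simp only [TrivSqZeroExt.fst_add, TrivSqZeroExt.snd_add, TrivSqZeroExt.fst_inl,
        TrivSqZeroExt.snd_inl, TrivSqZeroExt.fst_inr, TrivSqZeroExt.snd_inr, map_add, add_zero, zero_add]

theorem dualHom_isUnit (k : ℕ) (y : nonZeroDivisors TSeries) : IsUnit (dualHom k y) := by
  rw [TrivSqZeroExt.isUnit_iff_isUnit_fst]
  simp [dualHom]

/-- The extension of `dualHom k` to the field of fractions. -/
noncomputable def dualLift (k : ℕ) : K →+* DualNumber K :=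
  IsLocalization.lift (M := nonZeroDivisors TSeries) (dualHom_isUnit k)

theorem dualLift_fst (k : ℕ) (x : K) : (dualLift k x).fst = x := by
  have h : (TrivSqZeroExt.fstHom K K K).toRingHom.comp (dualLift k) = RingHom.id K := by
    apply IsLocalization.ringHom_ext (nonZeroDivisors TSeries)
    ext a
    simp [dualLift, dualHom]
  exact RingHom.congr_fun h x

/-- The (unique) extension of the derivation `∂/∂t_{2k+1}` to the field of fractions. -/
noncomputable def dt (k : ℕ) : Derivation ℂ K K where
  toFun x := (dualLift k x).snd
  map_add' x y := by simp
  map_smul' c x := by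
    have h : dualLift k (algebraMap ℂ K c) = TrivSqZeroExt.inl (algebraMap ℂ K c) := by
      rw [IsScalarTower.algebraMap_apply ℂ TSeries K, dualLift, IsLocalization.lift_eq]
      ext <;> simp [dualHom]
    simp [Algebra.smul_def, h]
  map_one_eq_zero' := by simp
  leibniz' x y := by
    simp [dualLift_fst, mul_comm]

theorem dt_algebraMap (k : ℕ) (a : TSeries) :
    dt k (algebraMap TSeries K a) = algebraMap TSeries K (MvPowerSeries.pderiv ℂ k a) := by
  change (dualLift k (algebraMap TSeries K a)).snd = _
  rw [dualLift, IsLocalization.lift_eq]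
  simp only [dualHom, RingHom.coe_mk, MonoidHom.coe_mk, OneHom.coe_mk, TrivSqZeroExt.snd_add,
    TrivSqZeroExt.snd_inl, TrivSqZeroExt.snd_inr, zero_add]

/-! ### Pseudo-differential operators in `∂ = ∂/∂x`, `x = t_1` -/

/-- The pseudo-differential operator `∑_{i ≤ N} a_i ∂^i` with coefficients in `K`. -/
@[ext] structure PDO where
  coeff : ℤ → K
  bdd : ∃ N : ℤ, ∀ i, N < i → coeff i = 0

namespace PDO

/-- The operator `a ∂^i`. -/
noncomputable def mono (a : K) (i : ℤ) : PDO where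
  coeff j := if j = i then a else 0
  bdd := ⟨i, fun j hj => if_neg (by omega)⟩

noncomputable instance : One PDO := ⟨mono 1 0⟩

noncomputable instance : Sub PDO where
  sub P Q :=
    { coeff := fun i => P.coeff i - Q.coeff i
      bdd := by
        obtain ⟨N, hN⟩ := P.bdd
        obtain ⟨M, hM⟩ := Q.bdd
        exact ⟨max N M, fun i hi => by
          rw [hN i (lt_of_le_of_lt (le_max_left _ _) hi),
            hM i (lt_of_le_of_lt (le_max_right _ _) hi), sub_zero]⟩ }

/-- The product, determined by `∂^i ∘ b = ∑_{k ≥ 0} (i choose k) (∂_x^k b) ∂^{i-k}` for `i ∈ ℤ`. -/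
noncomputable instance : Mul PDO where
  mul P Q :=
    { coeff := fun n => ∑ᶠ p : ℤ × ℕ,
        ((Ring.choose p.1 p.2 : ℤ) : K) * P.coeff p.1 * (dt 0)^[p.2] (Q.coeff (n - p.1 + p.2))
      bdd := by
        obtain ⟨N, hN⟩ := P.bdd
        obtain ⟨M, hM⟩ := Q.bdd
        refine ⟨N + M, fun n hn => finsum_eq_zero_of_forall_eq_zero fun p => ?_⟩
        by_cases hp : N < p.1
        · rw [hN _ hp, mul_zero, zero_mul]
        · rw [hM _ (by omega), iterate_map_zero, mul_zero] }

/-- The differential part `P_{≥ 0}`. -/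
noncomputable def pos (P : PDO) : PDO where
  coeff i := if 0 ≤ i then P.coeff i else 0
  bdd := by
    obtain ⟨N, hN⟩ := P.bdd
    exact ⟨N, fun i hi => by simp [hN i hi]⟩

/-- The residue: the coefficient of `∂^{-1}`. -/
def res (P : PDO) : K := P.coeff (-1)

/-- The action `P_{≥ 0}(f) = ∑_{i ≥ 0} a_i ∂_x^i f` of the differential part on functions. -/
noncomputable def applyPos (P : PDO) (f : K) : K :=
  ∑ᶠ i : ℕ, P.coeff i * (dt 0)^[i] f

/-- The inverse `∑_{k ≥ 0} (1 - W)^k` of an operator of the form `W = 1 + w₁ ∂^{-1} + ⋯`.  To the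
coefficient of `∂^{-n}` only the terms with `k ≤ n` contribute. -/
noncomputable def inv (W : PDO) : PDO where
  coeff i := if 0 < i then 0 else
    ∑ k ∈ Finset.range ((-i).toNat + 1), (npowRec k (1 - W)).coeff i
  bdd := ⟨0, fun _ hi => if_pos hi⟩

/-- The power `L^n` of the Lax operator `L = W ∂ W^{-1}`. -/
noncomputable def laxPow (W : PDO) (n : ℕ) : PDO := npowRec n (W * mono 1 1 * W.inv)

end PDO

/-- The dressing operator `W = ∑_{n ≥ 0} w_n ∂^{-n}`, for which `w(t,z) = W(e^{ξ(t,z)})` with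
`w(t,z) = 2 ⟨1|e^{H(t)} φ(z)|u⟩ / ⟨0|e^{H(t)}|u⟩`. -/
noncomputable def dressing (u : Fock) : PDO where
  coeff i := if 0 < i then 0 else algebraMap TSeries K (waveCoeff u (-i))
  bdd := ⟨0, fun _ hi => if_pos hi⟩

/-- `q` is an eigenfunction: `q_{t_n} = (L^n)_{≥ 0}(q)` for all odd `n`. -/
def IsEigenfunction (W : PDO) (q : TSeries) : Prop :=
  ∀ k : ℕ, algebraMap TSeries K (MvPowerSeries.pderiv ℂ k q) =
    (W.laxPow (2 * k + 1)).applyPos (algebraMap TSeries K q)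

/-- `Ω` is a squared eigenfunction potential `Ω(q, r)`: `Ω_x = q r` and
`Ω_{t_n} = Res_∂ (∂^{-1} r (L^n)_{≥ 0} q ∂^{-1})` for all odd `n`. -/
def IsSEP (W : PDO) (q r Ω : TSeries) : Prop :=
  MvPowerSeries.pderiv ℂ 0 Ω = q * r ∧
  ∀ k : ℕ, algebraMap TSeries K (MvPowerSeries.pderiv ℂ k Ω) =
    (PDO.mono 1 (-1) * PDO.mono (algebraMap TSeries K r) 0 * (W.laxPow (2 * k + 1)).pos *
      PDO.mono (algebraMap TSeries K q) 0 * PDO.mono 1 (-1)).res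

/-- `τ` is a tau function of the solution of the CKP hierarchy with dressing operator
`W = 1 + w₁ ∂^{-1} + ⋯` and Lax operator `L = W ∂ W^{-1}`:
`w₁ = 2 ∂_x log τ` and `2 ∂_{t_n} ∂_x log τ = -Res_∂ L^n` for all odd `n`. -/
def IsTau (W : PDO) (τ : TSeries) : Prop :=
  MvPowerSeries.constantCoeff τ ≠ 0 ∧
  W.coeff (-1) = algebraMap TSeries K (2 * (MvPowerSeries.pderiv ℂ 0 τ * τ⁻¹)) ∧
  ∀ k : ℕ, algebraMap TSeries K
      (2 * MvPowerSeries.pderiv ℂ k (MvPowerSeries.pderiv ℂ 0 τ * τ⁻¹)) =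
    -(W.laxPow (2 * k + 1)).res

/-- The elementary Darboux operator of differential type, `T_D(q) = q ∂ q^{-1}`. -/
noncomputable def darbouxD (q : K) : PDO := PDO.mono q 0 * PDO.mono 1 1 * PDO.mono q⁻¹ 0

/-- The elementary Darboux operator of integral type, `T_I(r) = r^{-1} ∂^{-1} r`. -/
noncomputable def darbouxI (r : K) : PDO := PDO.mono r⁻¹ 0 * PDO.mono 1 (-1) * PDO.mono r 0

/-- The binary Darboux operator `T(q, r) = T_I(r^{(1)}) T_D(q)`.  Here `r^{(1)} = -Ω / q` is the
image of the adjoint eigenfunction `r` under `T_D(q)`, and `Ω` is the chosen squared eigenfunction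
potential `Ω(q, r)`, through which `T(q, r)` depends on `r`. -/
noncomputable def darboux (q Ω : K) : PDO := darbouxI (-Ω / q) * darbouxD q

/-- The operator `β² / 2`. -/
noncomputable def halfSq (b : ℤ →₀ ℂ) (f : Fock) : Fock := (1 / 2 : ℂ) • field b (field b f)

end CKP

/-! Everything follows from one bilinear identity. Let `bil f h` be the formal tensor ∑ (-1)^k
φ_{k+1/2} f ⊗ φ_{-k-1/2} h. It behaves like a Casimir element: for a quadratic operator A with
symmetric band kernel it intertwines A ⊗ 1 + 1 ⊗ A (`bil_quad`). It vanishes on |0⟩ ⊗ |0⟩, hence on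
u ⊗ u for every u = g|0⟩ (`SpVac.bil_self`), and also after applying e^{H(t)}, because the H_n are
quadratic (`expBil_eq`).

The identity says that e^{H(t)} u is a Gaussian τ exp(½ ∑ B_{ij} X_i X_j), and it gives Wick's
theorem for its correlators. Commuting β through it expresses `bil (β^a u) u` and `bil (β^a u) (β
u)` by decomposable tensors (`bil_iterate_field`, `bil_iterate_field_iterate_field`). Their vacuum
components are the Gaussian moment recursion ⟨β^{m+2}⟩ = (m+1) Ω ⟨β^m⟩ with Ω = ⟨β²⟩/τ, which
produces the double factorials.

A derivative in t_{2k+1} inserts H_{2k+1}, which against ⟨0| is ½ ∑ (-1)^i ∂_i ∂_{2k-i}. With Wick's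
theorem this becomes a closed system (`pderiv_bmat`, `pderiv_cvec`, `pderiv_omega`): matrix Riccati
equations for B, linear equations for c_i = ⟨∂_i β⟩/τ, and Ω_{t_{2k+1}} = ∑ (-1)^r c_r c_{2k-r}.
Moreover W = 1 + ∑ (-1)^j B_{0j} ∂^{-j-1}, q = c_0 and B_{00} = 2 ∂ log τ.

The rest of the hierarchy is algebra of pseudo-differential operators. There are differential
operators P_a with P_a W = ∂^a + (terms of negative order) and P_a(c_0) = c_a. They give
(L^{2k+1})_{≥0} explicitly (`laxPos_mul_dressB`), and from it the tau function, the eigenfunction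
and the potential.

The n-th term of e^{β²/2} u has vacuum expectation a_n Ω^n τ, with a_n the coefficients of
(1-x)^{-1/2}. Since a_n ≥ 1/(2n) for n ≥ 1, convergence forces |Ω(0)| < 1. Conversely, the bilinear
identity bounds the coefficients of all basis vectors by induction on the degree
(`rapid_coeff_expTerm`). Squaring ∑ a_n Ω^n gives (τ^{[1]})² (1-Ω) = τ². The transformation changes
B to B + c cᵀ/(1-Ω) in row 0 (`bmat_hasExp`), and this is what T(q) does to W
(`darboux_mul_dressB`). As β²/2 represents an element of c_∞, the result on tau functions applies to
the new vector. -/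

open MvPowerSeries
open Finset.HasAntidiagonal (antidiagonal mem_antidiagonal)

namespace CKP

/-! ### Coefficients of the bosons -/

/-- The monomial `m` contains only the variables `X n` with `n < L`. -/
def Below (L : ℕ) (m : ℕ →₀ ℕ) : Prop := ∀ n, L ≤ n → m n = 0

theorem Below.mono {L L' : ℕ} {m : ℕ →₀ ℕ} (h : Below L m) (hL : L ≤ L') : Below L' m :=
  fun n hn => h n (hL.trans hn)

/-- A bound for the variables of a monomial. -/
def bd (m : ℕ →₀ ℕ) : ℕ := m.support.sup id + 1

theorem below_bd (m : ℕ →₀ ℕ) : Below (bd m) m := by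
  intro n hn
  by_contra h
  have := Finset.le_sup (f := id) (Finsupp.mem_support_iff.mpr h)
  simp only [id, bd] at this hn
  omega

theorem phi_natCast (n : ℕ) (f : Fock) : phi n f = X n * f := rfl

theorem phi_neg_succ (n : ℕ) (f : Fock) :
    phi (-(n : ℤ) - 1) f = (-1 : ℂ) ^ n • pderiv ℂ n f := by
  have : (-(n : ℤ) - 1) = Int.negSucc n := by simp [Int.negSucc_eq]; ring
  rw [this]; rfl

theorem coeff_X_mul_eq (n : ℕ) (f : Fock) (m : ℕ →₀ ℕ) :
    coeff m (X n * f) = if m n = 0 then 0 else coeff (m - Finsupp.single n 1) f := by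
  classical
  rw [X_def, coeff_monomial_mul]
  by_cases h : m n = 0
  · rw [if_neg, if_pos h]
    intro h'
    have := h' n
    simp [h] at this
  · rw [if_pos, if_neg h, one_mul]
    intro j
    by_cases hj : n = j
    · subst hj; simp; omega
    · simp [hj]

theorem coeff_phi_of_le {L : ℕ} {m : ℕ →₀ ℕ} (hm : Below L m) {k : ℤ} (hk : L ≤ k) (f : Fock) :
    coeff m (phi k f) = 0 := by
  lift k to ℕ using by omega
  rw [phi_natCast, coeff_X_mul_eq, if_pos (hm k (by exact_mod_cast hk))]

/-- Locality: such a mode neither introduces nor differentiates a variable X n with n ≥ L. This and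
`coeff_phi_of_le` replace infinite sums over modes by finite ones, one coefficient at a time. -/
theorem coeff_phi_congr {L : ℕ} {m : ℕ →₀ ℕ} (hm : Below L m) {k : ℤ} (hk : -L ≤ k) {f g : Fock}
    (hfg : ∀ m, Below L m → coeff m f = coeff m g) :
    coeff m (phi k f) = coeff m (phi k g) := by
  rcases le_or_gt 0 k with h | h
  · lift k to ℕ using h
    rw [phi_natCast, phi_natCast, coeff_X_mul_eq, coeff_X_mul_eq, hfg]
    intro n hn
    simp [hm n hn]
  · obtain ⟨n, rfl⟩ : ∃ n : ℕ, k = -(n : ℤ) - 1 := ⟨(-k - 1).toNat, by omega⟩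
    simp only [phi_neg_succ, map_smul, coeff_pderiv]
    rw [hfg]
    intro j hj
    have : n ≠ j := by omega
    simp [hm j hj, this]

theorem vac_phi_nonneg {k : ℤ} (hk : 0 ≤ k) (f : Fock) : vac (phi k f) = 0 := by
  lift k to ℕ using hk
  exact vac_phi k f

theorem phi_one_neg {k : ℤ} (hk : k < 0) : phi k 1 = 0 := by
  obtain ⟨n, rfl⟩ : ∃ n : ℕ, k = Int.negSucc n := ⟨(-k - 1).toNat, by
    rw [Int.negSucc_eq]; omega⟩
  exact phi_one n

theorem neg_one_zpow_mul_self (k : ℤ) : (-1 : ℂ) ^ k * (-1) ^ k = 1 := by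
  rw [← mul_zpow]; simp

theorem neg_one_zpow_neg_sub (k : ℤ) : (-1 : ℂ) ^ (-k - 1) = -(-1) ^ k := by
  rw [zpow_sub₀ (by simp), zpow_neg, zpow_one]
  have := neg_one_zpow_mul_self k
  rw [inv_eq_of_mul_eq_one_left this, div_neg, div_one]

/-! ### Quadratic operators -/

/-- The operator `(1/2) ∑ N_{k,l} :φ_{k+1/2} φ_{l+1/2}: + c`. -/
noncomputable def quad (N : ℤ → ℤ → ℂ) (c : ℂ) (f : Fock) : Fock := fun m =>
  (1 / 2) * (∑ᶠ p : ℤ × ℤ, N p.1 p.2 * coeff m (normalOrd p.1 p.2 f)) + c * coeff m f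

/-- The box of the modes that act on the variables `X n` with `n < L`. -/
noncomputable def box (L : ℕ) : Finset ℤ := Finset.Ico (-L : ℤ) L

theorem mem_box {L : ℕ} {k : ℤ} : k ∈ box L ↔ -(L : ℤ) ≤ k ∧ k < L := Finset.mem_Ico

theorem neg_sub_mem_box {L : ℕ} {k : ℤ} : -k - 1 ∈ box L ↔ k ∈ box L := by
  rw [mem_box, mem_box]; omega

theorem sum_box_reflect {M : Type*} [AddCommMonoid M] (L : ℕ) (F : ℤ → M) :
    ∑ k ∈ box L, F (-k - 1) = ∑ k ∈ box L, F k := by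
  apply Finset.sum_bij' (fun k _ => -k - 1) (fun k _ => -k - 1)
  · intro k _; ring
  · intro k _; ring
  · intro k _; rfl
  · intro k hk; exact neg_sub_mem_box.mpr hk
  · intro k hk; exact neg_sub_mem_box.mpr hk

/-- The part of `quad N c` with modes in a box. -/
noncomputable def quadBox (N : ℤ → ℤ → ℂ) (c : ℂ) (L : ℕ) : Fock →ₗ[ℂ] Fock :=
  (1 / 2 : ℂ) • ∑ k ∈ box L, ∑ l ∈ box L, N k l • ((phi k).comp (phi l) -
    vac (phi k (phi l 1)) • LinearMap.id) + c • LinearMap.id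

theorem quadBox_apply (N : ℤ → ℤ → ℂ) (c : ℂ) (L : ℕ) (f : Fock) :
    quadBox N c L f = (1 / 2 : ℂ) • ∑ k ∈ box L, ∑ l ∈ box L, N k l • normalOrd k l f + c • f := by
  simp [quadBox, normalOrd, LinearMap.sum_apply]

/-- The kernel `N` is a band matrix around the antidiagonal `k + l = -1`. -/
def Band (N : ℤ → ℤ → ℂ) (M : ℕ) : Prop := ∀ k l, N k l ≠ 0 → |k + l + 1| ≤ M

/-- The subtracted vacuum expectation is exactly the commutator, so normal ordering moves the
annihilation operator to the right. -/
theorem normalOrd_eq_of_neg {k l : ℤ} (hk : k < 0) (f : Fock) :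
    normalOrd k l f = phi l (phi k f) := by
  have h1 := phi_comm k l f
  have h2 := phi_comm k l 1
  rw [phi_one_neg hk, map_zero, sub_zero] at h2
  rw [normalOrd, h2]
  rw [sub_eq_iff_eq_add] at h1
  rw [h1]
  split_ifs
  · simp [vac]
  · simp [vac]

theorem normalOrd_eq_of_nonneg {k l : ℤ} (hk : 0 ≤ k) (f : Fock) :
    normalOrd k l f = phi k (phi l f) := by
  rw [normalOrd, vac_phi_nonneg hk, zero_smul, sub_zero]

/-- A creation mode with index at least L on the left kills the coefficient. The band condition then
bounds the other mode from below, which accounts for the enlargement of the box by M + 1. -/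
theorem normalOrd_support {N : ℤ → ℤ → ℂ} {M : ℕ} (hN : Band N M) {L : ℕ} {m : ℕ →₀ ℕ}
    (hm : Below L m) (f : Fock) {k l : ℤ} (h : N k l * coeff m (normalOrd k l f) ≠ 0) :
    k ∈ box (L + M + 1) ∧ l ∈ box (L + M + 1) := by
  have h1 := abs_le.mp (hN k l (left_ne_zero_of_mul h))
  have h2 := right_ne_zero_of_mul h
  rw [mem_box, mem_box]
  push_cast
  rcases le_or_gt 0 k with hk | hk
  · have : k < L := by
      by_contra hlt
      exact h2 (by rw [normalOrd_eq_of_nonneg hk, coeff_phi_of_le hm (by omega)])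
    omega
  · rcases le_or_gt 0 l with hl | hl
    · have : l < L := by
        by_contra hlt
        exact h2 (by rw [normalOrd_eq_of_neg hk, coeff_phi_of_le hm (by omega)])
      omega
    · omega

theorem coeff_quad {N : ℤ → ℤ → ℂ} {M : ℕ} (hN : Band N M) (c : ℂ) {L : ℕ} {m : ℕ →₀ ℕ}
    (hm : Below L m) (f : Fock) :
    coeff m (quad N c f) = coeff m (quadBox N c (L + M + 1) f) := by
  change (1 / 2) * (∑ᶠ p : ℤ × ℤ, N p.1 p.2 * coeff m (normalOrd p.1 p.2 f)) + c * coeff m f = _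
  rw [finsum_eq_sum_of_support_subset (s := box (L + M + 1) ×ˢ box (L + M + 1)),
    Finset.sum_product, quadBox_apply]
  · simp [map_sum]
  · intro p hp
    have := normalOrd_support hN hm f hp
    simpa using this

theorem coeff_quadBox_congr (N : ℤ → ℤ → ℂ) (c : ℂ) {L : ℕ} {m : ℕ →₀ ℕ} (hm : Below L m)
    {f g : Fock} (hfg : ∀ m, Below L m → coeff m f = coeff m g) :
    coeff m (quadBox N c L f) = coeff m (quadBox N c L g) := by
  simp only [quadBox_apply, normalOrd, map_add, map_smul, map_sum, map_sub, hfg m hm]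
  congr 2
  refine Finset.sum_congr rfl fun k hk => Finset.sum_congr rfl fun l hl => ?_
  rw [coeff_phi_congr hm (mem_box.mp hk).1 fun m' hm' =>
    coeff_phi_congr hm' (mem_box.mp hl).1 hfg]

theorem quad_add {N : ℤ → ℤ → ℂ} {M : ℕ} (hN : Band N M) (c : ℂ) (f g : Fock) :
    quad N c (f + g) = quad N c f + quad N c g := by
  ext m
  simp only [map_add, coeff_quad hN c (below_bd m)]

theorem quad_smul {N : ℤ → ℤ → ℂ} {M : ℕ} (hN : Band N M) (c : ℂ) (r : ℂ) (f : Fock) :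
    quad N c (r • f) = r • quad N c f := by
  ext m
  simp only [map_smul, coeff_quad hN c (below_bd m)]

theorem normalOrd_phi (k l n : ℤ) (f : Fock) :
    normalOrd k l (phi n f) = phi n (normalOrd k l f) +
      ((if k + n + 1 = 0 then (-1 : ℂ) ^ n • phi l f else 0) +
        (if l + n + 1 = 0 then (-1 : ℂ) ^ n • phi k f else 0)) := by
  have h1 := phi_comm l n f
  have h2 := phi_comm k n (phi l f)
  rw [sub_eq_iff_eq_add'] at h1 h2
  rw [normalOrd, h1, map_add, h2, normalOrd, map_sub, map_smul]
  split_ifs <;> simp <;> abel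

/-- Each of the two modes of A can be contracted with φ_n. The two contributions agree by symmetry
of the kernel, which cancels the factor 1/2: [A, φ_n] is linear in the modes. -/
theorem quadBox_phi {N : ℤ → ℤ → ℂ} (hs : ∀ k l, N k l = N l k) (c : ℂ) {L : ℕ} {n : ℤ}
    (hn : n ∈ box L) (f : Fock) :
    quadBox N c L (phi n f) = phi n (quadBox N c L f) +
      (-1 : ℂ) ^ n • ∑ j ∈ box L, N j (-n - 1) • phi j f := by
  have e : ∀ k : ℤ, k + n + 1 = 0 ↔ k = -n - 1 := fun k => by omega
  simp only [quadBox_apply, normalOrd_phi, smul_add, map_add, map_smul, map_sum, e,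
    Finset.sum_add_distrib, smul_ite, smul_zero, Finset.sum_ite_eq', neg_sub_mem_box, hn, if_true]
  rw [Finset.sum_comm (f := fun k l => if k = -n - 1 then N k l • (-1 : ℂ) ^ n • phi l f else 0)]
  simp only [Finset.sum_ite_eq', neg_sub_mem_box, hn, if_true]
  have : ∑ y ∈ box L, N (-n - 1) y • (-1 : ℂ) ^ n • (phi y) f =
      ∑ x ∈ box L, N x (-n - 1) • (-1 : ℂ) ^ n • (phi x) f :=
    Finset.sum_congr rfl fun y _ => by rw [hs]
  rw [this, Finset.smul_sum (r := (-1 : ℂ) ^ n)]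
  simp only [smul_comm ((-1 : ℂ) ^ n)]
  rw [← add_smul]
  norm_num
  abel

theorem quad_phi {N : ℤ → ℤ → ℂ} {M : ℕ} (hN : Band N M) (hs : ∀ k l, N k l = N l k) (c : ℂ)
    (n : ℤ) (f : Fock) :
    quad N c (phi n f) = phi n (quad N c f) +
      (-1 : ℂ) ^ n • ∑ j ∈ Finset.Icc (n - M) (n + M), N j (-n - 1) • phi j f := by
  ext m
  set L := bd m + n.natAbs + 1 with hL
  have hm : Below L m := (below_bd m).mono (by omega)
  have hn : n ∈ box (L + M + 1) := mem_box.mpr (by omega)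
  have h : coeff m (phi n (quad N c f)) = coeff m (phi n (quadBox N c (L + M + 1) f)) :=
    coeff_phi_congr hm (by omega) fun m' hm' => coeff_quad hN c hm' f
  rw [coeff_quad hN c hm, quadBox_phi hs c hn, map_add, map_add, h]
  congr 3
  symm
  apply Finset.sum_subset
  · intro j hj
    rw [Finset.mem_Icc] at hj
    rw [mem_box]; omega
  · intro j _ hj
    rw [Finset.mem_Icc] at hj
    by_cases h0 : N j (-n - 1) = 0
    · rw [h0, zero_smul]
    · have := abs_le.mp (hN _ _ h0)
      omega

/-! ### The bilinear form -/

/-- Formal tensors: `T m'` is the coefficient of the monomial `m'` in the second factor. -/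
abbrev Ten : Type := (ℕ →₀ ℕ) → Fock

/-- Interchange of the two factors. -/
def Ten.swap (T : Ten) : Ten := fun m m' => T m' m

theorem Ten.coeff_swap (T : Ten) (m m' : ℕ →₀ ℕ) : coeff m (T.swap m') = coeff m' (T m) := rfl

/-- The tensor product of two vectors. -/
noncomputable def tmul (f h : Fock) : Ten := fun m' => coeff m' h • f

theorem swap_tmul (f h : Fock) : (tmul f h).swap = tmul h f := by
  ext m' m
  rw [Ten.coeff_swap, tmul, tmul, map_smul, map_smul, smul_eq_mul, smul_eq_mul, mul_comm]

/-- The action `A ⊗ 1`. -/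
def op1 (A : Fock → Fock) (T : Ten) : Ten := fun m' => A (T m')

/-- The action `1 ⊗ A`. -/
def op2 (A : Fock → Fock) (T : Ten) : Ten := (op1 A T.swap).swap

/-- `∑_{k ∈ box L} (-1)^k φ_{k+1/2} f ⊗ φ_{-k-1/2} h`. -/
noncomputable def bilBox (L : ℕ) (f h : Fock) : Ten := fun m' =>
  ∑ k ∈ box L, ((-1 : ℂ) ^ k * coeff m' (phi (-k - 1) h)) • phi k f

/-- `∑_k (-1)^k φ_{k+1/2} f ⊗ φ_{-k-1/2} h`. -/
noncomputable def bil (f h : Fock) : Ten := fun m' m => coeff m (bilBox (bd m + bd m') f h m')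

theorem coeff_bilBox (L : ℕ) (f h : Fock) (m m' : ℕ →₀ ℕ) : coeff m (bilBox L f h m') =
    ∑ k ∈ box L, (-1 : ℂ) ^ k * coeff m' (phi (-k - 1) h) * coeff m (phi k f) := by
  simp [bilBox, map_sum]

/-- Outside the box one of k and -k-1 is a creation index at least L, so one of the two factors has
no such coefficient. This makes `bil` well defined. -/
theorem coeff_bilBox_mono {L L' : ℕ} (hL : L ≤ L') (f h : Fock) {m m' : ℕ →₀ ℕ} (hm : Below L m)
    (hm' : Below L m') : coeff m (bilBox L f h m') = coeff m (bilBox L' f h m') := by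
  rw [coeff_bilBox, coeff_bilBox]
  apply Finset.sum_subset
  · intro k hk
    rw [mem_box] at hk ⊢
    omega
  · intro k _ hk
    rw [mem_box] at hk
    rcases le_or_gt (L : ℤ) k with h | h
    · rw [coeff_phi_of_le hm h, mul_zero]
    · rw [coeff_phi_of_le hm' (by omega), mul_zero, zero_mul]

theorem coeff_bil {L : ℕ} (f h : Fock) {m m' : ℕ →₀ ℕ} (hm : Below L m) (hm' : Below L m') :
    coeff m (bil f h m') = coeff m (bilBox L f h m') := by
  change coeff m (bilBox (bd m + bd m') f h m') = _
  rw [coeff_bilBox_mono (le_max_left _ L) f h ((below_bd m).mono (by omega))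
    ((below_bd m').mono (by omega)), coeff_bilBox_mono (le_max_right (bd m + bd m') L) f h hm hm']

/-- The reflection k ↦ -k-1 changes the sign (-1)^k. -/
theorem swap_bilBox (L : ℕ) (f h : Fock) : (bilBox L f h).swap = -bilBox L h f := by
  ext m' m
  rw [Ten.coeff_swap, Pi.neg_apply, map_neg, coeff_bilBox, coeff_bilBox, ← sum_box_reflect,
    ← Finset.sum_neg_distrib]
  refine Finset.sum_congr rfl fun k _ => ?_
  rw [neg_one_zpow_neg_sub, show -(-k - 1) - 1 = k by ring]
  ring

theorem swap_bil (f h : Fock) : (bil f h).swap = -bil h f := by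
  ext m' m
  have h1 : Below (bd m + bd m') m := (below_bd m).mono (by omega)
  have h2 : Below (bd m + bd m') m' := (below_bd m').mono (by omega)
  rw [Ten.coeff_swap, coeff_bil f h h2 h1, Pi.neg_apply, map_neg, coeff_bil h f h1 h2,
    ← Ten.coeff_swap, swap_bilBox, Pi.neg_apply, map_neg]

theorem vac_bil (f h : Fock) : coeff 0 (bil f h 0) = 0 := by
  rw [coeff_bil (L := 0) f h (fun _ _ => rfl) (fun _ _ => rfl), coeff_bilBox]
  simp [box]

theorem bilBox_phi {L : ℕ} {l : ℤ} (hl : l ∈ box L) (f h : Fock) :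
    bilBox L (phi l f) h = op1 (phi l) (bilBox L f h) - tmul f (phi l h) := by
  funext m'
  simp only [bilBox, op1, Pi.sub_apply, tmul, map_sum, map_smul]
  rw [eq_sub_iff_add_eq, eq_comm, ← sub_eq_iff_eq_add', ← Finset.sum_sub_distrib]
  have : ∀ k, ((-1 : ℂ) ^ k * coeff m' (phi (-k - 1) h)) • phi l (phi k f) -
      ((-1 : ℂ) ^ k * coeff m' (phi (-k - 1) h)) • phi k (phi l f) =
      if k = -l - 1 then coeff m' (phi l h) • f else 0 := by
    intro k
    rw [← smul_sub, phi_comm]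
    by_cases hk : k = -l - 1
    · rw [if_pos hk, if_pos (by omega), smul_smul, hk, show -(-l - 1) - 1 = l by ring,
        mul_right_comm, neg_one_zpow_mul_self, one_mul]
    · rw [if_neg hk, if_neg (by omega), smul_zero]
  simp only [this, Finset.sum_ite_eq', neg_sub_mem_box, hl, if_true]

theorem bil_phi (l : ℤ) (f h : Fock) :
    bil (phi l f) h = op1 (phi l) (bil f h) - tmul f (phi l h) := by
  ext m' m
  set L := bd m + bd m' + l.natAbs + 1 with hL
  have h1 : Below L m := (below_bd m).mono (by omega)
  have h2 : Below L m' := (below_bd m').mono (by omega)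
  rw [coeff_bil _ _ h1 h2, bilBox_phi (mem_box.mpr (by omega)), Pi.sub_apply, Pi.sub_apply,
    map_sub, map_sub]
  congr 1
  exact coeff_phi_congr h1 (by omega) fun m'' hm'' => (coeff_bil f h hm'' h2).symm

/-- The commutators of A with φ_k in the first factor and with φ_{-k-1} in the second are double
sums over modes. They cancel after the reflection k ↦ -k-1 because the kernel is symmetric. Working
in a box keeps every rearrangement finite. -/
theorem bilBox_quadBox {N : ℤ → ℤ → ℂ} (hs : ∀ k l, N k l = N l k) (c : ℂ) (L : ℕ) (f h : Fock) :
    bilBox L (quadBox N c L f) h + bilBox L f (quadBox N c L h) =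
      op1 (quadBox N c L) (bilBox L f h) + op2 (quadBox N c L) (bilBox L f h) := by
  have e2 : op2 (quadBox N c L) (bilBox L f h) = fun m' => ∑ k ∈ box L,
      ((-1 : ℂ) ^ k * coeff m' (quadBox N c L (phi (-k - 1) h))) • phi k f := by
    ext m' m
    have : (bilBox L f h).swap m = ∑ k ∈ box L,
        ((-1 : ℂ) ^ k * coeff m (phi k f)) • phi (-k - 1) h := by
      ext m''
      rw [Ten.coeff_swap, coeff_bilBox, map_sum]
      refine Finset.sum_congr rfl fun k _ => ?_
      rw [map_smul, smul_eq_mul]; ring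
    rw [op2, Ten.coeff_swap, op1, this, map_sum, map_sum, map_sum]
    refine Finset.sum_congr rfl fun k _ => ?_
    simp only [map_smul, smul_eq_mul]; ring
  funext m'
  rw [e2]
  simp only [bilBox, op1, Pi.add_apply, map_sum, map_smul]
  have h1 : ∀ k ∈ box L, ((-1 : ℂ) ^ k * coeff m' (phi (-k - 1) h)) • quadBox N c L (phi k f) =
      ((-1 : ℂ) ^ k * coeff m' (phi (-k - 1) h)) • phi k (quadBox N c L f) +
      ∑ j ∈ box L, (N j (-k - 1) * coeff m' (phi (-k - 1) h)) • phi j f := by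
    intro k hk
    rw [quadBox_phi hs c hk, smul_add, smul_smul, mul_right_comm, neg_one_zpow_mul_self, one_mul,
      Finset.smul_sum]
    congr 1
    refine Finset.sum_congr rfl fun j _ => ?_
    rw [smul_smul, mul_comm]
  have h2 : ∀ k ∈ box L, ((-1 : ℂ) ^ k * coeff m' (quadBox N c L (phi (-k - 1) h))) • phi k f =
      ((-1 : ℂ) ^ k * coeff m' (phi (-k - 1) (quadBox N c L h))) • phi k f -
      ∑ j ∈ box L, (N j k * coeff m' (phi j h)) • phi k f := by
    intro k hk
    rw [quadBox_phi hs c (neg_sub_mem_box.mpr hk), map_add, map_smul, mul_add, add_smul,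
      smul_eq_mul, ← mul_assoc, neg_one_zpow_neg_sub, mul_neg, neg_one_zpow_mul_self, map_sum,
      show -(-k - 1) - 1 = k by ring, ← Finset.sum_smul]
    simp [sub_eq_add_neg]
  rw [Finset.sum_congr rfl h1, Finset.sum_congr rfl h2, Finset.sum_add_distrib,
    Finset.sum_sub_distrib]
  have h3 := sum_box_reflect L fun k => ∑ j ∈ box L, (N j k * coeff m' (phi k h)) • phi j f
  rw [h3, Finset.sum_comm (s := box L)]
  have h4 : ∑ y ∈ box L, ∑ x ∈ box L, (N y x * coeff m' (phi x h)) • phi y f =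
      ∑ y ∈ box L, ∑ x ∈ box L, (N x y * coeff m' (phi x h)) • phi y f :=
    Finset.sum_congr rfl fun y _ => Finset.sum_congr rfl fun x _ => by rw [hs]
  rw [h4]
  abel

/-- The invariance of the bilinear form under the symplectic Lie algebra. It is used for c_∞ and
again for the Heisenberg operators. -/
theorem bil_quad {N : ℤ → ℤ → ℂ} {M : ℕ} (hN : Band N M) (hs : ∀ k l, N k l = N l k) (c : ℂ)
    (f h : Fock) :
    bil (quad N c f) h + bil f (quad N c h) =
      op1 (quad N c) (bil f h) + op2 (quad N c) (bil f h) := by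
  ext m' m
  set L := bd m + bd m' with hL
  have h1 : Below L m := (below_bd m).mono (by omega)
  have h2 : Below L m' := (below_bd m').mono (by omega)
  have h1' : Below (L + M + 1) m := h1.mono (by omega)
  have h2' : Below (L + M + 1) m' := h2.mono (by omega)
  have key := congrArg (coeff m) (congrFun (bilBox_quadBox hs c (L + M + 1) f h) m')
  have left1 : ∀ f h, coeff m (bil (quad N c f) h m') =
      coeff m (bilBox (L + M + 1) (quadBox N c (L + M + 1) f) h m') := by
    intro f h
    rw [← coeff_bilBox_mono (by omega : L ≤ L + M + 1) _ _ h1 h2, coeff_bil _ _ h1 h2,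
      coeff_bilBox, coeff_bilBox]
    refine Finset.sum_congr rfl fun k hk => ?_
    rw [coeff_phi_congr h1 (mem_box.mp hk).1 fun m'' hm'' => coeff_quad hN c hm'' f]
  have left2 : ∀ f h, coeff m (bil f (quad N c h) m') =
      coeff m (bilBox (L + M + 1) f (quadBox N c (L + M + 1) h) m') := by
    intro f h
    rw [← coeff_bilBox_mono (by omega : L ≤ L + M + 1) _ _ h1 h2, coeff_bil _ _ h1 h2,
      coeff_bilBox, coeff_bilBox]
    refine Finset.sum_congr rfl fun k hk => ?_
    rw [coeff_phi_congr h2 (mem_box.mp (neg_sub_mem_box.mpr hk)).1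
      fun m'' hm'' => coeff_quad hN c hm'' h]
  rw [Pi.add_apply, map_add, left1, left2, ← map_add, ← Pi.add_apply, key]
  simp only [Pi.add_apply, map_add, op2, Ten.coeff_swap, op1]
  rw [coeff_quad hN c h1, coeff_quad hN c h2]
  congr 1
  · exact coeff_quadBox_congr N c h1' fun m'' hm'' => (coeff_bil f h hm'' h2').symm
  · exact coeff_quadBox_congr N c h2' fun m'' hm'' => (coeff_bil f h h1' hm'').symm

/-- `quad` as a linear map. -/
noncomputable def quadLin {N : ℤ → ℤ → ℂ} {M : ℕ} (hN : Band N M) (c : ℂ) : Fock →ₗ[ℂ] Fock where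
  toFun := quad N c
  map_add' := quad_add hN c
  map_smul' := quad_smul hN c

theorem op1_zero (A : Fock →ₗ[ℂ] Fock) : op1 A 0 = 0 := by
  funext m'; exact map_zero A

theorem op2_zero (A : Fock →ₗ[ℂ] Fock) : op2 A 0 = 0 := by
  have : Ten.swap (0 : Ten) = 0 := rfl
  rw [op2, this, op1_zero]; rfl

theorem op1_add (A : Fock →ₗ[ℂ] Fock) (S T : Ten) : op1 A (S + T) = op1 A S + op1 A T := by
  funext m'; exact map_add A _ _

theorem op1_smul (A : Fock →ₗ[ℂ] Fock) (r : ℂ) (T : Ten) : op1 A (r • T) = r • op1 A T := by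
  funext m'; exact map_smul A r _

theorem op2_add (A : Fock →ₗ[ℂ] Fock) (S T : Ten) : op2 A (S + T) = op2 A S + op2 A T := by
  have : (S + T).swap = S.swap + T.swap := rfl
  rw [op2, this, op1_add]; rfl

theorem op2_smul (A : Fock →ₗ[ℂ] Fock) (r : ℂ) (T : Ten) : op2 A (r • T) = r • op2 A T := by
  have : (r • T).swap = r • T.swap := rfl
  rw [op2, this, op1_smul]; rfl

theorem op1_sum {ι : Type*} (A : Fock →ₗ[ℂ] Fock) (s : Finset ι) (T : ι → Ten) :
    op1 A (∑ i ∈ s, T i) = ∑ i ∈ s, op1 A (T i) := by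
  classical
  induction s using Finset.induction_on with
  | empty => exact op1_zero A
  | insert i s hi ih => rw [Finset.sum_insert hi, Finset.sum_insert hi, op1_add, ih]

theorem op2_sum {ι : Type*} (A : Fock →ₗ[ℂ] Fock) (s : Finset ι) (T : ι → Ten) :
    op2 A (∑ i ∈ s, T i) = ∑ i ∈ s, op2 A (T i) := by
  classical
  induction s using Finset.induction_on with
  | empty => exact op2_zero A
  | insert i s hi ih => rw [Finset.sum_insert hi, Finset.sum_insert hi, op2_add, ih]

theorem op1_tmul (A : Fock →ₗ[ℂ] Fock) (f h : Fock) : op1 A (tmul f h) = tmul (A f) h := by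
  funext m'; exact map_smul A _ _

theorem op2_tmul (A : Fock →ₗ[ℂ] Fock) (f h : Fock) : op2 A (tmul f h) = tmul f (A h) := by
  rw [op2, swap_tmul, op1_tmul, swap_tmul]

theorem tmul_smul_left (r : ℂ) (f h : Fock) : tmul (r • f) h = r • tmul f h := by
  funext m'; exact smul_comm _ r f

theorem tmul_smul_right (r : ℂ) (f h : Fock) : tmul f (r • h) = r • tmul f h := by
  funext m'; simp [tmul, smul_smul]

theorem bil_add_left (f g h : Fock) : bil (f + g) h = bil f h + bil g h := by
  ext m' m
  have h1 : Below (bd m + bd m') m := (below_bd m).mono (by omega)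
  have h2 : Below (bd m + bd m') m' := (below_bd m').mono (by omega)
  simp [coeff_bil _ _ h1 h2, coeff_bilBox, mul_add, Finset.sum_add_distrib]

theorem bil_smul_left (r : ℂ) (f h : Fock) : bil (r • f) h = r • bil f h := by
  ext m' m
  have h1 : Below (bd m + bd m') m := (below_bd m).mono (by omega)
  have h2 : Below (bd m + bd m') m' := (below_bd m').mono (by omega)
  simp only [Pi.smul_apply, map_smul, coeff_bil _ _ h1 h2, coeff_bilBox, smul_eq_mul,
    Finset.mul_sum]
  exact Finset.sum_congr rfl fun k _ => by ring

theorem bil_eq_neg_swap (f h : Fock) : bil f h = -(bil h f).swap := by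
  rw [swap_bil, neg_neg]

theorem bil_smul_right (r : ℂ) (f h : Fock) : bil f (r • h) = r • bil f h := by
  rw [bil_eq_neg_swap, bil_smul_left, bil_eq_neg_swap f h, smul_neg]
  rfl

/-! ### Coefficientwise convergent series of vectors -/

/-- The series `∑ s n` of vectors converges coefficientwise to `f`. -/
def HasSumF (s : ℕ → Fock) (f : Fock) : Prop :=
  ∀ m, HasSum (fun n => coeff m (s n)) (coeff m f)

theorem HasSumF.phi {s : ℕ → Fock} {f : Fock} (h : HasSumF s f) (k : ℤ) :
    HasSumF (fun n => phi k (s n)) (phi k f) := by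
  intro m
  rcases le_or_gt 0 k with hk | hk
  · lift k to ℕ using hk
    simp only [phi_natCast, coeff_X_mul_eq]
    split_ifs
    · exact hasSum_zero
    · exact h _
  · obtain ⟨n, rfl⟩ : ∃ n : ℕ, k = -(n : ℤ) - 1 := ⟨(-k - 1).toNat, by omega⟩
    simp only [phi_neg_succ, map_smul, coeff_pderiv, smul_eq_mul]
    exact ((h _).mul_right _).mul_left _

theorem HasSumF.add {s t : ℕ → Fock} {f g : Fock} (h : HasSumF s f) (h' : HasSumF t g) :
    HasSumF (fun n => s n + t n) (f + g) := by
  intro m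
  simpa using (h m).add (h' m)

theorem HasSumF.smul {s : ℕ → Fock} {f : Fock} (h : HasSumF s f) (r : ℂ) :
    HasSumF (fun n => r • s n) (r • f) := by
  intro m
  simpa using (h m).mul_left r

theorem HasSumF.sum {ι : Type*} {s : ι → ℕ → Fock} {f : ι → Fock} {I : Finset ι}
    (h : ∀ i ∈ I, HasSumF (s i) (f i)) :
    HasSumF (fun n => ∑ i ∈ I, s i n) (∑ i ∈ I, f i) := by
  intro m
  simp only [map_sum]
  exact hasSum_sum fun i hi => h i hi m

theorem HasSumF.quad {s : ℕ → Fock} {f : Fock} (h : HasSumF s f) {N : ℤ → ℤ → ℂ} {M : ℕ}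
    (hN : Band N M) (c : ℂ) : HasSumF (fun n => quad N c (s n)) (quad N c f) := by
  intro m
  simp only [coeff_quad hN c (below_bd m), quadBox_apply]
  refine (((HasSumF.sum fun k _ => HasSumF.sum fun l _ => ?_).smul _).add (h.smul c)) m
  refine HasSumF.smul ?_ _
  have := ((h.phi l).phi k).add (h.smul (-vac (CKP.phi k (CKP.phi l 1))))
  simpa only [normalOrd, sub_eq_add_neg, neg_smul] using this

theorem hasSum_cauchy {f g : ℕ → ℂ} {a b : ℂ} (hf : HasSum f a) (hg : HasSum g b) :
    HasSum (fun n => ∑ p ∈ antidiagonal n, f p.1 * g p.2) (a * b) := by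
  have h1 := hf.summable.norm
  have h2 := hg.summable.norm
  have h3 := (summable_norm_sum_mul_antidiagonal_of_summable_norm h1 h2).of_norm.hasSum
  rwa [← tsum_mul_tsum_eq_tsum_sum_antidiagonal_of_summable_norm h1 h2, hf.tsum_eq,
    hg.tsum_eq] at h3

theorem HasSumF.bil {s t : ℕ → Fock} {f h : Fock} (hs : HasSumF s f) (ht : HasSumF t h)
    (m m' : ℕ →₀ ℕ) :
    HasSum (fun n => coeff m ((∑ p ∈ antidiagonal n, bil (s p.1) (t p.2)) m'))
      (coeff m (bil f h m')) := by
  have h1 : Below (bd m + bd m') m := (below_bd m).mono (by omega)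
  have h2 : Below (bd m + bd m') m' := (below_bd m').mono (by omega)
  simp only [Finset.sum_apply, map_sum, coeff_bil _ _ h1 h2, coeff_bilBox]
  have := hasSum_sum (s := box (bd m + bd m')) fun k _ =>
    (hasSum_cauchy (ht.phi (-k - 1) m') (hs.phi k m)).mul_left ((-1 : ℂ) ^ k)
  convert this using 1
  · rfl
  · funext n
    rw [Finset.sum_comm]
    refine Finset.sum_congr rfl fun k _ => ?_
    rw [Finset.mul_sum, ← Finset.Nat.sum_antidiagonal_swap]
    refine Finset.sum_congr rfl fun p _ => ?_
    simp only [Prod.fst_swap, Prod.snd_swap]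
    ring
  · exact Finset.sum_congr rfl fun k _ => by ring

/-! ### Exponentials preserve the bilinear identity -/

theorem hasExp_iff (A : Fock → Fock) (f f' : Fock) :
    HasExp A f f' ↔ HasSumF (fun n => ((n.factorial : ℂ))⁻¹ • A^[n] f) f' := by
  simp [HasExp, HasSumF]

/-- By `bil_quad` the binomial sum is (A ⊗ 1 + 1 ⊗ A)^n applied to `bil f h`. After division by n!
it is the n-th term of the Cauchy product for e^A f and e^A h. -/
theorem sum_bil_iterate_quad {N : ℤ → ℤ → ℂ} {M : ℕ} (hN : Band N M) (hs : ∀ k l, N k l = N l k)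
    (c : ℂ) {f h : Fock} (hf : bil f h = 0) (n : ℕ) :
    ∑ p ∈ antidiagonal n, n.choose p.1 • bil ((quad N c)^[p.1] f) ((quad N c)^[p.2] h)
      = 0 := by
  induction n with
  | zero => simp [hf]
  | succ n ih =>
    rw [Finset.sum_antidiagonal_choose_succ_nsmul
      (fun i j => bil ((quad N c)^[i] f) ((quad N c)^[j] h))]
    have e : ∀ p ∈ antidiagonal n,
        n.choose p.2 • bil ((quad N c)^[p.1 + 1] f) ((quad N c)^[p.2] h) =
        n.choose p.1 • bil ((quad N c)^[p.1 + 1] f) ((quad N c)^[p.2] h) := by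
      intro p hp
      rw [mem_antidiagonal] at hp
      rw [← hp, Nat.choose_symm_add]
    rw [Finset.sum_congr rfl e, ← Finset.sum_add_distrib]
    have e2 : ∀ p ∈ antidiagonal n,
        n.choose p.1 • bil ((quad N c)^[p.1] f) ((quad N c)^[p.2 + 1] h) +
        n.choose p.1 • bil ((quad N c)^[p.1 + 1] f) ((quad N c)^[p.2] h) =
        op1 (quadLin hN c) (n.choose p.1 • bil ((quad N c)^[p.1] f) ((quad N c)^[p.2] h)) +
        op2 (quadLin hN c) (n.choose p.1 • bil ((quad N c)^[p.1] f) ((quad N c)^[p.2] h)) := by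
      intro p _
      rw [← Nat.cast_smul_eq_nsmul ℂ, ← Nat.cast_smul_eq_nsmul ℂ, ← Nat.cast_smul_eq_nsmul ℂ,
        op1_smul, op2_smul, ← smul_add, ← smul_add]
      congr 1
      rw [Function.iterate_succ_apply', Function.iterate_succ_apply', add_comm]
      exact bil_quad hN hs c _ _
    rw [Finset.sum_congr rfl e2, Finset.sum_add_distrib, ← op1_sum, ← op2_sum, ih, op1_zero,
      op2_zero, add_zero]

theorem bil_hasExp {N : ℤ → ℤ → ℂ} {M : ℕ} (hN : Band N M) (hs : ∀ k l, N k l = N l k)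
    (c : ℂ) {f f' : Fock} (hf : bil f f = 0) (h : HasExp (quad N c) f f') : bil f' f' = 0 := by
  rw [hasExp_iff] at h
  ext m' m
  have h1 := HasSumF.bil h h m m'
  have h0 : ∀ n, ∑ p ∈ antidiagonal n, bil (((p.1.factorial : ℂ))⁻¹ • (quad N c)^[p.1] f)
      (((p.2.factorial : ℂ))⁻¹ • (quad N c)^[p.2] f) = 0 := by
    intro n
    have h2 := congrArg (((n.factorial : ℂ))⁻¹ • ·) (sum_bil_iterate_quad hN hs c hf n)
    simp only [smul_zero, Finset.smul_sum] at h2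
    rw [← h2]
    refine Finset.sum_congr rfl fun p hp => ?_
    rw [bil_smul_left, bil_smul_right, smul_smul, ← Nat.cast_smul_eq_nsmul ℂ, smul_smul]
    congr 1
    rw [mem_antidiagonal] at hp
    have h3 : (n.factorial : ℂ) = n.choose p.1 * p.1.factorial * p.2.factorial := by
      rw [← hp]
      have := Nat.choose_mul_factorial_mul_factorial (Nat.le_add_right p.1 p.2)
      rw [Nat.add_sub_cancel_left] at this
      exact_mod_cast this.symm
    have h4 : (n.choose p.1 : ℂ) ≠ 0 := by
      have : p.1 ≤ n := by omega
      exact_mod_cast (Nat.choose_pos this).ne'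
    have h5 : (p.1.factorial : ℂ) ≠ 0 := by exact_mod_cast p.1.factorial_ne_zero
    have h6 : (p.2.factorial : ℂ) ≠ 0 := by exact_mod_cast p.2.factorial_ne_zero
    rw [h3]
    field_simp
  simp only [h0, Pi.zero_apply, map_zero] at h1
  exact h1.unique hasSum_zero

/-! ### `c_∞` and squares of fields as quadratic operators -/

/-- The kernel of an element of `c_∞`. -/
noncomputable def CInf.kernel (a : CInf) (k l : ℤ) : ℂ := a.mat (k + 1) (-l) * (-1) ^ (-l - 1)

theorem CInf.op_eq_quad (a : CInf) : a.op = quad a.kernel (a.central * (-1 / 2)) := by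
  funext f
  ext m
  change (1 / 2) * (∑ᶠ p : ℤ × ℤ, a.mat p.1 p.2 * (-1) ^ (p.2 - 1) *
    coeff m (normalOrd (p.1 - 1) (-p.2) f)) + _ = (1 / 2) * (∑ᶠ p : ℤ × ℤ, _) + _
  congr 2
  let e : ℤ × ℤ ≃ ℤ × ℤ :=
    { toFun := fun p => (p.1 - 1, -p.2)
      invFun := fun p => (p.1 + 1, -p.2)
      left_inv := fun p => by simp
      right_inv := fun p => by simp }
  rw [← finsum_comp_equiv e (f := fun p => a.kernel p.1 p.2 * coeff m (normalOrd p.1 p.2 f))]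
  refine finsum_congr fun p => ?_
  simp [e, CInf.kernel]

/-- The defining relation a_{i,j} = (-1)^{i+j+1} a_{1-j,1-i} of c_∞ is precisely the symmetry of the
kernel. -/
theorem CInf.kernel_symm (a : CInf) (k l : ℤ) : a.kernel k l = a.kernel l k := by
  rw [kernel, kernel, a.symm, show 1 - -l = l + 1 by ring, show 1 - (k + 1) = -k by ring,
    mul_comm, ← mul_assoc, mul_comm]
  congr 1
  rw [← zpow_add₀ (by simp), show -l - 1 + (k + 1 + -l + 1) = (-k - 1) + 2 * (k - l + 1) by ring,
    zpow_add₀ (by simp), zpow_mul]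
  simp

theorem CInf.exists_band (a : CInf) : ∃ M, Band a.kernel M := by
  obtain ⟨N, hN⟩ := a.band
  refine ⟨N.toNat, fun k l h => ?_⟩
  have := left_ne_zero_of_mul h
  by_contra hlt
  exact this (hN _ _ (by
    rw [show k + 1 - -l = k + l + 1 by ring]
    omega))

/-- One of φ_{k+1/2} and φ_{-k-1/2} annihilates the vacuum. -/
theorem bil_one : bil 1 1 = 0 := by
  ext m' m
  have h1 : Below (bd m + bd m') m := (below_bd m).mono (by omega)
  have h2 : Below (bd m + bd m') m' := (below_bd m').mono (by omega)
  rw [coeff_bil _ _ h1 h2, coeff_bilBox]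
  refine Finset.sum_eq_zero fun k _ => ?_
  rcases le_or_gt 0 k with hk | hk
  · rw [phi_one_neg (by omega : -k - 1 < 0)]; simp
  · rw [phi_one_neg hk]; simp

/-- The CKP bilinear identity. -/
theorem SpVac.bil_self {u : Fock} (hu : SpVac u) : bil u u = 0 := by
  induction hu with
  | one => exact bil_one
  | exp a _ hexp ih =>
    obtain ⟨M, hM⟩ := a.exists_band
    rw [a.op_eq_quad] at hexp
    exact bil_hasExp hM a.kernel_symm _ ih hexp

/-! ### Fields in the bilinear form, and their squares in c_∞ -/

theorem field_apply (b : ℤ →₀ ℂ) (f : Fock) : field b f = ∑ k ∈ b.support, b k • phi k f := by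
  simp [field, Finsupp.sum, LinearMap.sum_apply]

theorem bil_field (b : ℤ →₀ ℂ) (f h : Fock) :
    bil (field b f) h = op1 (field b) (bil f h) - tmul f (field b h) := by
  have e1 : ∀ s : Finset ℤ, bil (∑ k ∈ s, b k • phi k f) h = ∑ k ∈ s, b k • bil (phi k f) h := by
    intro s
    classical
    induction s using Finset.induction_on with
    | empty => simpa using bil_smul_left 0 0 h
    | insert i s hi ih =>
      rw [Finset.sum_insert hi, Finset.sum_insert hi, bil_add_left, ih, bil_smul_left]
  rw [field_apply, e1]
  simp only [bil_phi, smul_sub, Finset.sum_sub_distrib]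
  congr 1
  · funext m'
    simp [op1, field_apply]
  · funext m'
    simp [tmul, field_apply, Finset.sum_smul, smul_smul]

/-- Each of the a factors β leaves one commutator term when it is moved out of the form, and β
commutes with itself. At a = 0 the truncated exponent a - 1 is harmless, since its coefficient is
zero. -/
theorem bil_iterate_field (b : ℤ →₀ ℂ) {f h : Fock} (hf : bil f h = 0) (a : ℕ) :
    bil ((field b)^[a] f) h = -((a : ℂ) • tmul ((field b)^[a - 1] f) (field b h)) := by
  induction a with
  | zero => simp [hf]
  | succ a ih =>
    rw [Function.iterate_succ_apply', bil_field, ih]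
    have : op1 (field b) (-((a : ℂ) • tmul ((field b)^[a - 1] f) (field b h))) =
        -((a : ℂ) • tmul ((field b)^[a] f) (field b h)) := by
      rw [← neg_smul, op1_smul, op1_tmul, neg_smul]
      rcases a with _ | a
      · simp
      · rw [Nat.add_sub_cancel, ← Function.iterate_succ_apply' (field b)]
    rw [this, Nat.add_sub_cancel]
    push_cast
    rw [add_smul, one_smul]
    abel

theorem bil_iterate_field_iterate_field (b : ℤ →₀ ℂ) {u : Fock} (hu : bil u u = 0) (a : ℕ) :
    bil ((field b)^[a] u) (field b u) =
      tmul ((field b)^[a + 1] u) u - (a : ℂ) • tmul ((field b)^[a - 1] u) (field b (field b u)) := by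
  have h1 : bil u (field b u) = tmul (field b u) u := by
    rw [bil_eq_neg_swap, show field b u = (field b)^[1] u from rfl, bil_iterate_field b hu]
    have : (-(((1 : ℕ) : ℂ) • tmul ((field b)^[1 - 1] u) (field b u))).swap =
      -(((1 : ℕ) : ℂ) • (tmul u (field b u)).swap) := rfl
    rw [this, swap_tmul]
    simp
  induction a with
  | zero => simp [h1]
  | succ a ih =>
    rw [Function.iterate_succ_apply', bil_field, ih, sub_eq_add_neg (tmul _ _), ← neg_smul,
      op1_add, op1_smul, op1_tmul, op1_tmul, Nat.add_sub_cancel]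
    have : (-(a : ℂ)) • tmul ((field b) ((field b)^[a - 1] u)) (field b (field b u)) =
        (-(a : ℂ)) • tmul ((field b)^[a] u) (field b (field b u)) := by
      rcases a with _ | a
      · simp
      · rw [Nat.add_sub_cancel, ← Function.iterate_succ_apply' (field b)]
    rw [this, ← Function.iterate_succ_apply' (field b)]
    push_cast
    rw [add_smul, one_smul, neg_smul]
    abel

/-- The kernel is the rank one matrix b_k b_l. The central component restores the vacuum expectation
of β² that normal ordering subtracts. Hence applying e^{β²/2} stays within `SpVac`. -/
theorem exists_op_eq_halfSq (b : ℤ →₀ ℂ) : ∃ a : CInf, a.op = halfSq b := by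
  set N : ℤ → ℤ → ℂ := fun k l => b k * b l with hN
  set L : ℕ := b.support.sup Int.natAbs with hL
  have hb : ∀ k, L < k.natAbs → b k = 0 := by
    intro k hk
    by_contra h
    have := Finset.le_sup (f := Int.natAbs) (Finsupp.mem_support_iff.mpr h)
    omega
  refine ⟨⟨fun i j => (-1 : ℂ) ^ (j - 1) * (b (i - 1) * b (-j)), ?_, ?_,
    -∑ k ∈ b.support, ∑ l ∈ b.support, b k * b l * vac (phi k (phi l 1))⟩, ?_⟩
  · intro i j
    rw [show -(1 - i) = i - 1 by ring, ← mul_assoc ((-1 : ℂ) ^ (i + j + 1)),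
      ← zpow_add₀ (by simp : (-1 : ℂ) ≠ 0), show 1 - j - 1 = -j by ring, mul_comm (b (-j)),
      show i + j + 1 + (1 - i - 1) = (j - 1) + 2 by ring, zpow_add₀ (by simp : (-1 : ℂ) ≠ 0)]
    simp
  · refine ⟨2 * L + 2, fun i j hij => ?_⟩
    by_cases h1 : b (i - 1) = 0
    · rw [h1]; simp
    · have h2 : b (-j) = 0 := by
        apply hb
        have : (i - 1).natAbs ≤ L := by
          by_contra h; exact h1 (hb _ (by omega))
        rcases abs_cases (i - j) with h | h <;> omega
      rw [h2]; simp
  · funext f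
    rw [CInf.op_eq_quad]
    ext m
    change (1 / 2) * (∑ᶠ p : ℤ × ℤ, _) + _ * coeff m f = _
    rw [finsum_eq_sum_of_support_subset (s := b.support ×ˢ b.support), Finset.sum_product]
    · have e : ∀ k l : ℤ, (-1 : ℂ) ^ (-l - 1) * (b (k + 1 - 1) * b (- -l)) * (-1) ^ (-l - 1) =
          b k * b l := by
        intro k l
        rw [mul_right_comm, neg_one_zpow_mul_self, one_mul, neg_neg, add_sub_cancel_right]
      have e2 : field b (field b f) = ∑ k ∈ b.support, ∑ l ∈ b.support,
          (b k * b l) • phi k (phi l f) := by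
        simp only [field_apply b, map_sum, map_smul, Finset.smul_sum, smul_smul]
      simp only [CInf.kernel, e, halfSq, e2, map_smul, map_sum, normalOrd, map_sub, smul_eq_mul,
        mul_sub, Finset.sum_sub_distrib]
      simp only [← mul_assoc, ← Finset.sum_mul]
      ring
    · intro p hp
      simp only [CInf.kernel, Function.mem_support] at hp
      have h1 := left_ne_zero_of_mul (left_ne_zero_of_mul hp)
      have h2 := right_ne_zero_of_mul h1
      rw [neg_neg, add_sub_cancel_right] at h2
      simp [left_ne_zero_of_mul h2, right_ne_zero_of_mul h2]

theorem finsupp_induction {P : (ℕ →₀ ℕ) → Prop} (h0 : P 0)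
    (hs : ∀ α k, P α → P (α + Finsupp.single k 1)) (α : ℕ →₀ ℕ) : P α := by
  suffices h : ∀ β, P β → P (β + α) by simpa using h 0 h0
  induction α using Finsupp.induction_linear with
  | zero => intro β h; simpa using h
  | add f g hf hg => intro β h; rw [← add_assoc]; exact hg _ (hf _ h)
  | single k n =>
    induction n with
    | zero => intro β h; simpa using h
    | succ n ih =>
      intro β h
      rw [Finsupp.single_add, ← add_assoc]
      exact hs _ _ (ih _ h)

/-! ### Annihilation operators -/

/-- The partial derivative `∂/∂X a` on the Fock space. -/
noncomputable def d (a : ℕ) : Fock →ₗ[ℂ] Fock := (pderiv ℂ a).toLinearMap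

theorem phi_neg_succ' (n : ℕ) : phi (-(n : ℤ) - 1) = (-1 : ℂ) ^ n • d n :=
  LinearMap.ext fun f => phi_neg_succ n f

theorem d_eq (n : ℕ) (f : Fock) : d n f = (-1 : ℂ) ^ n • phi (-(n : ℤ) - 1) f := by
  rw [phi_neg_succ', LinearMap.smul_apply, smul_smul, ← mul_pow]
  simp

theorem coeff_d (a : ℕ) (f : Fock) (m : ℕ →₀ ℕ) :
    coeff m (d a f) = coeff (m + Finsupp.single a 1) f * (m a + 1) := coeff_pderiv _ _

theorem d_comm (a b : ℕ) (f : Fock) : d a (d b f) = d b (d a f) := by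
  ext m
  simp only [coeff_d, add_right_comm m (Finsupp.single a 1)]
  by_cases h : a = b
  · subst h; rfl
  · simp only [Finsupp.add_apply, Finsupp.single_apply, h, Ne.symm h, if_false]
    push_cast
    ring

theorem HasSumF.d {s : ℕ → Fock} {f : Fock} (h : HasSumF s f) (a : ℕ) :
    HasSumF (fun n => d a (s n)) (d a f) := by
  simp only [d_eq]
  exact (h.phi _).smul _

/-! ### The Heisenberg operators -/

/-- The kernel of the Heisenberg operator `H_n`. -/
noncomputable def heisKernel (n : ℕ) (k l : ℤ) : ℂ :=
  if k + l = -(n : ℤ) - 1 then -(-1 : ℂ) ^ k else 0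

theorem neg_one_zpow_odd {n : ℕ} (hn : Odd n) : (-1 : ℂ) ^ (n : ℤ) = -1 := by
  rw [zpow_natCast, hn.neg_one_pow]

/-- On the support k + l = -n-1 is even, so (-1)^k = (-1)^l; this needs n odd. -/
theorem heisKernel_symm {n : ℕ} (hn : Odd n) (k l : ℤ) : heisKernel n k l = heisKernel n l k := by
  rw [heisKernel, heisKernel, add_comm l k]
  split_ifs with h
  · rw [show l = (-k - 1) - n by omega, zpow_sub₀ (by simp), neg_one_zpow_odd hn,
      neg_one_zpow_neg_sub]
    simp
  · rfl

theorem heisKernel_band (n : ℕ) : Band (heisKernel n) n := by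
  intro k l h
  have : k + l = -(n : ℤ) - 1 := by
    by_contra h'
    exact h (if_neg h')
  rw [show k + l + 1 = -(n : ℤ) by omega]
  simp

theorem heis_eq_quad (n : ℕ) : heis n = quad (heisKernel n) 0 := by
  funext f
  ext m
  change -(1 / 2) * ∑ᶠ i : ℤ, (-1 : ℂ) ^ i * coeff m (normalOrd i (-n - 1 - i) f) = (1 / 2) *
    (∑ᶠ p : ℤ × ℤ, heisKernel n p.1 p.2 * coeff m (normalOrd p.1 p.2 f)) + 0 * coeff m f
  have hinj : Function.Injective fun i : ℤ => (i, -(n : ℤ) - 1 - i) :=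
    fun i j h => (Prod.mk.inj h).1
  rw [zero_mul, add_zero, neg_mul, ← mul_neg, ← finsum_neg_distrib]
  congr 1
  rw [← finsum_mem_range (f := fun p : ℤ × ℤ =>
    -((-1 : ℂ) ^ p.1 * coeff m (normalOrd p.1 p.2 f))) hinj, finsum_mem_def]
  refine finsum_congr fun p => ?_
  rw [heisKernel]
  by_cases hp : p.1 + p.2 = -(n : ℤ) - 1
  · rw [Set.indicator_of_mem, if_pos hp, neg_mul]
    exact ⟨p.1, Prod.ext rfl (by simp only; omega)⟩
  · rw [Set.indicator_of_notMem, if_neg hp, zero_mul]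
    rintro ⟨i, rfl⟩
    exact hp (by simp only; omega)

/-- `heis n` as a linear map. -/
noncomputable def heisLin (n : ℕ) : Fock →ₗ[ℂ] Fock := quadLin (heisKernel_band n) 0

theorem heisLin_apply (n : ℕ) (f : Fock) : heisLin n f = heis n f := by
  rw [heis_eq_quad]; rfl

theorem heis_phi {n : ℕ} (hn : Odd n) (k : ℤ) (f : Fock) :
    heis n (phi k f) = phi k (heis n f) + phi (k - n) f := by
  rw [heis_eq_quad, quad_phi (heisKernel_band n) (heisKernel_symm hn)]
  congr 1
  rw [Finset.sum_eq_single (k - n)]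
  · rw [heisKernel, if_pos (by ring), smul_smul, zpow_sub₀ (by simp), neg_one_zpow_odd hn, div_neg,
      neg_neg, div_one, neg_one_zpow_mul_self, one_smul]
  · intro j _ hj
    rw [heisKernel, if_neg (by omega), zero_smul]
  · intro h
    rw [Finset.mem_Icc] at h
    omega

theorem d_heis {n : ℕ} (hn : Odd n) (a : ℕ) (f : Fock) :
    d a (heis n f) = heis n (d a f) + d (a + n) f := by
  rw [d_eq a f, heis_eq_quad, quad_smul (heisKernel_band n), ← heis_eq_quad, heis_phi hn,
    show -(a : ℤ) - 1 - n = -((a + n : ℕ) : ℤ) - 1 by push_cast; ring, phi_neg_succ' (a + n),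
    pow_add, hn.neg_one_pow, smul_add, ← d_eq, LinearMap.smul_apply, smul_smul, ← mul_assoc,
    ← mul_pow]
  simp

/-- Against ⟨0| only terms in which both modes annihilate survive: i and -n-1-i must both be
negative, which leaves n terms. -/
theorem vac_heis {n : ℕ} (hn : Odd n) (f : Fock) :
    vac (heis n f) = 1 / 2 * ∑ i ∈ Finset.range n, (-1 : ℂ) ^ i * vac (d i (d (n - 1 - i) f)) := by
  change -(1 / 2) * ∑ᶠ i : ℤ, (-1 : ℂ) ^ i * coeff 0 (normalOrd i (-n - 1 - i) f) = _
  rw [finsum_eq_sum_of_support_subset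
    (s := (Finset.range n).image fun i : ℕ => -(i : ℤ) - 1), Finset.sum_image, neg_mul, ← mul_neg,
    ← Finset.sum_neg_distrib]
  · congr 1
    refine Finset.sum_congr rfl fun i hi => ?_
    rw [Finset.mem_range] at hi
    obtain ⟨j, rfl⟩ : ∃ j, n = i + j + 1 := ⟨n - 1 - i, by omega⟩
    have hij : Even (i + j) := by
      rcases hn with ⟨r, hr⟩; exact ⟨r, by omega⟩
    rw [show -((i + j + 1 : ℕ) : ℤ) - 1 - (-(i : ℤ) - 1) = -(j : ℤ) - 1 by push_cast; ring,
      normalOrd_eq_of_neg (by omega), neg_one_zpow_neg_sub, zpow_natCast, phi_neg_succ',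
      phi_neg_succ', show i + j + 1 - 1 - i = j by omega]
    simp only [LinearMap.smul_apply, map_smul, smul_smul, ← pow_add]
    rw [hij.neg_one_pow, one_smul, d_comm]
    simp [vac]
  · intro i _ j _ h
    simp only at h
    omega
  · intro i hi
    have h2 := right_ne_zero_of_mul hi
    rcases le_or_gt 0 i with h | h
    · exact absurd (by rw [normalOrd_eq_of_nonneg h]; exact vac_phi_nonneg h _) h2
    · rcases le_or_gt 0 (-(n : ℤ) - 1 - i) with h' | h'
      · exact absurd (by rw [normalOrd_eq_of_neg h]; exact vac_phi_nonneg h' _) h2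
      · simp only [Finset.coe_image, Set.mem_image, Finset.coe_range, Set.mem_Iio]
        exact ⟨(-i - 1).toNat, by omega, by omega⟩

/-- The summand is odd under the reflection of `range (m + n)`, because m + n - 1 is odd and D is
symmetric. So the total vanishes, and the last n terms are the negative of the first n. -/
theorem sum_range_alternating_comm {m n : ℕ} (hm : Odd m) (hn : Odd n) {D : ℕ → ℕ → ℂ}
    (hD : ∀ p q, D p q = D q p) :
    ∑ i ∈ Finset.range m, (-1 : ℂ) ^ i * D i (m + n - 1 - i) =
      ∑ i ∈ Finset.range n, (-1 : ℂ) ^ i * D i (m + n - 1 - i) := by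
  set g : ℕ → ℂ := fun i => (-1 : ℂ) ^ i * D i (m + n - 1 - i) with hg
  have hodd : Odd (m + n - 1) := by
    rcases hm with ⟨r, hr⟩; rcases hn with ⟨s, hs⟩
    exact ⟨r + s, by omega⟩
  have href : ∀ i, i < m + n → g (m + n - 1 - i) = -g i := by
    intro i hi
    simp only [hg]
    rw [hD, show m + n - 1 - (m + n - 1 - i) = i by omega, ← neg_mul]
    congr 1
    have h1 : (-1 : ℂ) ^ (m + n - 1 - i) * (-1) ^ i = -1 := by
      rw [← pow_add, show m + n - 1 - i + i = m + n - 1 by omega, hodd.neg_one_pow]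
    have h2 : (-1 : ℂ) ^ i * (-1) ^ i = 1 := by rw [← mul_pow]; simp
    linear_combination (-1 : ℂ) ^ i * h1 - (-1 : ℂ) ^ (m + n - 1 - i) * h2
  have htot : ∑ i ∈ Finset.range (m + n), g i = 0 := by
    have h1 := Finset.sum_range_reflect g (m + n)
    rw [Finset.sum_congr rfl fun i hi => href i (Finset.mem_range.mp hi),
      Finset.sum_neg_distrib] at h1
    have h2 : (2 : ℂ) * ∑ i ∈ Finset.range (m + n), g i = 0 := by linear_combination -h1
    simpa using h2
  rw [Finset.sum_range_add] at htot
  have h3 : ∑ x ∈ Finset.range n, g (m + x) = -∑ i ∈ Finset.range n, g i := by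
    rw [← Finset.sum_range_reflect, ← Finset.sum_neg_distrib]
    refine Finset.sum_congr rfl fun i hi => ?_
    rw [Finset.mem_range] at hi
    rw [← href i (by omega), show m + (n - 1 - i) = m + n - 1 - i by omega]
  rw [h3] at htot
  linear_combination htot

/-- The vacuum components are compared by `vac_heis`. The higher coefficients follow by induction on
the monomial, since the commutators of ∂_a with the Heisenberg operators only shift indices
(`d_heis`). -/
theorem heis_comm {m n : ℕ} (hm : Odd m) (hn : Odd n) (f : Fock) :
    heis m (heis n f) = heis n (heis m f) := by
  have aux : ∀ {m n : ℕ} (_ : Odd m) (_ : Odd n) (f : Fock), vac (heis m (heis n f)) =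
      1 / 4 * (∑ i ∈ Finset.range m, ∑ j ∈ Finset.range n, (-1 : ℂ) ^ i * (-1) ^ j *
        vac (d j (d (n - 1 - j) (d i (d (m - 1 - i) f))))) +
      ∑ i ∈ Finset.range m, (-1 : ℂ) ^ i * vac (d i (d (m + n - 1 - i) f)) := by
    intro m n hm hn f
    have h1 : ∀ i ∈ Finset.range m, (-1 : ℂ) ^ i * vac (d i (d (m - 1 - i) (heis n f))) =
        1 / 2 * (∑ j ∈ Finset.range n, (-1 : ℂ) ^ i * (-1) ^ j *
          vac (d j (d (n - 1 - j) (d i (d (m - 1 - i) f))))) +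
        ((-1 : ℂ) ^ (m - 1 - i) * vac (d (m - 1 - i) (d (m + n - 1 - (m - 1 - i)) f)) +
        (-1 : ℂ) ^ i * vac (d i (d (m + n - 1 - i) f))) := by
      intro i hi
      rw [Finset.mem_range] at hi
      have h2 : (-1 : ℂ) ^ (m - 1 - i) = (-1) ^ i := by
        obtain ⟨r, hr⟩ := hm
        rw [neg_one_pow_eq_pow_mod_two, neg_one_pow_eq_pow_mod_two (n := i)]
        congr 1
        omega
      rw [d_heis hn, map_add, d_heis hn, h2, show m + n - 1 - (m - 1 - i) = i + n by omega,
        show m - 1 - i + n = m + n - 1 - i by omega, d_comm (m - 1 - i) (i + n)]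
      have h3 := vac_heis hn (d i (d (m - 1 - i) f))
      simp only [vac, map_add] at h3 ⊢
      rw [h3]
      simp only [mul_assoc, ← Finset.mul_sum]
      ring
    rw [vac_heis hm, Finset.sum_congr rfl h1, Finset.sum_add_distrib, Finset.sum_add_distrib,
      Finset.sum_range_reflect (fun i => (-1 : ℂ) ^ i * vac (d i (d (m + n - 1 - i) f))),
      ← Finset.mul_sum]
    ring
  have hvac : ∀ f, vac (heis m (heis n f)) = vac (heis n (heis m f)) := by
    intro f
    rw [aux hm hn, aux hn hm, Finset.sum_comm,
      sum_range_alternating_comm hm hn (D := fun p q => vac (d p (d q f)))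
        fun p q => by rw [d_comm], add_comm n m]
    congr 2
    refine Finset.sum_congr rfl fun i _ => Finset.sum_congr rfl fun j _ => ?_
    rw [mul_comm ((-1 : ℂ) ^ i), d_comm (m - 1 - j) i, d_comm (m - 1 - j) (n - 1 - i), d_comm j i,
      d_comm j (n - 1 - i)]
  ext μ
  induction μ using finsupp_induction generalizing f with
  | h0 => exact hvac f
  | hs μ a ih =>
    have e : ∀ g : Fock, coeff (μ + Finsupp.single a 1) g = (μ a + 1 : ℂ)⁻¹ * coeff μ (d a g) := by
      intro g
      have : (μ a + 1 : ℂ) ≠ 0 := Nat.cast_add_one_ne_zero _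
      rw [coeff_d]
      field_simp
    have hadd : ∀ {r : ℕ} (g g' : Fock), heis r (g + g') = heis r g + heis r g' := by
      intro r g g'
      rw [heis_eq_quad, quad_add (heisKernel_band r)]
    rw [e, e, d_heis hm, d_heis hn, d_heis hn, d_heis hn, d_heis hm, d_heis hm, hadd, hadd]
    simp only [map_add, ih, add_right_comm a n m]
    ring

/-! ### The exponential of `H(t)` -/

theorem heisT_iterate_apply (f : Fock) (n : ℕ) (α : ℕ →₀ ℕ) (h : α.degree ≠ n) :
    (heisT^[n] (fun γ => if γ = 0 then f else 0)) α = 0 := by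
  induction n generalizing α with
  | zero =>
    rw [Function.iterate_zero, id, if_neg]
    rintro rfl
    simp at h
  | succ n ih =>
    rw [Function.iterate_succ_apply', heisT]
    refine Finset.sum_eq_zero fun k hk => ?_
    have hk' : 1 ≤ α k := Nat.one_le_iff_ne_zero.mpr (Finsupp.mem_support_iff.mp hk)
    have hle : Finsupp.single k 1 ≤ α := by simpa using hk'
    rw [ih]
    · have := map_zero (heisLin (2 * k + 1))
      rw [heisLin_apply] at this
      exact_mod_cast this
    · intro h'
      apply h
      conv_lhs => rw [← tsub_add_cancel_of_le hle]
      rw [map_add, h', Finsupp.degree_single]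

theorem expHeis_eq (f : Fock) (α : ℕ →₀ ℕ) : expHeis f α =
    ((α.degree.factorial : ℂ))⁻¹ • (heisT^[α.degree] (fun γ => if γ = 0 then f else 0)) α := by
  rw [expHeis, finsum_eq_single _ α.degree]
  intro n hn
  rw [heisT_iterate_apply f n α hn.symm, smul_zero]

theorem expHeis_zero (f : Fock) : expHeis f 0 = f := by
  rw [expHeis_eq]; simp

/-- Euler's identity for e^{H(t)}: the degree operator inserts one more factor H(t). This needs no
commutativity of the H_n. -/
theorem degree_smul_expHeis (f : Fock) (α : ℕ →₀ ℕ) : (α.degree : ℂ) • expHeis f α =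
    ∑ k ∈ α.support, heis ((2 * k + 1 : ℕ)) (expHeis f (α - Finsupp.single k 1)) := by
  rcases h : α.degree with _ | n
  · rw [(Finsupp.degree_eq_zero_iff α).mp h]; simp
  · rw [expHeis_eq, h, Function.iterate_succ_apply', heisT, smul_smul, Finset.smul_sum]
    refine Finset.sum_congr rfl fun k hk => ?_
    have hk' : 1 ≤ α k := Nat.one_le_iff_ne_zero.mpr (Finsupp.mem_support_iff.mp hk)
    have hle : Finsupp.single k 1 ≤ α := by simpa using hk'
    have hd : (α - Finsupp.single k 1).degree = n := by
      have h2 := congrArg Finsupp.degree (tsub_add_cancel_of_le hle)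
      rw [map_add, Finsupp.degree_single, h] at h2
      omega
    rw [expHeis_eq, hd, heis_eq_quad, quad_smul (heisKernel_band (2 * k + 1)), ← heis_eq_quad]
    have h1 : (n + 1 : ℂ) ≠ 0 := Nat.cast_add_one_ne_zero _
    have h2 : (n.factorial : ℂ) ≠ 0 := by exact_mod_cast n.factorial_ne_zero
    rw [Nat.factorial_succ]
    push_cast
    congr 1
    field_simp

theorem odd_two_mul_add_one' (k : ℕ) : Odd (2 * k + 1) := ⟨k, rfl⟩

/-- `∂/∂t_{2k+1} e^{H(t)} f = H_{2k+1} e^{H(t)} f`. -/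
theorem expHeis_add_single (f : Fock) (α : ℕ →₀ ℕ) (k : ℕ) :
    (α k + 1 : ℂ) • expHeis f (α + Finsupp.single k 1) = heis ((2 * k + 1 : ℕ)) (expHeis f α) := by
  rcases hd : α.degree with n
  induction n using Nat.strong_induction_on generalizing α k with
  | _ n ih =>
    have hα : (α.degree : ℂ) = ∑ j ∈ insert k α.support, (α j : ℂ) := by
      rw [Finsupp.degree_apply]
      push_cast
      apply Finset.sum_subset (Finset.subset_insert _ _)
      intro j _ hj
      simpa using hj
    have hd1 : ((α + Finsupp.single k 1).degree : ℂ) ≠ 0 := by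
      rw [map_add, Finsupp.degree_single]
      push_cast
      exact Nat.cast_add_one_ne_zero _
    have hs : (α + Finsupp.single k 1).support = insert k α.support := by
      ext j
      by_cases hj : j = k
      · subst hj; simp
      · simp [hj]
    have key : ∀ j ∈ insert k α.support, (α k + 1 : ℂ) •
        heis ((2 * j + 1 : ℕ)) (expHeis f (α + Finsupp.single k 1 - Finsupp.single j 1)) =
        ((α j : ℂ) + if j = k then 1 else 0) • heis ((2 * k + 1 : ℕ)) (expHeis f α) := by
      intro j hj
      by_cases hjk : j = k
      · subst hjk
        rw [add_tsub_cancel_right, if_pos rfl]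
      · have hj' : α j ≠ 0 := by
          rw [Finset.mem_insert] at hj
          exact Finsupp.mem_support_iff.mp (hj.resolve_left hjk)
        have hle : Finsupp.single j 1 ≤ α := by
          simpa using Nat.one_le_iff_ne_zero.mpr hj'
        obtain ⟨γ, rfl⟩ : ∃ γ, α = γ + Finsupp.single j 1 := ⟨_, (tsub_add_cancel_of_le hle).symm⟩
        have hγ : γ.degree < n := by
          rw [map_add, Finsupp.degree_single] at hd
          omega
        rw [if_neg hjk, add_zero, add_right_comm, add_tsub_cancel_right]
        have h1 := ih _ hγ γ k rfl
        have h2 := ih _ hγ γ j rfl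
        have e1 : ((γ + Finsupp.single j 1 : ℕ →₀ ℕ) k : ℂ) = γ k := by simp [hjk]
        have e2 : ((γ + Finsupp.single j 1 : ℕ →₀ ℕ) j : ℂ) = γ j + 1 := by simp
        rw [e1, e2, heis_eq_quad (2 * j + 1), ← quad_smul (heisKernel_band (2 * j + 1)), ← heis_eq_quad, h1,
          heis_comm (odd_two_mul_add_one' j) (odd_two_mul_add_one' k), ← h2,
          heis_eq_quad, quad_smul (heisKernel_band (2 * k + 1))]
    -- Multiplication by the degree of α + e_k makes Euler's identity applicable. Each of its terms
    -- is then reduced to H_{2k+1} by the induction hypothesis and `heis_comm`.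
    apply smul_right_injective Fock hd1
    simp only
    rw [smul_comm, degree_smul_expHeis, hs, Finset.smul_sum, Finset.sum_congr rfl key,
      ← Finset.sum_smul, Finset.sum_add_distrib, ← hα, Finset.sum_ite_eq' _ k,
      if_pos (Finset.mem_insert_self _ _), map_add, Finsupp.degree_single]
    push_cast
    rfl

/-! ### Correlation functions -/

/-- `∂_{i₁} ⋯ ∂_{iᵣ}` on the Fock space. -/
noncomputable def dl (I : List ℕ) : Fock →ₗ[ℂ] Fock :=
  I.foldr (fun i A => (d i).comp A) LinearMap.id

@[simp] theorem dl_nil (f : Fock) : dl [] f = f := rfl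

@[simp] theorem dl_cons (i : ℕ) (I : List ℕ) (f : Fock) : dl (i :: I) f = d i (dl I f) := rfl

/-- The series `⟨0|∂_{i₁} ⋯ ∂_{iᵣ} e^{H(t)}|f⟩`. -/
noncomputable def corr (I : List ℕ) (f : Fock) : TSeries := fun α => vac (dl I (expHeis f α))

theorem coeff_corr (I : List ℕ) (f : Fock) (α : ℕ →₀ ℕ) :
    coeff α (corr I f) = vac (dl I (expHeis f α)) := rfl

theorem corr_swap (i j : ℕ) (I : List ℕ) (f : Fock) :
    corr (i :: j :: I) f = corr (j :: i :: I) f := by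
  ext α
  simp only [coeff_corr, dl_cons, d_comm i j]

theorem constantCoeff_corr (I : List ℕ) (f : Fock) :
    constantCoeff (corr I f) = vac (dl I f) := by
  rw [← coeff_zero_eq_constantCoeff_apply, coeff_corr, expHeis_zero]

theorem bra0_eq_corr (f : Fock) : bra0 f = corr [] f := rfl

theorem coeff_pderiv_corr (I : List ℕ) (f : Fock) (α : ℕ →₀ ℕ) (k : ℕ) :
    coeff α (pderiv ℂ k (corr I f)) = vac (dl I (heis ((2 * k + 1 : ℕ)) (expHeis f α))) := by
  rw [coeff_pderiv, coeff_corr, ← expHeis_add_single, map_smul]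
  simp [vac, mul_comm]

theorem vac_add (f g : Fock) : vac (f + g) = vac f + vac g := map_add _ f g

/-- The derivative inserts H_{2k+1}, evaluated by `vac_heis`. In the variants with annihilation
operators, moving H_{2k+1} to the left past each ∂_a adds a term with a shifted by 2k+1. -/
theorem pderiv_corr_nil (k : ℕ) (f : Fock) : 2 * pderiv ℂ k (corr [] f) =
    ∑ i ∈ Finset.range (2 * k + 1), (-1) ^ i * corr [i, 2 * k - i] f := by
  ext α
  have e : ∀ i, ((-1 : TSeries) ^ i * corr [i, 2 * k - i] f) =
    (C ((-1 : ℂ) ^ i)) * corr [i, 2 * k - i] f := by intro i; simp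
  have e2 : (2 : TSeries) = C (2 : ℂ) := (map_ofNat C 2).symm
  simp only [e, e2, map_sum, coeff_C_mul, coeff_pderiv_corr, coeff_corr, dl_nil, dl_cons,
    vac_heis (odd_two_mul_add_one' k), Nat.add_sub_cancel]
  ring

theorem pderiv_corr_one (k a : ℕ) (f : Fock) : 2 * pderiv ℂ k (corr [a] f) =
    ∑ i ∈ Finset.range (2 * k + 1), (-1) ^ i * corr [i, 2 * k - i, a] f +
      2 * corr [a + (2 * k + 1)] f := by
  ext α
  have e : ∀ i, ((-1 : TSeries) ^ i * corr [i, 2 * k - i, a] f) =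
    (C ((-1 : ℂ) ^ i)) * corr [i, 2 * k - i, a] f := by intro i; simp
  have e2 : (2 : TSeries) = C (2 : ℂ) := (map_ofNat C 2).symm
  simp only [e, e2, map_add, map_sum, coeff_C_mul, coeff_pderiv_corr, coeff_corr, dl_nil, dl_cons,
    d_heis (odd_two_mul_add_one' k), vac_add, vac_heis (odd_two_mul_add_one' k),
    Nat.add_sub_cancel]
  ring

theorem pderiv_corr_two (k a b : ℕ) (f : Fock) : 2 * pderiv ℂ k (corr [a, b] f) =
    ∑ i ∈ Finset.range (2 * k + 1), (-1) ^ i * corr [i, 2 * k - i, a, b] f +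
      2 * (corr [a + (2 * k + 1), b] f + corr [a, b + (2 * k + 1)] f) := by
  ext α
  have e : ∀ i, ((-1 : TSeries) ^ i * corr [i, 2 * k - i, a, b] f) =
    (C ((-1 : ℂ) ^ i)) * corr [i, 2 * k - i, a, b] f := by intro i; simp
  have e2 : (2 : TSeries) = C (2 : ℂ) := (map_ofNat C 2).symm
  simp only [e, e2, map_add, map_sum, coeff_C_mul, coeff_pderiv_corr, coeff_corr, dl_nil, dl_cons,
    d_heis (odd_two_mul_add_one' k), vac_add, vac_heis (odd_two_mul_add_one' k),
    Nat.add_sub_cancel]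
  ring

/-! ### Bilinear identities for `e^{H(t)}` -/

/-- The Leibniz rule for ∂/∂t_{2k+1} of a product of power series, written in coefficients so that
it applies to any pairing of them. -/
theorem antidiagonal_leibniz {Z : Type*} [AddCommGroup Z] [Module ℂ Z]
    (F : (ℕ →₀ ℕ) → (ℕ →₀ ℕ) → Z) (α : ℕ →₀ ℕ) (k : ℕ) :
    (α k + 1 : ℂ) • ∑ p ∈ antidiagonal (α + Finsupp.single k 1), F p.1 p.2 =
      ∑ p ∈ antidiagonal α, ((p.1 k + 1 : ℂ) • F (p.1 + Finsupp.single k 1) p.2 +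
        (p.2 k + 1 : ℂ) • F p.1 (p.2 + Finsupp.single k 1)) := by
  have h1 : ∑ p ∈ antidiagonal α, (p.1 k + 1 : ℂ) • F (p.1 + Finsupp.single k 1) p.2 =
      ∑ p ∈ antidiagonal (α + Finsupp.single k 1),
        ((p : (ℕ →₀ ℕ) × (ℕ →₀ ℕ)).1 k : ℂ) • F p.1 p.2 := by
    apply Finset.sum_of_injOn (fun p => (p.1 + Finsupp.single k 1, p.2))
    · intro p _ q _ h
      simpa [Prod.ext_iff] using h
    · intro p hp
      simp only [Finset.mem_coe, mem_antidiagonal] at hp ⊢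
      rw [← hp, add_right_comm]
    · intro p hp hp'
      have : p.1 k = 0 := by
        by_contra h
        have hle : Finsupp.single k 1 ≤ p.1 := by simpa using Nat.one_le_iff_ne_zero.mpr h
        apply hp'
        rw [mem_antidiagonal] at hp
        refine ⟨(p.1 - Finsupp.single k 1, p.2), ?_, ?_⟩
        · rw [Finset.mem_coe, mem_antidiagonal]
          apply add_right_cancel (b := Finsupp.single k 1)
          rw [← hp, add_right_comm, tsub_add_cancel_of_le hle]
        · exact Prod.ext (tsub_add_cancel_of_le hle) rfl
      rw [this, Nat.cast_zero, zero_smul]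
    · intro p _
      simp
  have h2 : ∑ p ∈ antidiagonal α, (p.2 k + 1 : ℂ) • F p.1 (p.2 + Finsupp.single k 1) =
      ∑ p ∈ antidiagonal (α + Finsupp.single k 1),
        ((p : (ℕ →₀ ℕ) × (ℕ →₀ ℕ)).2 k : ℂ) • F p.1 p.2 := by
    apply Finset.sum_of_injOn (fun p => (p.1, p.2 + Finsupp.single k 1))
    · intro p _ q _ h
      simpa [Prod.ext_iff] using h
    · intro p hp
      simp only [Finset.mem_coe, mem_antidiagonal] at hp ⊢
      rw [← hp, add_assoc]
    · intro p hp hp'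
      have : p.2 k = 0 := by
        by_contra h
        have hle : Finsupp.single k 1 ≤ p.2 := by simpa using Nat.one_le_iff_ne_zero.mpr h
        apply hp'
        rw [mem_antidiagonal] at hp
        refine ⟨(p.1, p.2 - Finsupp.single k 1), ?_, ?_⟩
        · rw [Finset.mem_coe, mem_antidiagonal]
          apply add_right_cancel (b := Finsupp.single k 1)
          rw [← hp, add_assoc, tsub_add_cancel_of_le hle]
        · exact Prod.ext rfl (tsub_add_cancel_of_le hle)
      rw [this, Nat.cast_zero, zero_smul]
    · intro p _
      simp
  rw [Finset.sum_add_distrib, h1, h2, ← Finset.sum_add_distrib, Finset.smul_sum]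
  refine Finset.sum_congr rfl fun p hp => ?_
  rw [mem_antidiagonal] at hp
  have := congrArg (fun f : ℕ →₀ ℕ => (f k : ℂ)) hp
  simp only [Finsupp.add_apply, Finsupp.single_eq_same] at this
  push_cast at this
  rw [← add_smul, this]

/-- The coefficient of `t^α` in `e^{H(t)} f ⊗ e^{H(t)} h`. -/
noncomputable def expTmul (f h : Fock) (α : ℕ →₀ ℕ) : Ten :=
  ∑ p ∈ antidiagonal α, tmul (expHeis f p.1) (expHeis h p.2)

/-- The bilinear form of `e^{H(t)} f` and `e^{H(t)} h`. -/
noncomputable def expBil (f h : Fock) (α : ℕ →₀ ℕ) : Ten :=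
  ∑ p ∈ antidiagonal α, bil (expHeis f p.1) (expHeis h p.2)

theorem expTmul_add_single (f h : Fock) (α : ℕ →₀ ℕ) (k : ℕ) :
    (α k + 1 : ℂ) • expTmul f h (α + Finsupp.single k 1) =
      op1 (heisLin (2 * k + 1)) (expTmul f h α) + op2 (heisLin (2 * k + 1)) (expTmul f h α) := by
  rw [expTmul, antidiagonal_leibniz (fun x y => tmul (expHeis f x) (expHeis h y)), expTmul,
    op1_sum, op2_sum, ← Finset.sum_add_distrib]
  refine Finset.sum_congr rfl fun p _ => ?_
  rw [← tmul_smul_left, ← tmul_smul_right, expHeis_add_single, expHeis_add_single, op1_tmul,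
    op2_tmul, heisLin_apply, heisLin_apply]

theorem expBil_add_single (f h : Fock) (α : ℕ →₀ ℕ) (k : ℕ) :
    (α k + 1 : ℂ) • expBil f h (α + Finsupp.single k 1) =
      op1 (heisLin (2 * k + 1)) (expBil f h α) + op2 (heisLin (2 * k + 1)) (expBil f h α) := by
  rw [expBil, antidiagonal_leibniz (fun x y => bil (expHeis f x) (expHeis h y)), expBil,
    op1_sum, op2_sum, ← Finset.sum_add_distrib]
  refine Finset.sum_congr rfl fun p _ => ?_
  rw [← bil_smul_left, ← bil_smul_right, expHeis_add_single, expHeis_add_single, heis_eq_quad]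
  exact bil_quad (heisKernel_band _) (heisKernel_symm (odd_two_mul_add_one' k)) 0 _ _

/-- Both sides solve the same flow, generated by H ⊗ 1 + 1 ⊗ H, and agree at t = 0. -/
theorem expBil_eq {f h f₁ h₁ f₂ h₂ : Fock} {c₁ c₂ : ℂ}
    (hb : bil f h = c₁ • tmul f₁ h₁ + c₂ • tmul f₂ h₂) (α : ℕ →₀ ℕ) :
    expBil f h α = c₁ • expTmul f₁ h₁ α + c₂ • expTmul f₂ h₂ α := by
  induction α using finsupp_induction with
  | h0 => simp [expBil, expTmul, expHeis_zero, hb]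
  | hs α k ih =>
    have h0 : (α k + 1 : ℂ) ≠ 0 := Nat.cast_add_one_ne_zero _
    apply smul_right_injective Ten h0
    simp only
    rw [smul_add, smul_comm _ c₁, smul_comm _ c₂, expBil_add_single, expTmul_add_single,
      expTmul_add_single, ih, op1_add, op2_add, op1_smul, op1_smul, op2_smul, op2_smul, smul_add,
      smul_add]
    abel

/-- The functional `⟨0|∂_I ⊗ ⟨0|∂_{I'}` on formal tensors. -/
noncomputable def evT (I I' : List ℕ) (T : Ten) : ℂ := vac (op1 (dl I) (op2 (dl I') T) 0)

theorem evT_add (I I' : List ℕ) (S T : Ten) : evT I I' (S + T) = evT I I' S + evT I I' T := by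
  rw [evT, op2_add, op1_add, Pi.add_apply, vac_add]; rfl

theorem evT_smul (I I' : List ℕ) (r : ℂ) (T : Ten) : evT I I' (r • T) = r * evT I I' T := by
  rw [evT, op2_smul, op1_smul]; rfl

theorem evT_sum {ι : Type*} (I I' : List ℕ) (s : Finset ι) (T : ι → Ten) :
    evT I I' (∑ i ∈ s, T i) = ∑ i ∈ s, evT I I' (T i) := by
  simp [evT, op1_sum, op2_sum, vac]

theorem evT_tmul (I I' : List ℕ) (f h : Fock) :
    evT I I' (tmul f h) = vac (dl I f) * vac (dl I' h) := by
  rw [evT, op2_tmul, op1_tmul, tmul, mul_comm]; rfl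

theorem evT_expTmul (I I' : List ℕ) (f h : Fock) (α : ℕ →₀ ℕ) :
    evT I I' (expTmul f h α) = coeff α (corr I f * corr I' h) := by
  classical
  rw [expTmul, evT_sum, coeff_mul]
  exact Finset.sum_congr rfl fun p _ => evT_tmul _ _ _ _

theorem op1_d_bil (a : ℕ) (f h : Fock) :
    op1 (d a) (bil f h) = bil (d a f) h + tmul f (d a h) := by
  have h1 := bil_phi (-(a : ℤ) - 1) f h
  rw [phi_neg_succ'] at h1
  simp only [LinearMap.smul_apply] at h1
  rw [bil_smul_left, tmul_smul_right] at h1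
  have h2 : op1 (⇑((-1 : ℂ) ^ a • d a)) (bil f h) = (-1 : ℂ) ^ a • op1 (d a) (bil f h) := rfl
  rw [h2, ← smul_sub] at h1
  have h3 := smul_right_injective Ten (pow_ne_zero a (by simp : (-1 : ℂ) ≠ 0)) h1
  rw [h3, sub_add_cancel]

theorem op2_d_bil (a : ℕ) (f h : Fock) :
    op2 (d a) (bil f h) = bil f (d a h) - tmul (d a f) h := by
  have h1 := op1_d_bil a h f
  have h2 : op2 (d a) (bil f h) = -(op1 (d a) (bil h f)).swap := by
    rw [bil_eq_neg_swap f h, op2]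
    funext m'
    ext m
    have : (-(bil h f).swap).swap = -bil h f := rfl
    rw [this]
    have e2 : op1 (d a) (-bil h f) = -op1 (d a) (bil h f) := by
      funext m'; exact map_neg _ _
    rw [e2]
    rfl
  rw [h2, h1, bil_eq_neg_swap f (d a h)]
  have : (bil (d a h) f + tmul h (d a f)).swap = (bil (d a h) f).swap + (tmul h (d a f)).swap := rfl
  rw [this, swap_tmul]
  abel

theorem evT_nil_nil_bil (f h : Fock) : evT [] [] (bil f h) = 0 := vac_bil f h

theorem op1_sub (A : Fock →ₗ[ℂ] Fock) (S T : Ten) : op1 A (S - T) = op1 A S - op1 A T := by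
  funext m'; exact map_sub A _ _

theorem op2_sub (A : Fock →ₗ[ℂ] Fock) (S T : Ten) : op2 A (S - T) = op2 A S - op2 A T := by
  have : (S - T).swap = S.swap - T.swap := rfl
  rw [op2, this, op1_sub]; rfl

theorem evT_cons_left (i : ℕ) (I' : List ℕ) (T : Ten) :
    evT [i] I' T = vac (op1 (d i) (op2 (dl I') T) 0) := rfl

theorem evT_nil_left (I' : List ℕ) (T : Ten) : evT [] I' T = vac (op2 (dl I') T 0) := rfl

theorem op2_dl_cons (i : ℕ) (I : List ℕ) (T : Ten) :
    op2 (dl (i :: I)) T = op2 (d i) (op2 (dl I) T) := rfl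

theorem op2_dl_nil (T : Ten) : op2 (dl []) T = T := rfl

theorem vac_sub (f g : Fock) : vac (f - g) = vac f - vac g := map_sub _ f g

theorem vac_tmul (f h : Fock) : vac (tmul f h 0) = vac f * vac h := by
  rw [tmul, mul_comm]; rfl

theorem vac_bil' (f h : Fock) : vac (bil f h 0) = 0 := vac_bil f h

/-- Here and in the next three evaluations, every derivative is moved inside `bil` at the cost of
one decomposable tensor. What remains of `bil` has vanishing vacuum component. -/
theorem evT_bil_one (j : ℕ) (f h : Fock) :
    evT [] [j] (bil f h) = -(vac (d j f) * vac h) := by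
  simp [evT_nil_left, op2_dl_cons, op2_dl_nil, op2_d_bil, vac_sub, vac_tmul, vac_bil']

theorem evT_bil_one_one (i j : ℕ) (f h : Fock) : evT [i] [j] (bil f h) =
    vac f * vac (d i (d j h)) - vac (d i (d j f)) * vac h := by
  simp [evT_cons_left, op2_dl_cons, op2_dl_nil, op2_d_bil, op1_d_bil, op1_sub, op1_tmul, vac_sub,
    vac_add, vac_tmul, vac_bil']

theorem evT_bil_three (i j k : ℕ) (f h : Fock) : evT [] [i, j, k] (bil f h) =
    -(vac (d i f) * vac (d j (d k h)) + vac (d j f) * vac (d i (d k h)) +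
      vac (d k f) * vac (d i (d j h))) := by
  simp [evT_nil_left, op2_dl_cons, op2_dl_nil, op2_d_bil, op2_sub, op2_tmul, vac_sub, vac_tmul,
    vac_bil']
  ring

theorem evT_bil_one_three (a i j k : ℕ) (f h : Fock) : evT [a] [i, j, k] (bil f h) =
    vac f * vac (d a (d i (d j (d k h)))) - (vac (d a (d i f)) * vac (d j (d k h)) +
      vac (d a (d j f)) * vac (d i (d k h)) + vac (d a (d k f)) * vac (d i (d j h))) := by
  simp [evT_cons_left, op2_dl_cons, op2_dl_nil, op2_d_bil, op2_sub, op2_tmul, op1_d_bil, op1_sub,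
    op1_tmul, vac_sub, vac_add, vac_tmul, vac_bil']
  ring

/-! ### Wick's theorem from the bilinear identity -/

section Wick

variable {f h f₁ h₁ f₂ h₂ : Fock} {c₁ c₂ : ℂ}

theorem evT_expBil (hb : bil f h = c₁ • tmul f₁ h₁ + c₂ • tmul f₂ h₂) (I I' : List ℕ)
    (α : ℕ →₀ ℕ) : ∑ p ∈ antidiagonal α, evT I I' (bil (expHeis f p.1) (expHeis h p.2)) =
      coeff α (C c₁ * (corr I f₁ * corr I' h₁) + C c₂ * (corr I f₂ * corr I' h₂)) := by
  rw [← evT_sum, ← expBil, expBil_eq hb, evT_add, evT_smul, evT_smul, evT_expTmul, evT_expTmul,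
    map_add, coeff_C_mul, coeff_C_mul]

theorem wick_zero (hb : bil f h = c₁ • tmul f₁ h₁ + c₂ • tmul f₂ h₂) :
    C c₁ * (corr [] f₁ * corr [] h₁) + C c₂ * (corr [] f₂ * corr [] h₂) = 0 := by
  ext α
  rw [← evT_expBil hb]
  simp [evT_nil_nil_bil]

theorem wick_one (hb : bil f h = c₁ • tmul f₁ h₁ + c₂ • tmul f₂ h₂) (j : ℕ) :
    C c₁ * (corr [] f₁ * corr [j] h₁) + C c₂ * (corr [] f₂ * corr [j] h₂) =
      -(corr [j] f * corr [] h) := by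
  classical
  ext α
  rw [← evT_expBil hb, map_neg, coeff_mul, ← Finset.sum_neg_distrib]
  exact Finset.sum_congr rfl fun p _ => evT_bil_one _ _ _

theorem wick_one_one (hb : bil f h = c₁ • tmul f₁ h₁ + c₂ • tmul f₂ h₂) (i j : ℕ) :
    C c₁ * (corr [i] f₁ * corr [j] h₁) + C c₂ * (corr [i] f₂ * corr [j] h₂) =
      corr [] f * corr [i, j] h - corr [i, j] f * corr [] h := by
  classical
  ext α
  rw [← evT_expBil hb, map_sub, coeff_mul, coeff_mul, ← Finset.sum_sub_distrib]
  exact Finset.sum_congr rfl fun p _ => evT_bil_one_one _ _ _ _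

theorem wick_three (hb : bil f h = c₁ • tmul f₁ h₁ + c₂ • tmul f₂ h₂) (i j k : ℕ) :
    C c₁ * (corr [] f₁ * corr [i, j, k] h₁) + C c₂ * (corr [] f₂ * corr [i, j, k] h₂) =
      -(corr [i] f * corr [j, k] h + corr [j] f * corr [i, k] h + corr [k] f * corr [i, j] h) := by
  classical
  ext α
  rw [← evT_expBil hb, map_neg, map_add, map_add, coeff_mul, coeff_mul, coeff_mul,
    ← Finset.sum_add_distrib, ← Finset.sum_add_distrib, ← Finset.sum_neg_distrib]
  exact Finset.sum_congr rfl fun p _ => evT_bil_three _ _ _ _ _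

theorem wick_one_three (hb : bil f h = c₁ • tmul f₁ h₁ + c₂ • tmul f₂ h₂) (a i j k : ℕ) :
    C c₁ * (corr [a] f₁ * corr [i, j, k] h₁) + C c₂ * (corr [a] f₂ * corr [i, j, k] h₂) =
      corr [] f * corr [a, i, j, k] h - (corr [a, i] f * corr [j, k] h +
        corr [a, j] f * corr [i, k] h + corr [a, k] f * corr [i, j] h) := by
  classical
  ext α
  rw [← evT_expBil hb, map_sub, map_add, map_add, coeff_mul, coeff_mul, coeff_mul, coeff_mul,
    ← Finset.sum_add_distrib, ← Finset.sum_add_distrib, ← Finset.sum_sub_distrib]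
  exact Finset.sum_congr rfl fun p _ => evT_bil_one_three _ _ _ _ _ _

end Wick

/-! ### The wave function -/

/-- The weight of a monomial in the times, where `t_{2i+1}` has weight `2i+1`. -/
def wt (α : ℕ →₀ ℕ) : ℕ := α.sum fun i e => e * (2 * i + 1)

/-- The coefficients of `e^{-ξ(t,1)}`. -/
noncomputable def xiCoeff (α : ℕ →₀ ℕ) : ℂ :=
  α.prod fun _ e => (-1 : ℂ) ^ e / (e.factorial : ℂ)

theorem wt_add_single (α : ℕ →₀ ℕ) (k : ℕ) : wt (α + Finsupp.single k 1) = wt α + (2 * k + 1) := by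
  rw [wt, Finsupp.sum_add_index', Finsupp.sum_single_index]
  · simp [wt]
  · simp
  · simp
  · intro i a b; ring

theorem xiCoeff_add_single (α : ℕ →₀ ℕ) (k : ℕ) :
    (α k + 1 : ℂ) * xiCoeff (α + Finsupp.single k 1) = -xiCoeff α := by
  have h : ∀ i : ℕ, (fun (_ : ℕ) (e : ℕ) => (-1 : ℂ) ^ e / (e.factorial : ℂ)) i 0 = 1 := by simp
  rw [xiCoeff, xiCoeff, ← Finsupp.mul_prod_erase' _ k _ h, ← Finsupp.mul_prod_erase' α k _ h,
    Finsupp.erase_add, Finsupp.erase_single, add_zero, ← mul_assoc, ← neg_mul]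
  congr 1
  have h1 : (α k + 1 : ℂ) ≠ 0 := Nat.cast_add_one_ne_zero _
  have h2 : ((α k).factorial : ℂ) ≠ 0 := by exact_mod_cast (α k).factorial_ne_zero
  rw [Finsupp.add_apply, Finsupp.single_eq_same, Nat.factorial_succ, pow_succ]
  push_cast
  field_simp

/-- `φ_n e^{H(t)} f = ∑_k s_k(-t) e^{H(t)} φ_{n-k} f`. -/
theorem phi_expHeis (n : ℤ) (f : Fock) (α : ℕ →₀ ℕ) : phi n (expHeis f α) =
    ∑ p ∈ antidiagonal α, xiCoeff p.1 • expHeis (phi (n - wt p.1) f) p.2 := by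
  induction α using finsupp_induction generalizing n with
  | h0 => simp [expHeis_zero, xiCoeff, wt]
  | hs α k ih =>
    have h0 : (α k + 1 : ℂ) ≠ 0 := Nat.cast_add_one_ne_zero _
    apply smul_right_injective Fock h0
    simp only
    -- On the left, φ_n H = H φ_n - φ_{n-(2k+1)}. The two terms match the derivatives of e^{H(t)}
    -- and of e^{-ξ(t,z)} on the right.
    rw [antidiagonal_leibniz (fun x y => xiCoeff x • expHeis (phi (n - wt x) f) y), ← map_smul,
      expHeis_add_single,
      eq_sub_of_add_eq (heis_phi (odd_two_mul_add_one' k) n (expHeis f α)).symm, ih, ih,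
      ← heisLin_apply, map_sum, ← Finset.sum_sub_distrib]
    refine Finset.sum_congr rfl fun p _ => ?_
    rw [smul_smul, xiCoeff_add_single, wt_add_single, smul_comm _ (xiCoeff p.1), expHeis_add_single,
      map_smul, heisLin_apply, neg_smul, sub_eq_add_neg, add_comm,
      show n - ((wt p.1 + (2 * k + 1) : ℕ) : ℤ) = n - ((2 * k + 1 : ℕ) : ℤ) - wt p.1 by
        push_cast; ring]

theorem phi_neg_one (f : Fock) : phi (-1) f = d 0 f := by
  have := phi_neg_succ 0 f
  simpa [d] using this

theorem two_mul_bra1 (f : Fock) : 2 * bra1 f = corr [0] f := by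
  ext α
  rw [show (2 : TSeries) = C (2 : ℂ) from (map_ofNat C 2).symm, coeff_C_mul, coeff_corr, dl_cons,
    dl_nil, ← phi_neg_one]
  change 2 * (1 / 2 * vac _) = _
  ring

theorem coeff_expNegXi (k : ℕ) (α : ℕ →₀ ℕ) :
    coeff α (expNegXi k) = if wt α = k then xiCoeff α else 0 := rfl

/-- The factor e^{-ξ(t,z)} is exactly what arises when φ(z) is moved to the left of e^{H(t)}. So the
normalized wave function is a correlator of e^{H(t)} u alone. -/
theorem coeff_waveNum (u : Fock) (n : ℤ) (α : ℕ →₀ ℕ) :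
    coeff α (waveNum u n) = vac (d 0 (phi (-n) (expHeis u α))) := by
  classical
  change ∑ᶠ k : ℕ, coeff α (expNegXi k * (2 * bra1 (phi (-n - k) u))) = _
  have h1 : ∀ k : ℕ, coeff α (expNegXi k * (2 * bra1 (phi (-n - k) u))) =
      ∑ p ∈ antidiagonal α, if wt p.1 = k then
        xiCoeff p.1 * vac (d 0 (expHeis (phi (-n - k) u) p.2)) else 0 := by
    intro k
    rw [two_mul_bra1, coeff_mul]
    refine Finset.sum_congr rfl fun p _ => ?_
    rw [coeff_expNegXi, coeff_corr]
    split_ifs <;> simp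
  rw [finsum_congr h1, finsum_eq_sum_of_support_subset (s := (antidiagonal α).image fun p => wt p.1),
    Finset.sum_comm, phi_expHeis, map_sum, vac, map_sum]
  · refine Finset.sum_congr rfl fun p hp => ?_
    rw [Finset.sum_ite_eq, if_pos (Finset.mem_image_of_mem _ hp), map_smul]
    rfl
  · intro k hk
    by_contra h
    apply hk
    refine Finset.sum_eq_zero fun p hp => if_neg fun h' => h ?_
    rw [Finset.coe_image]
    exact ⟨p, hp, h'⟩

theorem waveNum_succ (u : Fock) (j : ℕ) :
    waveNum u ((j : ℤ) + 1) = (-1) ^ j * corr [0, j] u := by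
  ext α
  rw [coeff_waveNum, show -((j : ℤ) + 1) = -(j : ℤ) - 1 by ring, phi_neg_succ',
    show ((-1 : TSeries) ^ j) = C ((-1 : ℂ) ^ j) by simp, coeff_C_mul, coeff_corr]
  simp [vac]

theorem waveNum_zero (u : Fock) : waveNum u 0 = bra0 u := by
  ext α
  rw [coeff_waveNum, bra0_eq_corr, coeff_corr, dl_nil, neg_zero]
  have h := phi_comm (-1) 0 (expHeis u α)
  rw [phi_neg_one, phi_neg_one, if_pos (by norm_num), sub_eq_iff_eq_add, zpow_zero, one_smul] at h
  rw [h, vac_add, vac_phi_nonneg le_rfl, add_zero]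

theorem eigen_eq (u : Fock) (b : ℤ →₀ ℂ) : eigen u b = (bra0 u)⁻¹ * corr [0] (field b u) := by
  rw [eigen, two_mul_bra1]

/-! ### The Riccati equations -/

/-- The matrix `B` of `e^{H(t)} u = τ exp((1/2) ∑ B_{ij} X_i X_j)`. -/
noncomputable def bmat (u : Fock) (i j : ℕ) : TSeries := (bra0 u)⁻¹ * corr [i, j] u

/-- The linear form of `e^{H(t)} β u = (∑ c_i X_i) e^{H(t)} u`. -/
noncomputable def cvec (u : Fock) (b : ℤ →₀ ℂ) (i : ℕ) : TSeries :=
  (bra0 u)⁻¹ * corr [i] (field b u)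

/-- The normalized expectation value of `β²`. -/
noncomputable def omega (u : Fock) (b : ℤ →₀ ℂ) : TSeries :=
  (bra0 u)⁻¹ * bra0 (field b (field b u))

theorem bmat_comm (u : Fock) (i j : ℕ) : bmat u i j = bmat u j i := by
  rw [bmat, corr_swap, bmat]

theorem constantCoeff_bra0 (u : Fock) : constantCoeff (bra0 u) = vac u := constantCoeff_corr [] u

section

variable {u : Fock} (h0 : vac u ≠ 0) (hu : bil u u = 0) (b : ℤ →₀ ℂ)
include h0

theorem bra0_mul_inv : bra0 u * (bra0 u)⁻¹ = 1 :=
  MvPowerSeries.mul_inv_cancel _ (by rwa [constantCoeff_bra0])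

theorem bra0_ne_zero : bra0 u ≠ 0 := left_ne_zero_of_mul_eq_one (bra0_mul_inv h0)

theorem corr_eq_bmat (i j : ℕ) : corr [i, j] u = bra0 u * bmat u i j := by
  rw [bmat, ← mul_assoc, bra0_mul_inv h0, one_mul]

theorem corr_eq_cvec (i : ℕ) : corr [i] (field b u) = bra0 u * cvec u b i := by
  rw [cvec, ← mul_assoc, bra0_mul_inv h0, one_mul]

theorem bra0_eq_omega : bra0 (field b (field b u)) = bra0 u * omega u b := by
  rw [omega, ← mul_assoc, bra0_mul_inv h0, one_mul]

include hu

theorem corr_four (a i j k : ℕ) : corr [a, i, j, k] u =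
    bra0 u * (bmat u a i * bmat u j k + bmat u a j * bmat u i k + bmat u a k * bmat u i j) := by
  -- The Wick lemmas allow two tensors on the right-hand side; for u paired with itself both are
  -- zero.
  have h := wick_one_three (f := u) (h := u) (f₁ := 0) (h₁ := 0) (f₂ := 0) (h₂ := 0) (c₁ := 0)
    (c₂ := 0) (by rw [hu]; simp) a i j k
  simp only [corr_eq_bmat h0, map_zero, zero_mul, add_zero] at h
  apply mul_left_cancel₀ (bra0_ne_zero h0)
  rw [← bra0_eq_corr] at h
  linear_combination -h

omit h0 in
theorem bil_field_self : bil (field b u) u = (-1 : ℂ) • tmul u (field b u) + (0 : ℂ) • tmul 0 0 := by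
  have := bil_iterate_field b hu 1
  simpa using this

theorem corr_three (i j k : ℕ) : corr [i, j, k] (field b u) = bra0 u *
    (cvec u b i * bmat u j k + cvec u b j * bmat u i k + cvec u b k * bmat u i j) := by
  have h := wick_three (bil_field_self hu b) i j k
  simp only [corr_eq_bmat h0, corr_eq_cvec h0, map_zero, zero_mul, add_zero, map_neg, map_one] at h
  apply mul_left_cancel₀ (bra0_ne_zero h0)
  rw [← bra0_eq_corr] at h
  linear_combination -h

theorem bra0_field : bra0 (field b u) = 0 := by
  have h := wick_zero (bil_field_self hu b)
  simp only [map_zero, zero_mul, add_zero, map_neg, map_one, ← bra0_eq_corr] at h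
  apply mul_left_cancel₀ (bra0_ne_zero h0)
  linear_combination -h

omit h0 in
theorem bil_iterate_eq (m : ℕ) : bil ((field b)^[m] u) u =
    (-(m : ℂ)) • tmul ((field b)^[m - 1] u) (field b u) + (0 : ℂ) • tmul 0 0 := by
  rw [bil_iterate_field b hu, neg_smul, zero_smul, add_zero]

theorem corr_one_iterate (m j : ℕ) :
    corr [j] ((field b)^[m] u) = m * bra0 ((field b)^[m - 1] u) * cvec u b j := by
  have h := wick_one (bil_iterate_eq hu b m) j
  simp only [corr_eq_cvec h0, map_zero, zero_mul, add_zero, map_neg, map_natCast,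
    ← bra0_eq_corr] at h
  apply mul_left_cancel₀ (bra0_ne_zero h0)
  linear_combination h

theorem corr_two_iterate (m i j : ℕ) : corr [i, j] ((field b)^[m] u) =
    bra0 ((field b)^[m] u) * bmat u i j +
      m * (m - 1 : ℕ) * bra0 ((field b)^[m - 2] u) * (cvec u b i * cvec u b j) := by
  have h := wick_one_one (bil_iterate_eq hu b m) i j
  simp only [corr_eq_cvec h0, corr_eq_bmat h0, map_zero, zero_mul, add_zero, map_neg, map_natCast,
    ← bra0_eq_corr, corr_one_iterate h0 hu b (m - 1)] at h
  apply mul_left_cancel₀ (bra0_ne_zero h0)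
  rw [show m - 2 = m - 1 - 1 by omega]
  linear_combination h

/-- The vacuum component of `bil (β^{m+1} u) (β u)` vanishes, which relates ⟨β^{m+2}⟩⟨1⟩ to
(m+1)⟨β^m⟩⟨β²⟩. -/
theorem bra0_iterate_add_two (m : ℕ) : bra0 ((field b)^[m + 2] u) =
    (m + 1 : ℕ) * omega u b * bra0 ((field b)^[m] u) := by
  have h1 := bil_iterate_field_iterate_field b hu (m + 1)
  have h := wick_zero (f := (field b)^[m + 1] u) (h := field b u) (c₁ := 1)
    (c₂ := -((m + 1 : ℕ) : ℂ)) (by rw [h1, one_smul, neg_smul, sub_eq_add_neg])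
  simp only [map_one, map_neg, map_natCast, ← bra0_eq_corr, Nat.add_sub_cancel,
    bra0_eq_omega h0 b] at h
  apply mul_left_cancel₀ (bra0_ne_zero h0)
  linear_combination h

theorem bra0_iterate (m : ℕ) : bra0 ((field b)^[2 * m] u) =
    ((Nat.doubleFactorial (2 * m - 1) : ℕ) : TSeries) * omega u b ^ m * bra0 u := by
  induction m with
  | zero => simp
  | succ m ih =>
    rw [show 2 * (m + 1) = 2 * m + 2 by ring, bra0_iterate_add_two h0 hu b, ih]
    -- For exponent 0 the truncated index 2·0 - 1 is 0, and 0!! = 1 plays the role of (-1)!!; the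
    -- recursion for !! therefore starts one step later.
    rcases m with _ | m
    · simp
    · rw [show 2 * (m + 1) + 2 - 1 = 2 * m + 1 + 2 by omega, Nat.doubleFactorial_add_two,
        show 2 * (m + 1) - 1 = 2 * m + 1 by omega]
      push_cast
      ring

omit hu in
theorem two_mul_pderiv_bra0 (k : ℕ) : 2 * pderiv ℂ k (bra0 u) =
    bra0 u * ∑ i ∈ Finset.range (2 * k + 1), (-1) ^ i * bmat u i (2 * k - i) := by
  rw [bra0_eq_corr, pderiv_corr_nil, ← bra0_eq_corr, Finset.mul_sum]
  refine Finset.sum_congr rfl fun i _ => ?_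
  rw [corr_eq_bmat h0]
  ring

omit h0 hu in
theorem sum_reflect_alternating (k : ℕ) (F : ℕ → ℕ → TSeries) :
    ∑ i ∈ Finset.range (2 * k + 1), (-1) ^ i * F (2 * k - i) i =
      ∑ i ∈ Finset.range (2 * k + 1), (-1) ^ i * F i (2 * k - i) := by
  rw [← Finset.sum_range_reflect]
  refine Finset.sum_congr rfl fun i hi => ?_
  rw [Finset.mem_range] at hi
  rw [show 2 * k + 1 - 1 - i = 2 * k - i by omega, show 2 * k - (2 * k - i) = i by omega]
  congr 1
  rw [neg_one_pow_eq_pow_mod_two, neg_one_pow_eq_pow_mod_two (n := i)]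
  congr 1
  omega

omit h0 hu in
theorem two_ne_zero_TSeries : (2 : TSeries) ≠ 0 := by
  rw [show (2 : TSeries) = C (2 : ℂ) from (map_ofNat C 2).symm]
  intro h
  have := congrArg constantCoeff h
  simp at this

omit hu in
/-- The logarithmic derivative is removed from a flow. -/
theorem two_mul_pderiv_of_mul {k : ℕ} {J x S D : TSeries} (hJ : J = bra0 u * x)
    (hτ : 2 * pderiv ℂ k (bra0 u) = bra0 u * S) (hD : 2 * pderiv ℂ k J = bra0 u * (S * x + D)) :
    2 * pderiv ℂ k x = D := by
  rw [hJ, Derivation.leibniz, smul_eq_mul, smul_eq_mul] at hD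
  apply mul_left_cancel₀ (bra0_ne_zero h0)
  linear_combination hD - x * hτ

/-- The four-point function splits into three pairings. The one that pairs r with 2k-r is the
logarithmic derivative of τ and drops out of the quotient; the other two agree after reflecting r,
which cancels the factor 2. -/
theorem pderiv_bmat (k i j : ℕ) : pderiv ℂ k (bmat u i j) =
    ∑ r ∈ Finset.range (2 * k + 1), (-1) ^ r * (bmat u r i * bmat u (2 * k - r) j) +
      (bmat u (i + (2 * k + 1)) j + bmat u i (j + (2 * k + 1))) := by
  apply mul_left_cancel₀ two_ne_zero_TSeries
  refine two_mul_pderiv_of_mul h0 (corr_eq_bmat h0 i j) (two_mul_pderiv_bra0 h0 k) ?_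
  have h1 := sum_reflect_alternating k fun r s => bmat u r i * bmat u s j
  rw [pderiv_corr_two]
  simp only [corr_four h0 hu, corr_eq_bmat h0]
  have h2 : ∑ r ∈ Finset.range (2 * k + 1), (-1) ^ r * (bra0 u *
      (bmat u r (2 * k - r) * bmat u i j + bmat u r i * bmat u (2 * k - r) j +
        bmat u r j * bmat u (2 * k - r) i)) =
      bra0 u * ((∑ r ∈ Finset.range (2 * k + 1), (-1) ^ r * bmat u r (2 * k - r)) * bmat u i j +
      (∑ r ∈ Finset.range (2 * k + 1), (-1) ^ r * (bmat u r i * bmat u (2 * k - r) j) +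
      ∑ r ∈ Finset.range (2 * k + 1), (-1) ^ r * (bmat u (2 * k - r) i * bmat u r j))) := by
    rw [Finset.sum_mul, ← Finset.sum_add_distrib, ← Finset.sum_add_distrib, Finset.mul_sum]
    exact Finset.sum_congr rfl fun r _ => by ring
  rw [h2, h1]
  ring

theorem pderiv_cvec (k i : ℕ) : pderiv ℂ k (cvec u b i) =
    ∑ r ∈ Finset.range (2 * k + 1), (-1) ^ r * (cvec u b r * bmat u (2 * k - r) i) +
      cvec u b (i + (2 * k + 1)) := by
  apply mul_left_cancel₀ two_ne_zero_TSeries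
  refine two_mul_pderiv_of_mul h0 (corr_eq_cvec h0 b i) (two_mul_pderiv_bra0 h0 k) ?_
  have h1 := sum_reflect_alternating k fun r s => cvec u b r * bmat u s i
  rw [pderiv_corr_one]
  simp only [corr_three h0 hu, corr_eq_cvec h0]
  have h2 : ∑ r ∈ Finset.range (2 * k + 1), (-1) ^ r * (bra0 u *
      (cvec u b r * bmat u (2 * k - r) i + cvec u b (2 * k - r) * bmat u r i +
        cvec u b i * bmat u r (2 * k - r))) =
      bra0 u * ((∑ r ∈ Finset.range (2 * k + 1), (-1) ^ r * bmat u r (2 * k - r)) * cvec u b i +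
      (∑ r ∈ Finset.range (2 * k + 1), (-1) ^ r * (cvec u b r * bmat u (2 * k - r) i) +
      ∑ r ∈ Finset.range (2 * k + 1), (-1) ^ r * (cvec u b (2 * k - r) * bmat u r i))) := by
    rw [Finset.sum_mul, ← Finset.sum_add_distrib, ← Finset.sum_add_distrib, Finset.mul_sum]
    exact Finset.sum_congr rfl fun r _ => by ring
  rw [h2, h1]
  ring

/-- The two-point function of β² u is Ω B_{ij} + 2 c_i c_j relative to τ. The B part is the
logarithmic derivative of τ. -/
theorem pderiv_omega (k : ℕ) : pderiv ℂ k (omega u b) =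
    ∑ r ∈ Finset.range (2 * k + 1), (-1) ^ r * (cvec u b r * cvec u b (2 * k - r)) := by
  apply mul_left_cancel₀ two_ne_zero_TSeries
  refine two_mul_pderiv_of_mul h0 (bra0_eq_omega h0 b) (two_mul_pderiv_bra0 h0 k) ?_
  have h2 : ∀ i j, corr [i, j] (field b (field b u)) =
      bra0 u * (omega u b * bmat u i j + 2 * (cvec u b i * cvec u b j)) := by
    intro i j
    have := corr_two_iterate h0 hu b 2 i j
    simp only [Function.iterate_succ, Function.iterate_zero, Function.comp_apply, id_eq,
      Nat.sub_self, bra0_eq_omega h0 b] at this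
    rw [this]
    norm_num
    ring
  rw [bra0_eq_corr, pderiv_corr_nil]
  simp only [h2]
  rw [Finset.sum_mul, Finset.mul_sum, ← Finset.sum_add_distrib, Finset.mul_sum]
  exact Finset.sum_congr rfl fun r _ => by ring

end

namespace PDO

/-! ### The ring of pseudo-differential operators -/

/-- The operator has order at most `N`. -/
def Ord (P : PDO) (N : ℤ) : Prop := ∀ i, N < i → P.coeff i = 0

theorem exists_ord (P : PDO) : ∃ N, Ord P N := P.bdd

theorem Ord.mono {P : PDO} {N M : ℤ} (h : Ord P N) (hNM : N ≤ M) : Ord P M :=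
  fun i hi => h i (hNM.trans_lt hi)

noncomputable instance : Zero PDO := ⟨⟨fun _ => 0, ⟨0, fun _ _ => rfl⟩⟩⟩

noncomputable instance : Add PDO where
  add P Q :=
    { coeff := fun i => P.coeff i + Q.coeff i
      bdd := by
        obtain ⟨N, hN⟩ := P.bdd
        obtain ⟨M, hM⟩ := Q.bdd
        exact ⟨max N M, fun i hi => by
          rw [hN i (lt_of_le_of_lt (le_max_left _ _) hi),
            hM i (lt_of_le_of_lt (le_max_right _ _) hi), add_zero]⟩ }

noncomputable instance : Neg PDO where
  neg P :=
    { coeff := fun i => -P.coeff i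
      bdd := by
        obtain ⟨N, hN⟩ := P.bdd
        exact ⟨N, fun i hi => by rw [hN i hi, neg_zero]⟩ }

@[simp] theorem coeff_zero (i : ℤ) : (0 : PDO).coeff i = 0 := rfl
@[simp] theorem coeff_add (P Q : PDO) (i : ℤ) : (P + Q).coeff i = P.coeff i + Q.coeff i := rfl
@[simp] theorem coeff_neg (P : PDO) (i : ℤ) : (-P).coeff i = -P.coeff i := rfl
@[simp] theorem coeff_sub (P Q : PDO) (i : ℤ) : (P - Q).coeff i = P.coeff i - Q.coeff i := rfl
theorem coeff_mono (a : K) (i j : ℤ) : (mono a i).coeff j = if j = i then a else 0 := rfl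
theorem one_eq_mono : (1 : PDO) = mono 1 0 := rfl

noncomputable instance : AddCommGroup PDO where
  add_assoc P Q R := by ext i; exact add_assoc _ _ _
  zero_add P := by ext i; exact zero_add _
  add_zero P := by ext i; exact add_zero _
  add_comm P Q := by ext i; exact add_comm _ _
  neg_add_cancel P := by ext i; exact neg_add_cancel _
  sub_eq_add_neg P Q := by ext i; exact sub_eq_add_neg _ _
  nsmul := nsmulRec
  zsmul := zsmulRec

/-- The coefficient of `∂^i` as an additive map. -/
def coeffHom (i : ℤ) : PDO →+ K where
  toFun P := P.coeff i
  map_zero' := rfl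
  map_add' _ _ := rfl

theorem coeff_sum {ι : Type*} (s : Finset ι) (P : ι → PDO) (i : ℤ) :
    (∑ j ∈ s, P j).coeff i = ∑ j ∈ s, (P j).coeff i := map_sum (coeffHom i) P s

/-- The iterated `x`-derivative. -/
noncomputable def der (k : ℕ) (x : K) : K := (dt 0)^[k] x

@[simp] theorem der_zero' (x : K) : der 0 x = x := rfl
theorem der_succ (k : ℕ) (x : K) : der (k + 1) x = dt 0 (der k x) :=
  Function.iterate_succ_apply' _ _ _
theorem der_succ' (k : ℕ) (x : K) : der (k + 1) x = der k (dt 0 x) := rfl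
@[simp] theorem der_map_zero (k : ℕ) : der k (0 : K) = 0 := iterate_map_zero _ _
theorem der_add (k : ℕ) (x y : K) : der k (x + y) = der k x + der k y := iterate_map_add _ _ _ _

theorem der_der (k l : ℕ) (x : K) : der k (der l x) = der (k + l) x :=
  (Function.iterate_add_apply _ _ _ _).symm

theorem der_intCast_mul (k : ℕ) (c : ℤ) (x : K) : der k ((c : K) * x) = c * der k x := by
  induction k with
  | zero => simp
  | succ k ih => rw [der_succ, ih, Derivation.leibniz, Derivation.map_intCast, der_succ]; simp

theorem der_mul (k : ℕ) (x y : K) : der k (x * y) =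
    ∑ p ∈ antidiagonal k, (k.choose p.1 : K) * (der p.1 x * der p.2 y) := by
  induction k with
  | zero => simp
  | succ k ih =>
    rw [der_succ, ih, map_sum, Finset.sum_antidiagonal_choose_succ_mul
      (fun i j => der i x * der j y), ← Finset.sum_add_distrib]
    refine Finset.sum_congr rfl fun p hp => ?_
    rw [mem_antidiagonal] at hp
    rw [← hp, Nat.choose_symm_add, Derivation.leibniz, Derivation.leibniz, Derivation.map_natCast]
    simp only [der_succ, smul_eq_mul, mul_zero, add_zero]
    ring

theorem mul_coeff (P Q : PDO) (n : ℤ) : (P * Q).coeff n = ∑ᶠ p : ℤ × ℕ,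
    ((Ring.choose p.1 p.2 : ℤ) : K) * P.coeff p.1 * der p.2 (Q.coeff (n - p.1 + p.2)) := rfl

/-- The lower limit a and the length k are left free, so that products whose factors have different
orders can be compared over one rectangle. -/
theorem mul_coeff_eq {P Q : PDO} {N M : ℤ} (hP : Ord P N) (hQ : Ord Q M) {n a : ℤ} {k : ℕ}
    (ha : a ≤ n - M) (hk : N + M - n < k) : (P * Q).coeff n = ∑ i ∈ Finset.Icc a N,
      ∑ j ∈ Finset.range k,
        ((Ring.choose i j : ℤ) : K) * P.coeff i * der j (Q.coeff (n - i + j)) := by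
  rw [mul_coeff, finsum_eq_sum_of_support_subset (s := Finset.Icc a N ×ˢ Finset.range k),
    Finset.sum_product]
  intro p hp
  have h1 : p.1 ≤ N := by
    by_contra h
    exact hp (by simp only [hP _ (not_le.mp h), mul_zero, zero_mul])
  have h2 : n - p.1 + p.2 ≤ M := by
    by_contra h
    exact hp (by simp only [hQ _ (not_le.mp h), der_map_zero, mul_zero])
  simp only [Finset.coe_product, Finset.coe_Icc, Finset.coe_range, Set.mem_prod, Set.mem_Icc,
    Set.mem_Iio]
  omega

theorem Ord.mul {P Q : PDO} {N M : ℤ} (hP : Ord P N) (hQ : Ord Q M) : Ord (P * Q) (N + M) := by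
  intro n hn
  rw [mul_coeff_eq hP hQ (a := n - M) (k := 0) le_rfl (by omega)]
  simp

theorem Ord.add {P Q : PDO} {N : ℤ} (hP : Ord P N) (hQ : Ord Q N) : Ord (P + Q) N := by
  intro n hn
  rw [coeff_add, hP n hn, hQ n hn, add_zero]

theorem ord_mono (a : K) (i : ℤ) : Ord (mono a i) i := fun _ hj => if_neg hj.ne'

theorem mono_mul_coeff (a : K) (i : ℤ) {Q : PDO} {M : ℤ} (hQ : Ord Q M) {n : ℤ} {k : ℕ}
    (hk : i + M - n < k) : (mono a i * Q).coeff n =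
      ∑ j ∈ Finset.range k, ((Ring.choose i j : ℤ) : K) * a * der j (Q.coeff (n - i + j)) := by
  rw [mul_coeff_eq (ord_mono a i) hQ (a := min (n - M) i) (min_le_left _ _) hk,
    Finset.sum_eq_single i]
  · simp [coeff_mono]
  · intro j _ hj
    simp [coeff_mono, hj]
  · intro h
    simp at h

theorem mul_mono_coeff {P : PDO} {N : ℤ} (hP : Ord P N) (c : K) (l : ℤ) {n : ℤ} {k : ℕ}
    (hk : N + l - n < k) : (P * mono c l).coeff n = ∑ j ∈ Finset.range k,
      ((Ring.choose (n - l + j) j : ℤ) : K) * P.coeff (n - l + j) * der j c := by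
  rw [mul_coeff_eq hP (ord_mono c l) (a := n - l) le_rfl hk, Finset.sum_comm]
  refine Finset.sum_congr rfl fun j _ => ?_
  by_cases h : n - l + j ≤ N
  · rw [Finset.sum_eq_single (n - l + j)]
    · rw [coeff_mono, if_pos (by ring)]
    · intro i _ hi
      rw [coeff_mono, if_neg (by omega), der_map_zero, mul_zero]
    · intro h'
      exact absurd (Finset.mem_Icc.mpr ⟨by omega, h⟩) h'
  · rw [hP _ (not_le.mp h), mul_zero, zero_mul]
    refine Finset.sum_eq_zero fun i hi => ?_
    rw [Finset.mem_Icc] at hi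
    rw [coeff_mono, if_neg (by omega), der_map_zero, mul_zero]

protected theorem add_mul (P Q R : PDO) : (P + Q) * R = P * R + Q * R := by
  obtain ⟨N, hP⟩ := P.exists_ord
  obtain ⟨N', hQ⟩ := Q.exists_ord
  obtain ⟨M, hR⟩ := R.exists_ord
  replace hP := hP.mono (le_max_left N N')
  replace hQ := hQ.mono (le_max_right N N')
  ext n
  rw [coeff_add, mul_coeff_eq hP hR (a := n - M) (k := (max N N' + M - n + 1).toNat) le_rfl
    (by omega), mul_coeff_eq hQ hR (a := n - M) (k := (max N N' + M - n + 1).toNat) le_rfl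
    (by omega), mul_coeff_eq (hP.add hQ) hR (a := n - M) (k := (max N N' + M - n + 1).toNat) le_rfl
    (by omega)]
  simp only [coeff_add, mul_add, add_mul, Finset.sum_add_distrib]

protected theorem mul_add (R P Q : PDO) : R * (P + Q) = R * P + R * Q := by
  obtain ⟨N, hP⟩ := P.exists_ord
  obtain ⟨N', hQ⟩ := Q.exists_ord
  obtain ⟨M, hR⟩ := R.exists_ord
  replace hP := hP.mono (le_max_left N N')
  replace hQ := hQ.mono (le_max_right N N')
  ext n
  rw [coeff_add, mul_coeff_eq hR hP (a := n - max N N') (k := (M + max N N' - n + 1).toNat) le_rfl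
    (by omega), mul_coeff_eq hR hQ (a := n - max N N') (k := (M + max N N' - n + 1).toNat) le_rfl
    (by omega), mul_coeff_eq hR (hP.add hQ) (a := n - max N N')
    (k := (M + max N N' - n + 1).toNat) le_rfl (by omega)]
  simp only [coeff_add, der_add, mul_add, Finset.sum_add_distrib]

/-- Left multiplication. -/
noncomputable def lmul (P : PDO) : PDO →+ PDO where
  toFun Q := P * Q
  map_zero' := by
    have := PDO.mul_add P 0 0
    rw [add_zero] at this
    exact left_eq_add.mp this
  map_add' := PDO.mul_add P

/-- Right multiplication. -/
noncomputable def rmul (P : PDO) : PDO →+ PDO where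
  toFun Q := Q * P
  map_zero' := by
    have := PDO.add_mul 0 0 P
    rw [add_zero] at this
    exact left_eq_add.mp this
  map_add' Q R := PDO.add_mul Q R P

/-- Two additive maps of bounded order that agree on monomials are equal. -/
theorem addHom_ext {φ ψ : PDO →+ PDO} {c : ℤ} (hφ : ∀ P N, Ord P N → Ord (φ P) (N + c))
    (hψ : ∀ P N, Ord P N → Ord (ψ P) (N + c)) (h : ∀ a i, φ (mono a i) = ψ (mono a i)) :
    φ = ψ := by
  ext P n
  obtain ⟨N, hP⟩ := P.exists_ord
  set S : PDO := ∑ i ∈ Finset.Icc (n - c) N, mono (P.coeff i) i with hS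
  have hcS : ∀ j, n - c ≤ j → S.coeff j = P.coeff j := by
    intro j hj
    rw [hS, coeff_sum]
    simp only [coeff_mono, Finset.sum_ite_eq]
    split_ifs with hm
    · rfl
    · rw [Finset.mem_Icc] at hm
      rw [hP j (by omega)]
  have hd : Ord (P - S) (n - c - 1) := by
    intro j hj
    rw [coeff_sub, hcS j (by omega), sub_self]
  have hSe : φ S = ψ S := by
    rw [hS, map_sum, map_sum]
    exact Finset.sum_congr rfl fun i _ => h _ _
  have h1 := hφ _ _ hd n (by omega)
  have h2 := hψ _ _ hd n (by omega)
  rw [map_sub, coeff_sub] at h1 h2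
  rw [hSe] at h1
  linear_combination h1 - h2

theorem mono_mul_mono_coeff (a b : K) (i j : ℤ) {n : ℤ} {k : ℕ} (hn : n + k = i + j) :
    (mono a i * mono b j).coeff n = ((Ring.choose i k : ℤ) : K) * a * der k b := by
  rw [mono_mul_coeff a i (ord_mono b j) (k := k + 1) (by omega), Finset.sum_range_succ,
    Finset.sum_eq_zero, zero_add]
  · rw [coeff_mono, if_pos (by omega)]
  · intro l hl
    rw [Finset.mem_range] at hl
    rw [coeff_mono, if_neg (by omega), der_map_zero, mul_zero]

/-- After (i choose e+p)(e+p choose e) = (i choose e)(i-e choose p) this is Vandermonde's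
convolution, valid for negative i and j too. -/
theorem choose_identity (i j : ℤ) (e g : ℕ) :
    ∑ p ∈ antidiagonal g, Ring.choose i (e + p.1) * (e + p.1).choose e * Ring.choose j p.2 =
      Ring.choose (i + j - e) g * Ring.choose i e := by
  rw [show i + j - e = (i - e) + j by ring, Ring.add_choose_eq g (Commute.all _ _),
    Finset.sum_mul]
  refine Finset.sum_congr rfl fun p _ => ?_
  have := Ring.choose_smul_choose i (Nat.le_add_right e p.1)
  rw [Nat.add_sub_cancel_left, nsmul_eq_mul] at this
  rw [mul_comm (Ring.choose i (e + p.1)), this]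
  ring

theorem mono_assoc (a b c : K) (i j l : ℤ) :
    mono a i * mono b j * mono c l = mono a i * (mono b j * mono c l) := by
  have h1 := (ord_mono a i).mul (ord_mono b j)
  have h2 := (ord_mono b j).mul (ord_mono c l)
  ext n
  rcases lt_or_ge (i + j + l) n with hn | hn
  · rw [h1.mul (ord_mono c l) n (by omega), (ord_mono a i).mul h2 n (by omega)]
  · obtain ⟨R, hR⟩ : ∃ R : ℕ, n + R = i + j + l := ⟨(i + j + l - n).toNat, by omega⟩
    rw [mul_mono_coeff h1 c l (k := R + 1) (by omega), mono_mul_coeff a i h2 (k := R + 1) (by omega)]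
    -- Both sides are combinations of the products b^{(e)} c^{(f)}: F is the expansion of the left
    -- side, G that of the right side before the derivatives of c are collected.
    set F : ℕ × ℕ → K := fun p => ((Ring.choose (i + j - p.1) p.2 * Ring.choose i p.1 : ℤ) : K) *
      (a * (der p.1 b * der p.2 c)) with hF
    set G : ℕ × ℕ → K := fun p => ∑ q ∈ antidiagonal p.1,
      ((Ring.choose i p.1 * p.1.choose q.1 * Ring.choose j p.2 : ℤ) : K) *
      (a * (der q.1 b * der (q.2 + p.2) c)) with hG
    have e1 : ∀ k ∈ Finset.range (R + 1), ((Ring.choose (n - l + k) k : ℤ) : K) *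
        (mono a i * mono b j).coeff (n - l + k) * der k c = F (R - k, k) := by
      intro k hk
      rw [Finset.mem_range] at hk
      rw [mono_mul_mono_coeff a b i j (k := R - k) (by omega),
        show n - l + k = i + j - (R - k : ℕ) by omega, hF]
      push_cast
      ring
    have e2 : ∀ k ∈ Finset.range (R + 1), ((Ring.choose i k : ℤ) : K) * a *
        der k ((mono b j * mono c l).coeff (n - i + k)) = G (k, R - k) := by
      intro k hk
      rw [Finset.mem_range] at hk
      rw [mono_mul_mono_coeff b c j l (k := R - k) (by omega), mul_assoc ((Ring.choose j _ : ℤ) : K),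
        der_intCast_mul, der_mul]
      simp only [der_der, Finset.mul_sum, hG]
      refine Finset.sum_congr rfl fun q _ => ?_
      push_cast
      ring
    have e3 : ∀ k ∈ Finset.range (R + 1), F (R - (R + 1 - 1 - k), R + 1 - 1 - k) =
        F (k, R - k) := by
      intro k hk
      rw [Finset.mem_range] at hk
      rw [Nat.add_sub_cancel, show R - (R - k) = k by omega]
    rw [Finset.sum_congr rfl e1, Finset.sum_congr rfl e2,
      ← Finset.sum_range_reflect, Finset.sum_congr rfl e3,
      ← Finset.Nat.sum_antidiagonal_eq_sum_range_succ_mk F R,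
      ← Finset.Nat.sum_antidiagonal_eq_sum_range_succ_mk G R, hF, hG]
    simp only [← choose_identity, Int.cast_sum, Finset.sum_mul]
    rw [Finset.sum_sigma', Finset.sum_sigma']
    symm
    refine Finset.sum_nbij' (fun x => ⟨(x.2.1, x.2.2 + x.1.2), (x.2.2, x.1.2)⟩)
      (fun x => ⟨(x.1.1 + x.2.1, x.2.2), (x.1.1, x.2.1)⟩) ?_ ?_ ?_ ?_ ?_
    · rintro ⟨⟨k, k'⟩, ⟨e, f⟩⟩ h
      simp only [Finset.mem_sigma, mem_antidiagonal] at h ⊢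
      obtain ⟨h1, rfl⟩ := h
      exact ⟨by rw [← h1]; ring, trivial⟩
    · rintro ⟨⟨k, k'⟩, ⟨e, f⟩⟩ h
      simp only [Finset.mem_sigma, mem_antidiagonal] at h ⊢
      obtain ⟨h1, rfl⟩ := h
      exact ⟨by rw [← h1]; ring, trivial⟩
    · rintro ⟨⟨k, k'⟩, ⟨e, f⟩⟩ h
      simp only [Finset.mem_sigma, mem_antidiagonal] at h ⊢
      obtain ⟨h1, rfl⟩ := h
      rfl
    · rintro ⟨⟨k, k'⟩, ⟨e, f⟩⟩ h
      simp only [Finset.mem_sigma, mem_antidiagonal] at h ⊢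
      obtain ⟨h1, rfl⟩ := h
      rfl
    · rintro ⟨⟨k, k'⟩, ⟨e, f⟩⟩ h
      simp only [Finset.mem_sigma, mem_antidiagonal] at h ⊢
      obtain ⟨h1, rfl⟩ := h
      rfl

/-- Both sides are additive of bounded order in each factor, so `addHom_ext` frees the factors one
at a time from being monomials: the last, then the middle, then the first. -/
protected theorem mul_assoc (P Q R : PDO) : P * Q * R = P * (Q * R) := by
  obtain ⟨N, hP⟩ := P.exists_ord
  obtain ⟨M, hQ⟩ := Q.exists_ord
  obtain ⟨L, hR⟩ := R.exists_ord
  have s1 : ∀ a i b j, (lmul (mono a i * mono b j)) = (lmul (mono a i)).comp (lmul (mono b j)) :=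
    fun a i b j => addHom_ext (c := i + j)
      (fun S n hS => (((ord_mono a i).mul (ord_mono b j)).mul hS).mono (by omega))
      (fun S n hS => ((ord_mono a i).mul ((ord_mono b j).mul hS)).mono (by omega))
      fun c l => mono_assoc a b c i j l
  have s2 : ∀ a i, (rmul R).comp (lmul (mono a i)) = (lmul (mono a i)).comp (rmul R) :=
    fun a i => addHom_ext (c := i + L)
      (fun S n hS => (((ord_mono a i).mul hS).mul hR).mono (by omega))
      (fun S n hS => ((ord_mono a i).mul (hS.mul hR)).mono (by omega))
      fun b j => DFunLike.congr_fun (s1 a i b j) R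
  have s3 : (rmul R).comp (rmul Q) = rmul (Q * R) :=
    addHom_ext (c := M + L) (fun S n hS => ((hS.mul hQ).mul hR).mono (by omega))
      (fun S n hS => (hS.mul (hQ.mul hR)).mono (by omega))
      fun a i => DFunLike.congr_fun (s2 a i) Q
  exact DFunLike.congr_fun s3 P

theorem mono_zero_mul_coeff (a : K) (Q : PDO) (n : ℤ) :
    (mono a 0 * Q).coeff n = a * Q.coeff n := by
  obtain ⟨M, hQ⟩ := Q.exists_ord
  rw [mono_mul_coeff a 0 hQ (k := (M - n).toNat + 1) (by omega), Finset.sum_range_succ',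
    Finset.sum_eq_zero]
  · simp
  · intro j _
    rw [Ring.choose_zero_succ]
    simp

theorem der_one (k : ℕ) : der (k + 1) (1 : K) = 0 := by
  rw [der_succ', Derivation.map_one_eq_zero, der_map_zero]

theorem mul_mono_one_coeff (P : PDO) (l n : ℤ) : (P * mono 1 l).coeff n = P.coeff (n - l) := by
  obtain ⟨N, hP⟩ := P.exists_ord
  rw [mul_mono_coeff hP 1 l (k := (N + l - n).toNat + 1) (by omega), Finset.sum_range_succ',
    Finset.sum_eq_zero]
  · simp
  · intro j _
    rw [der_one, mul_zero]

protected theorem one_mul (P : PDO) : 1 * P = P := by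
  ext n
  rw [one_eq_mono, mono_zero_mul_coeff, one_mul]

protected theorem mul_one (P : PDO) : P * 1 = P := by
  ext n
  rw [one_eq_mono, mul_mono_one_coeff, sub_zero]

noncomputable instance : Ring PDO where
  left_distrib := PDO.mul_add
  right_distrib := PDO.add_mul
  zero_mul P := map_zero (rmul P)
  mul_zero P := map_zero (lmul P)
  mul_assoc := PDO.mul_assoc
  one_mul := PDO.one_mul
  mul_one := PDO.mul_one
  neg_add_cancel := neg_add_cancel
  sub_eq_add_neg := sub_eq_add_neg
  zsmul := zsmulRec
  nsmul := nsmulRec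

/-! ### Operators of order zero, one and minus one -/

theorem mono_sub (a b : K) (i : ℤ) : mono (a - b) i = mono a i - mono b i := by
  ext n
  simp only [coeff_sub, coeff_mono]
  split_ifs <;> simp

theorem mono_zero (i : ℤ) : mono 0 i = 0 := by
  ext n
  simp [coeff_mono]

theorem mono_zero_mul_mono (a b : K) (j : ℤ) : mono a 0 * mono b j = mono (a * b) j := by
  ext n
  rw [mono_zero_mul_coeff, coeff_mono, coeff_mono]
  split_ifs <;> simp

theorem mono_one_mul_mono_one (i j : ℤ) : mono 1 i * mono 1 j = mono 1 (i + j) := by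
  ext n
  rw [mul_mono_one_coeff, coeff_mono, coeff_mono]
  congr 1
  rw [eq_iff_iff]
  omega

theorem inv_mul_d : mono 1 (-1) * mono 1 1 = 1 := mono_one_mul_mono_one (-1) 1

theorem d_mul_coeff (P : PDO) (n : ℤ) :
    (mono 1 1 * P).coeff n = P.coeff (n - 1) + dt 0 (P.coeff n) := by
  obtain ⟨M, hP⟩ := P.exists_ord
  rw [mono_mul_coeff 1 1 hP (k := (M - n + 1).toNat + 2) (by omega), Finset.sum_range_succ',
    Finset.sum_range_succ', Finset.sum_eq_zero]
  · simp [der_succ]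
    ring
  · intro j _
    have : Ring.choose (1 : ℤ) (j + 1 + 1) = 0 := by
      have := Ring.choose_natCast (R := ℤ) 1 (j + 1 + 1)
      rw [Nat.cast_one] at this
      rw [this, Nat.choose_eq_zero_of_lt (by omega), Nat.cast_zero]
    rw [this]
    simp

theorem d_mul_mono (f : K) : mono 1 1 * mono f 0 = mono f 0 * mono 1 1 + mono (dt 0 f) 0 := by
  ext n
  rw [d_mul_coeff, coeff_add, mul_mono_one_coeff]
  simp only [coeff_mono]
  split_ifs <;> simp

theorem inv_mul_mono_mul_d (f : K) :
    mono 1 (-1) * mono f 0 * mono 1 1 = mono f 0 - mono 1 (-1) * mono (dt 0 f) 0 := by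
  rw [mul_assoc, eq_sub_of_add_eq (d_mul_mono f).symm, mul_sub, ← mul_assoc, inv_mul_d, one_mul]

/-! ### Inverses of dressing operators -/

theorem npowRec_eq_pow (P : PDO) (n : ℕ) : npowRec n P = P ^ n := by
  induction n with
  | zero => rfl
  | succ n ih => rw [pow_succ, ← ih]; rfl

theorem Ord.sub {P Q : PDO} {N : ℤ} (hP : Ord P N) (hQ : Ord Q N) : Ord (P - Q) N := by
  intro n hn
  rw [coeff_sub, hP n hn, hQ n hn, sub_zero]

theorem ord_one : Ord (1 : PDO) 0 := ord_mono 1 0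

theorem Ord.pow {P : PDO} (hP : Ord P (-1)) (n : ℕ) : Ord (P ^ n) (-n) := by
  induction n with
  | zero => exact ord_one
  | succ n ih => rw [pow_succ]; exact (ih.mul hP).mono (by push_cast; omega)

theorem eq_zero_of_ord {P : PDO} (h : ∀ n : ℕ, Ord P (-n)) : P = 0 := by
  ext i
  exact h (-i + 1).toNat i (by omega)

section inv

variable {W : PDO} (hW : Ord (1 - W) (-1))
include hW

/-- The inverse agrees with the partial geometric sums up to arbitrarily low order, so both inverse
laws reduce to the finite geometric sum. -/
theorem ord_inv_sub (n : ℕ) : Ord (W.inv - ∑ k ∈ Finset.range n, (1 - W) ^ k) (-n) := by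
  intro i hi
  rw [coeff_sub, coeff_sum]
  change (if 0 < i then 0 else
    ∑ k ∈ Finset.range ((-i).toNat + 1), (npowRec k (1 - W)).coeff i) - _ = 0
  simp only [npowRec_eq_pow]
  split_ifs with h
  · rw [Finset.sum_eq_zero, sub_zero]
    intro k _
    exact hW.pow k i (by omega)
  · rw [sub_eq_zero]
    apply Finset.sum_subset
    · intro k hk
      rw [Finset.mem_range] at hk ⊢
      omega
    · intro k _ hk
      rw [Finset.mem_range] at hk
      exact hW.pow k i (by omega)

theorem ord_of_monic : Ord W 0 := by
  have := ord_one.sub (hW.mono (by omega : (-1 : ℤ) ≤ 0))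
  rwa [sub_sub_cancel] at this

theorem mul_inv_eq_one : W * W.inv = 1 := by
  rw [← sub_eq_zero]
  apply eq_zero_of_ord
  intro n
  have h := mul_neg_geom_sum (1 - W) n
  rw [sub_sub_cancel] at h
  have : W * W.inv - 1 = W * (W.inv - ∑ k ∈ Finset.range n, (1 - W) ^ k) - (1 - W) ^ n := by
    rw [mul_sub, h]; abel
  rw [this]
  exact (((ord_of_monic hW).mul (ord_inv_sub hW n)).mono (by omega)).sub (hW.pow n)

theorem inv_mul_eq_one : W.inv * W = 1 := by
  rw [← sub_eq_zero]
  apply eq_zero_of_ord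
  intro n
  have h := geom_sum_mul_neg (1 - W) n
  rw [sub_sub_cancel] at h
  have : W.inv * W - 1 = (W.inv - ∑ k ∈ Finset.range n, (1 - W) ^ k) * W - (1 - W) ^ n := by
    rw [sub_mul, h]; abel
  rw [this]
  exact (((ord_inv_sub hW n).mul (ord_of_monic hW)).mono (by omega)).sub (hW.pow n)

theorem laxPow_eq (n : ℕ) : W.laxPow n = W * mono 1 n * W.inv := by
  rw [laxPow, npowRec_eq_pow]
  induction n with
  | zero => rw [pow_zero, Nat.cast_zero, ← one_eq_mono, mul_one, mul_inv_eq_one hW]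
  | succ n ih =>
    have h : mono 1 n * W.inv * (W * mono 1 1 * W.inv) = mono 1 ((n + 1 : ℕ) : ℤ) * W.inv := by
      rw [mul_assoc (mono 1 n), mul_assoc W, ← mul_assoc W.inv W, inv_mul_eq_one hW, one_mul,
        ← mul_assoc, mono_one_mul_mono_one]
      push_cast
      rfl
    rw [pow_succ, ih, mul_assoc W, mul_assoc W, h, mul_assoc W]

theorem ord_inv_sub_one : Ord (W.inv - 1) (-1) := by
  have := ord_inv_sub hW 1
  simpa using this

end inv

/-! ### The action of differential operators on functions -/

/-- The value of the differential part of an operator on a function. -/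
noncomputable def act (P : PDO) (f : K) : K := (P * mono f 0).coeff 0

theorem choose_natCast_self (j : ℕ) : Ring.choose (j : ℤ) j = 1 := by
  rw [Ring.choose_natCast]; simp

theorem applyPos_eq_act (P : PDO) (f : K) : P.applyPos f = act P f := by
  obtain ⟨N, hP⟩ := P.exists_ord
  rw [act, mul_mono_coeff hP f 0 (k := N.toNat + 1) (by omega), applyPos,
    finsum_eq_sum_of_support_subset (s := Finset.range (N.toNat + 1))]
  · refine Finset.sum_congr rfl fun j _ => ?_
    rw [show (0 : ℤ) - 0 + j = j by ring, choose_natCast_self, Int.cast_one, one_mul]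
    rfl
  · intro j hj
    have h := left_ne_zero_of_mul hj
    simp only [Finset.coe_range, Set.mem_Iio]
    by_contra h'
    exact h (hP _ (by omega))

theorem act_add (P Q : PDO) (f : K) : act (P + Q) f = act P f + act Q f := by
  rw [act, add_mul]; rfl

theorem act_sub (P Q : PDO) (f : K) : act (P - Q) f = act P f - act Q f := by
  rw [act, sub_mul]; rfl

theorem act_sum {ι : Type*} (s : Finset ι) (P : ι → PDO) (f : K) :
    act (∑ i ∈ s, P i) f = ∑ i ∈ s, act (P i) f := by
  rw [act, Finset.sum_mul, coeff_sum]; rfl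

theorem act_mono_mul (a : K) (P : PDO) (f : K) : act (mono a 0 * P) f = a * act P f := by
  rw [act, mul_assoc, mono_zero_mul_coeff]; rfl

theorem act_one (f : K) : act 1 f = f := by
  rw [act, one_mul, coeff_mono, if_pos rfl]

theorem act_mono (a f : K) : act (mono a 0) f = a * f := by
  rw [act, mono_zero_mul_mono, coeff_mono, if_pos rfl]

theorem act_of_ord {P : PDO} (hP : Ord P (-1)) (f : K) : act P f = 0 :=
  hP.mul (ord_mono f 0) 0 (by omega)

/-- The operator is differential. -/
def IsDiff (P : PDO) : Prop := ∀ i, i < 0 → P.coeff i = 0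

/-- A term of negative order would come from ∂^r with more than r derivatives on f, and that
binomial coefficient vanishes. -/
theorem IsDiff.mul_mono {P : PDO} (hP : IsDiff P) (f : K) : IsDiff (P * mono f 0) := by
  obtain ⟨N, hN⟩ := P.exists_ord
  intro n hn
  rw [mul_mono_coeff hN f 0 (k := (N - n).toNat + 1) (by omega)]
  refine Finset.sum_eq_zero fun j _ => ?_
  rcases lt_or_ge (n - 0 + j) 0 with h | h
  · rw [hP _ h, mul_zero, zero_mul]
  · obtain ⟨r, hr⟩ : ∃ r : ℕ, n - 0 + j = r := ⟨(n - 0 + j).toNat, by omega⟩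
    rw [hr, Ring.choose_natCast, Nat.choose_eq_zero_of_lt (by omega)]
    simp

theorem IsDiff.d_mul {P : PDO} (hP : IsDiff P) : IsDiff (mono 1 1 * P) := by
  intro n hn
  rw [d_mul_coeff, hP _ hn, hP _ (by omega), map_zero, add_zero]

theorem IsDiff.mono_mul {P : PDO} (hP : IsDiff P) (a : K) : IsDiff (mono a 0 * P) := by
  intro n hn
  rw [mono_zero_mul_coeff, hP _ hn, mul_zero]

theorem isDiff_mono (a : K) {i : ℤ} (hi : 0 ≤ i) : IsDiff (mono a i) :=
  fun _ hj => if_neg (by omega)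

theorem IsDiff.add {P Q : PDO} (hP : IsDiff P) (hQ : IsDiff Q) : IsDiff (P + Q) := by
  intro n hn
  rw [coeff_add, hP n hn, hQ n hn, add_zero]

theorem IsDiff.sub {P Q : PDO} (hP : IsDiff P) (hQ : IsDiff Q) : IsDiff (P - Q) := by
  intro n hn
  rw [coeff_sub, hP n hn, hQ n hn, sub_zero]

theorem IsDiff.sum {ι : Type*} {s : Finset ι} {P : ι → PDO} (hP : ∀ i ∈ s, IsDiff (P i)) :
    IsDiff (∑ i ∈ s, P i) := by
  intro n hn
  rw [coeff_sum]
  exact Finset.sum_eq_zero fun i hi => hP i hi n hn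

theorem act_d_mul {P : PDO} (hP : IsDiff P) (f : K) :
    act (mono 1 1 * P) f = dt 0 (act P f) := by
  rw [act, mul_assoc, d_mul_coeff, hP.mul_mono f _ (by omega), zero_add]; rfl

theorem pos_eq_of_add {P Q R : PDO} (h : P = Q + R) (hQ : IsDiff Q) (hR : Ord R (-1)) :
    P.pos = Q := by
  ext i
  change (if 0 ≤ i then P.coeff i else 0) = _
  rw [h, coeff_add]
  split_ifs with hi
  · rw [hR i (by omega), add_zero]
  · rw [hQ i (by omega)]

/-! ### Tails -/

/-- The operator `∑_{j ≥ 0} (-1)^j x_j ∂^{-j-1}`. -/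
noncomputable def tail (x : ℕ → K) : PDO where
  coeff i := if 0 ≤ i then 0 else (-1) ^ (-i - 1).toNat * x (-i - 1).toNat
  bdd := ⟨0, fun _ hi => if_pos hi.le⟩

theorem tail_coeff_of_nonneg (x : ℕ → K) {i : ℤ} (hi : 0 ≤ i) : (tail x).coeff i = 0 := if_pos hi

theorem tail_coeff (x : ℕ → K) (j : ℕ) : (tail x).coeff (-(j : ℤ) - 1) = (-1) ^ j * x j := by
  change (if _ then _ else _) = _
  rw [if_neg (by omega), show (-(-(j : ℤ) - 1) - 1).toNat = j by omega]

theorem ord_tail (x : ℕ → K) : Ord (tail x) (-1) :=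
  fun i hi => tail_coeff_of_nonneg x (by omega)

theorem ext_tail {P Q : PDO} (h1 : ∀ i, 0 ≤ i → P.coeff i = Q.coeff i)
    (h2 : ∀ j : ℕ, P.coeff (-(j : ℤ) - 1) = Q.coeff (-(j : ℤ) - 1)) : P = Q := by
  ext i
  rcases le_or_gt 0 i with hi | hi
  · exact h1 i hi
  · have := h2 (-i - 1).toNat
    rwa [show -(((-i - 1).toNat : ℕ) : ℤ) - 1 = i by omega] at this

theorem tail_add (x y : ℕ → K) : tail (fun j => x j + y j) = tail x + tail y := by
  apply ext_tail
  · intro i hi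
    simp [tail_coeff_of_nonneg, hi]
  · intro j
    simp only [coeff_add, tail_coeff, mul_add]

theorem tail_mul (a : K) (x : ℕ → K) : tail (fun j => a * x j) = mono a 0 * tail x := by
  apply ext_tail
  · intro i hi
    simp [tail_coeff_of_nonneg, hi, mono_zero_mul_coeff]
  · intro j
    simp only [mono_zero_mul_coeff, tail_coeff]
    ring

theorem tail_sum {ι : Type*} (s : Finset ι) (x : ι → ℕ → K) :
    tail (fun j => ∑ i ∈ s, x i j) = ∑ i ∈ s, tail (x i) := by
  apply ext_tail
  · intro i hi
    simp [tail_coeff_of_nonneg, hi, coeff_sum]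
  · intro j
    simp only [coeff_sum, tail_coeff, Finset.mul_sum]

theorem d_mul_tail (x : ℕ → K) :
    mono 1 1 * tail x = tail (fun j => dt 0 (x j) - x (j + 1)) + mono (x 0) 0 := by
  apply ext_tail
  · intro i hi
    rw [d_mul_coeff, coeff_add, tail_coeff_of_nonneg _ hi, tail_coeff_of_nonneg _ hi, coeff_mono,
      map_zero]
    split_ifs with h
    · subst h
      have := tail_coeff x 0
      simp only [Nat.cast_zero, neg_zero, pow_zero, one_mul] at this
      rw [this, add_zero, zero_add]
    · rw [tail_coeff_of_nonneg _ (by omega)]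
  · intro j
    have h := tail_coeff x (j + 1)
    rw [show -((j + 1 : ℕ) : ℤ) - 1 = -(j : ℤ) - 1 - 1 by push_cast; ring] at h
    have h2 : dt 0 ((-1) ^ j * x j) = (-1) ^ j * dt 0 (x j) := by
      rcases neg_one_pow_eq_or K j with h | h <;> simp [h]
    rw [d_mul_coeff, coeff_add, tail_coeff, tail_coeff, h, h2, coeff_mono, if_neg (by omega)]
    ring

theorem tail_mul_mono (x : ℕ → K) (k : ℕ) : tail x * mono 1 ((2 * k + 1 : ℕ) : ℤ) =
    ∑ i ∈ Finset.range (2 * k + 1), mono ((-1) ^ i * x (2 * k - i)) i -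
      tail fun j => x (j + (2 * k + 1)) := by
  apply ext_tail
  · intro i hi
    obtain ⟨i, rfl⟩ := Int.eq_ofNat_of_zero_le hi
    rw [mul_mono_one_coeff, coeff_sub, coeff_sum, tail_coeff_of_nonneg _ hi, sub_zero]
    simp only [coeff_mono, Nat.cast_inj, Finset.sum_ite_eq, Finset.mem_range]
    split_ifs with h
    · have := tail_coeff x (2 * k - i)
      rw [show -((2 * k - i : ℕ) : ℤ) - 1 = i - ((2 * k + 1 : ℕ) : ℤ) by omega] at this
      rw [this]
      congr 1
      rw [neg_one_pow_eq_pow_mod_two, neg_one_pow_eq_pow_mod_two (n := i)]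
      congr 1
      omega
    · exact tail_coeff_of_nonneg _ (by omega)
  · intro j
    have := tail_coeff x (j + (2 * k + 1))
    rw [show -((j + (2 * k + 1) : ℕ) : ℤ) - 1 = -(j : ℤ) - 1 - ((2 * k + 1 : ℕ) : ℤ) by
      push_cast; ring] at this
    rw [mul_mono_one_coeff, this, coeff_sub, coeff_sum, tail_coeff, Finset.sum_eq_zero,
      pow_add, Odd.neg_one_pow ⟨k, rfl⟩]
    · ring
    · intro i _
      rw [coeff_mono, if_neg (by omega)]

end PDO

open PDO

/-! ### From the Riccati equations to the hierarchy -/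

/-- A symmetric matrix obeying the Riccati equations. -/
structure IsRiccati (B : ℕ → ℕ → K) : Prop where
  symm : ∀ i j, B i j = B j i
  flow : ∀ k i j, dt k (B i j) =
    ∑ r ∈ Finset.range (2 * k + 1), (-1) ^ r * (B r i * B (2 * k - r) j) +
      (B (i + (2 * k + 1)) j + B i (j + (2 * k + 1)))

/-- A vector obeying the linear equations associated with a solution of the Riccati equations. -/
def IsLinear (B : ℕ → ℕ → K) (c : ℕ → K) : Prop := ∀ k i, dt k (c i) =
  ∑ r ∈ Finset.range (2 * k + 1), (-1) ^ r * (c r * B (2 * k - r) i) + c (i + (2 * k + 1))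

/-- The dressing operator of a solution of the Riccati equations. -/
noncomputable def dressB (B : ℕ → ℕ → K) : PDO := 1 + tail (B 0)

/-- The differential operators with `P_a(c_0) = c_a`. -/
noncomputable def diffOp (B : ℕ → ℕ → K) : ℕ → PDO
  | 0 => 1
  | a + 1 => mono 1 1 * diffOp B a - mono (B 0 a) 0

theorem isDiff_diffOp (B : ℕ → ℕ → K) (a : ℕ) : IsDiff (diffOp B a) := by
  induction a with
  | zero => exact isDiff_mono 1 le_rfl
  | succ a ih => exact ih.d_mul.sub (isDiff_mono _ le_rfl)

/-- The differential part of `L^{2k+1}`. -/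
noncomputable def laxPos (B : ℕ → ℕ → K) (k : ℕ) : PDO := diffOp B (2 * k + 1) +
  ∑ i ∈ Finset.range (2 * k + 1), mono ((-1) ^ i * B (2 * k - i) 0) 0 * diffOp B i

theorem isDiff_laxPos (B : ℕ → ℕ → K) (k : ℕ) : IsDiff (laxPos B k) :=
  (isDiff_diffOp B _).add (IsDiff.sum fun i _ => (isDiff_diffOp B i).mono_mul _)

theorem ord_one_sub_dressB (B : ℕ → ℕ → K) : Ord (1 - dressB B) (-1) := by
  intro i hi
  rw [dressB, sub_add_cancel_left, coeff_neg, ord_tail _ i hi, neg_zero]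

section

variable {B : ℕ → ℕ → K} (hB : IsRiccati B)
include hB

theorem IsRiccati.flow_zero (i j : ℕ) :
    dt 0 (B i j) = B 0 i * B 0 j + (B (i + 1) j + B i (j + 1)) := by
  simpa using hB.flow 0 i j

/-- Multiplying by ∂ produces B_{0a} from the leading tail coefficient, and B_{0a} B_{0j} through
the x-flow of B_{ja}. Together they form B_{0a} W, which the recursion for P_{a+1} subtracts. -/
theorem diffOp_mul_dressB (a : ℕ) :
    diffOp B a * dressB B = mono 1 a + tail fun j => B j a := by
  induction a with
  | zero =>
    rw [diffOp, one_mul, dressB]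
    congr 2
    funext j
    exact hB.symm _ _
  | succ a ih =>
    have h : (fun j => dt 0 (B j a) - B (j + 1) a) = fun j => B 0 a * B 0 j + B j (a + 1) := by
      funext j
      rw [hB.flow_zero]
      ring
    rw [diffOp, sub_mul, mul_assoc, ih, mul_add, mono_one_mul_mono_one, d_mul_tail, h, tail_add,
      tail_mul, dressB, mul_add, mul_one, add_comm (1 : ℤ)]
    push_cast
    abel

/-- Sato's equation W_{t_n} = P W - W ∂^n with n = 2k+1. The coefficients of P cancel the
differential part of W ∂^n, and the Riccati flow identifies the remaining tail as W_{t_n}. -/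
theorem laxPos_mul_dressB (k : ℕ) : laxPos B k * dressB B =
    (tail fun j => dt k (B j 0)) + dressB B * mono 1 ((2 * k + 1 : ℕ) : ℤ) := by
  have h : (fun j => dt k (B j 0)) = fun j =>
      ∑ r ∈ Finset.range (2 * k + 1), ((-1) ^ r * B (2 * k - r) 0) * B j r +
        (B 0 (j + (2 * k + 1)) + B j (2 * k + 1)) := by
    funext j
    rw [hB.flow, hB.symm (j + _) 0, zero_add]
    congr 1
    refine Finset.sum_congr rfl fun r _ => ?_
    rw [hB.symm j r]
    ring
  have h3 : ∀ i ∈ Finset.range (2 * k + 1),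
      mono ((-1) ^ i * B (2 * k - i) 0) 0 * diffOp B i * dressB B =
      mono ((-1) ^ i * B 0 (2 * k - i)) i +
      tail (fun j => ((-1) ^ i * B (2 * k - i) 0) * B j i) := by
    intro i _
    rw [mul_assoc, diffOp_mul_dressB hB, mul_add, mono_zero_mul_mono, mul_one, tail_mul,
      hB.symm 0]
  rw [laxPos, add_mul, Finset.sum_mul, Finset.sum_congr rfl h3, diffOp_mul_dressB hB, h, tail_add,
    tail_add, tail_sum, dressB, add_mul, one_mul, tail_mul_mono, Finset.sum_add_distrib]
  abel

theorem laxPow_dressB (k : ℕ) : (dressB B).laxPow (2 * k + 1) =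
    laxPos B k + -((tail fun j => dt k (B j 0)) * (dressB B).inv) := by
  have h1 := ord_one_sub_dressB B
  have h := congrArg (· * (dressB B).inv) (laxPos_mul_dressB hB k)
  simp only [add_mul] at h
  rw [mul_assoc (laxPos B k), mul_inv_eq_one h1, mul_one] at h
  rw [laxPow_eq h1, h]
  abel

omit hB in
theorem ord_laxNeg (k : ℕ) : Ord (-((tail fun j => dt k (B j 0)) * (dressB B).inv)) (-1) := by
  have h : Ord (dressB B).inv 0 := by
    have := (ord_inv_sub_one (ord_one_sub_dressB B)).mono (by omega : (-1 : ℤ) ≤ 0)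
    have h2 := this.add ord_one
    rwa [sub_add_cancel] at h2
  intro i hi
  rw [coeff_neg, ((ord_tail _).mul h) i (by omega), neg_zero]

theorem pos_laxPow_dressB (k : ℕ) : ((dressB B).laxPow (2 * k + 1)).pos = laxPos B k :=
  pos_eq_of_add (laxPow_dressB hB k) (isDiff_laxPos B k) (ord_laxNeg k)

/-- The negative part of the power is -W_t W^{-1}, whose leading term is -(B_{00})_t ∂^{-1}. -/
theorem res_laxPow_dressB (k : ℕ) : ((dressB B).laxPow (2 * k + 1)).res = -dt k (B 0 0) := by
  have h : (tail fun j => dt k (B j 0)) * (dressB B).inv =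
      (tail fun j => dt k (B j 0)) * ((dressB B).inv - 1) + tail fun j => dt k (B j 0) := by
    rw [mul_sub, mul_one]; abel
  have h2 := tail_coeff (fun j => dt k (B j 0)) 0
  simp only [Nat.cast_zero, neg_zero, zero_sub, pow_zero, one_mul] at h2
  rw [res, laxPow_dressB hB, coeff_add, isDiff_laxPos B k _ (by omega), zero_add, coeff_neg, h,
    coeff_add, ((ord_tail _).mul (ord_inv_sub_one (ord_one_sub_dressB B))) _ (by omega), zero_add,
    h2]

variable {c : ℕ → K} (hc : IsLinear B c)
include hc

omit hB in
theorem IsLinear.flow_zero (i : ℕ) : dt 0 (c i) = c 0 * B 0 i + c (i + 1) := by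
  simpa using hc 0 i

omit hB in
theorem act_diffOp (a : ℕ) : act (diffOp B a) (c 0) = c a := by
  induction a with
  | zero => exact act_one _
  | succ a ih =>
    rw [diffOp, act_sub, act_d_mul (isDiff_diffOp B a), ih, act_mono, hc.flow_zero]
    ring

theorem applyPos_laxPow_dressB (k : ℕ) :
    ((dressB B).laxPow (2 * k + 1)).applyPos (c 0) = dt k (c 0) := by
  rw [applyPos_eq_act, laxPow_dressB hB, act_add, act_of_ord (ord_laxNeg k), add_zero, laxPos,
    act_add, act_sum]
  simp only [act_mono_mul, act_diffOp hc]
  rw [hc, zero_add, add_comm]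
  congr 1
  exact Finset.sum_congr rfl fun i _ => by ring

/-- The residue of `∂^{-1} f D q ∂^{-1}`. -/
noncomputable def concomitant (q f : K) (D : PDO) : K :=
  (mono 1 (-1) * mono f 0 * D * mono q 0 * mono 1 (-1)).coeff (-1)

omit hB hc

theorem concomitant_add (q f : K) (D D' : PDO) :
    concomitant q f (D + D') = concomitant q f D + concomitant q f D' := by
  simp only [concomitant, mul_add, add_mul, coeff_add]

theorem concomitant_sub (q f : K) (D D' : PDO) :
    concomitant q f (D - D') = concomitant q f D - concomitant q f D' := by
  simp only [concomitant, mul_sub, sub_mul, coeff_sub]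

theorem concomitant_sum {ι : Type*} (q f : K) (s : Finset ι) (D : ι → PDO) :
    concomitant q f (∑ i ∈ s, D i) = ∑ i ∈ s, concomitant q f (D i) := by
  simp only [concomitant, Finset.mul_sum, Finset.sum_mul, coeff_sum]

theorem concomitant_sub_left (q f g : K) (D : PDO) :
    concomitant q (f - g) D = concomitant q f D - concomitant q g D := by
  simp only [concomitant, mono_sub, mul_sub, sub_mul, coeff_sub]

theorem concomitant_mono_mul (q f a : K) (D : PDO) :
    concomitant q f (mono a 0 * D) = concomitant q (f * a) D := by
  rw [concomitant, concomitant, ← mul_assoc, mul_assoc (mono 1 (-1)), mono_zero_mul_mono]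

theorem concomitant_one (q f : K) : concomitant q f 1 = 0 := by
  rw [concomitant, mul_mono_one_coeff, mul_one]
  exact (((ord_mono 1 (-1)).mul (ord_mono f 0)).mul (ord_mono q 0)) _ (by omega)

theorem concomitant_mono (q f a : K) : concomitant q f (mono a 0) = 0 := by
  rw [← mul_one (mono a 0), concomitant_mono_mul, concomitant_one]

/-- Integration by parts, from ∂^{-1} f ∂ = f - ∂^{-1} f'. -/
theorem concomitant_d_mul (q f : K) (D : PDO) :
    concomitant q f (mono 1 1 * D) = f * act D q - concomitant q (dt 0 f) D := by
  have h : (mono f 0 * (D * mono q 0) * mono 1 (-1)).coeff (-1) = f * act D q := by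
    rw [mul_mono_one_coeff, show (-1 : ℤ) - -1 = 0 by norm_num, mono_zero_mul_coeff]; rfl
  rw [concomitant, ← mul_assoc, inv_mul_mono_mul_d, concomitant, ← h]
  simp only [sub_mul, coeff_sub, mul_assoc]

theorem alternating_telescope (G : ℕ → K) (n : ℕ) :
    ∑ i ∈ Finset.range n, (-1) ^ i * (G (i + 1) + G i) = G 0 - (-1) ^ n * G n := by
  induction n with
  | zero => simp
  | succ n ih => rw [Finset.sum_range_succ, ih, pow_succ]; ring

include hB hc

/-- Integrating by parts with f = c_{2k-i}, whose derivative is c_0 B_{2k-i,0} + c_{2k+1-i}, turns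
the i-th term into c_i c_{2k-i} - (G_{i+1} + G_i). The alternating sum telescopes to G_0 = 0 and
G_{2k+1}, and the latter cancels against the leading operator P_{2k+1}. -/
theorem concomitant_laxPos (k : ℕ) : concomitant (c 0) (c 0) (laxPos B k) =
    ∑ i ∈ Finset.range (2 * k + 1), (-1) ^ i * (c i * c (2 * k - i)) := by
  have hP : ∀ f a, concomitant (c 0) f (diffOp B (a + 1)) =
      f * c a - concomitant (c 0) (dt 0 f) (diffOp B a) := by
    intro f a
    rw [diffOp, concomitant_sub, concomitant_d_mul, concomitant_mono, sub_zero, act_diffOp hc]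
  set G : ℕ → K := fun i => concomitant (c 0) (c (2 * k + 1 - i)) (diffOp B i) with hG
  have h : ∀ i ∈ Finset.range (2 * k + 1),
      concomitant (c 0) (c 0) (mono ((-1) ^ i * B (2 * k - i) 0) 0 * diffOp B i) =
      (-1) ^ i * (c i * c (2 * k - i)) - (-1) ^ i * (G (i + 1) + G i) := by
    intro i hi
    rw [Finset.mem_range] at hi
    have e1 : c 0 * B (2 * k - i) 0 = dt 0 (c (2 * k - i)) - c (2 * k + 1 - i) := by
      rw [hc.flow_zero, hB.symm, show 2 * k + 1 - i = 2 * k - i + 1 by omega]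
      ring
    have e2 := hP (c (2 * k - i)) i
    have e3 : G (i + 1) = concomitant (c 0) (c (2 * k - i)) (diffOp B (i + 1)) := by
      rw [hG]
      simp only [show 2 * k + 1 - (i + 1) = 2 * k - i by omega]
    have e4 : concomitant (c 0) (c 0 * B (2 * k - i) 0) (diffOp B i) =
        c i * c (2 * k - i) - (G (i + 1) + G i) := by
      rw [e1, concomitant_sub_left, e3, e2]
      ring
    rw [concomitant_mono_mul, ← mul_sub, ← e4]
    -- Only additivity in f is available, so the sign is pulled out by cases, using subtraction from
    -- 0.
    rcases neg_one_pow_eq_or K i with h | h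
    · rw [h, one_mul, one_mul]
    · have e5 := concomitant_sub_left (c 0) 0 (c 0 * B (2 * k - i) 0) (diffOp B i)
      have e6 : concomitant (c 0) 0 (diffOp B i) = 0 := by
        rw [concomitant, mono_zero, mul_zero, zero_mul, zero_mul, zero_mul, coeff_zero]
      rw [e6, zero_sub, zero_sub] at e5
      rw [h, neg_one_mul, neg_one_mul, mul_neg, e5]
  rw [laxPos, concomitant_add, concomitant_sum, Finset.sum_congr rfl h, Finset.sum_sub_distrib,
    alternating_telescope, Odd.neg_one_pow ⟨k, rfl⟩]
  have h1 : G 0 = 0 := concomitant_one _ _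
  have h2 : G (2 * k + 1) = concomitant (c 0) (c 0) (diffOp B (2 * k + 1)) := by
    rw [hG]
    simp only [Nat.sub_self]
  rw [h1, h2]
  ring

omit hB in
/-- The Darboux transformation adds a rank one matrix to the solution of the Riccati equations. -/
theorem darboux_mul_dressB {Ω : K} (hΩ : dt 0 Ω = c 0 * c 0) (hs : 1 - Ω ≠ 0) (hq : c 0 ≠ 0)
    {B' : ℕ → ℕ → K} (hB' : ∀ j, B' 0 j = B 0 j + c 0 / (1 - Ω) * c j) :
    darboux (c 0) (Ω - 1) * dressB B = dressB B' := by
  -- In q/(1-Ω) ∂^{-1} (1-Ω) ∂ q^{-1} the middle is (1-Ω) + ∂^{-1} q², since Ω' = q².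
  have hT : darboux (c 0) (Ω - 1) = 1 + mono (c 0 / (1 - Ω)) 0 * mono 1 (-1) * mono (c 0) 0 := by
    have e1 : (-(Ω - 1) / c 0)⁻¹ = c 0 / (1 - Ω) := by
      rw [neg_sub, inv_div]
    have e2 : -(Ω - 1) / c 0 * c 0 = 1 - Ω := by
      rw [neg_sub, div_mul_cancel₀ _ hq]
    have e3 : dt 0 (1 - Ω) = -(c 0 * c 0) := by
      rw [map_sub, hΩ, Derivation.map_one_eq_zero, zero_sub]
    have e4 : mono (-(c 0 * c 0)) 0 = -(mono (c 0) 0 * mono (c 0) 0) := by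
      rw [mono_zero_mul_mono, ← zero_sub, mono_sub, mono_zero, zero_sub]
    calc darboux (c 0) (Ω - 1) = mono (c 0 / (1 - Ω)) 0 * (mono 1 (-1) *
          (mono (-(Ω - 1) / c 0) 0 * mono (c 0) 0) * mono 1 1) * mono (c 0)⁻¹ 0 := by
          rw [darboux, darbouxI, darbouxD, e1]
          simp only [mul_assoc]
      _ = mono (c 0 / (1 - Ω)) 0 * (mono (1 - Ω) 0 +
          mono 1 (-1) * mono (c 0) 0 * mono (c 0) 0) * mono (c 0)⁻¹ 0 := by
          rw [mono_zero_mul_mono, e2, inv_mul_mono_mul_d, e3, e4, mul_neg, sub_neg_eq_add,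
            ← mul_assoc (mono 1 (-1))]
      _ = mono (c 0 / (1 - Ω) * (1 - Ω) * (c 0)⁻¹) 0 +
          mono (c 0 / (1 - Ω)) 0 * mono 1 (-1) * mono (c 0) 0 * mono (c 0 * (c 0)⁻¹) 0 := by
          rw [mul_add, add_mul, mono_zero_mul_mono, mono_zero_mul_mono,
            ← mono_zero_mul_mono (c 0) (c 0)⁻¹]
          simp only [mul_assoc]
      _ = _ := by
          rw [div_mul_cancel₀ _ hs, mul_inv_cancel₀ hq, ← one_eq_mono, mul_one]
  -- The x-flow of c says that q W is ∂ applied to the tail of c, so the ∂^{-1} in T(q) cancels and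
  -- T(q) W - W is a multiple of that tail.
  have hd : mono (c 0) 0 * dressB B = mono 1 1 * tail c := by
    have h : (fun j => dt 0 (c j) - c (j + 1)) = fun j => c 0 * B 0 j := by
      funext j
      rw [hc.flow_zero]
      ring
    rw [d_mul_tail, h, tail_mul, dressB, mul_add, mul_one, add_comm]
  rw [hT, add_mul, one_mul, mul_assoc _ _ (dressB B), hd, mul_assoc, ← mul_assoc (mono 1 (-1)),
    inv_mul_d, one_mul, ← tail_mul, dressB, add_assoc, ← tail_add, dressB]
  congr 2
  funext j
  rw [hB']

end

/-! ### The hierarchy for vacuum expectation values -/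

/-- The matrix of correlators with entries in the field of fractions. -/
noncomputable def kmat (u : Fock) (i j : ℕ) : K := algebraMap TSeries K (bmat u i j)

/-- The vector of correlators with entries in the field of fractions. -/
noncomputable def kvec (u : Fock) (b : ℤ →₀ ℂ) (i : ℕ) : K := algebraMap TSeries K (cvec u b i)

theorem eigen_eq_cvec (u : Fock) (b : ℤ →₀ ℂ) : eigen u b = cvec u b 0 := eigen_eq u b

section

variable {u : Fock} (h0 : vac u ≠ 0) (hu : bil u u = 0) (b : ℤ →₀ ℂ)
include h0

theorem dressing_eq : dressing u = dressB (kmat u) := by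
  ext i
  rw [dressB, coeff_add]
  rcases lt_trichotomy i 0 with hi | rfl | hi
  · obtain ⟨j, rfl⟩ : ∃ j : ℕ, i = -(j : ℤ) - 1 := ⟨(-i - 1).toNat, by omega⟩
    rw [tail_coeff, one_eq_mono, coeff_mono, if_neg (by omega), zero_add]
    simp only [dressing]
    rw [if_neg (by omega), show -(-(j : ℤ) - 1) = (j : ℤ) + 1 by ring, waveCoeff, waveNum_succ,
      kmat, bmat, mul_left_comm, map_mul, map_pow, map_neg, map_one]
  · rw [tail_coeff_of_nonneg _ le_rfl, one_eq_mono, coeff_mono, if_pos rfl, add_zero]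
    simp only [dressing]
    rw [if_neg (by omega), neg_zero, waveCoeff, waveNum_zero, mul_comm, bra0_mul_inv h0, map_one]
  · rw [tail_coeff_of_nonneg _ hi.le, one_eq_mono, coeff_mono, if_neg (by omega), add_zero]
    simp only [dressing]
    rw [if_pos hi]

theorem two_mul_pderiv_bra0_mul_inv : 2 * (pderiv ℂ 0 (bra0 u) * (bra0 u)⁻¹) = bmat u 0 0 := by
  rw [← mul_assoc, two_mul_pderiv_bra0 h0 0]
  simp only [mul_zero, zero_add, Finset.sum_range_one, pow_zero, one_mul, Nat.sub_zero]
  rw [mul_right_comm, bra0_mul_inv h0, one_mul]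

include hu

theorem isRiccati_kmat : IsRiccati (kmat u) where
  symm i j := by rw [kmat, bmat_comm, kmat]
  flow k i j := by
    rw [kmat, dt_algebraMap, pderiv_bmat h0 hu]
    simp only [map_add, map_sum, map_mul, map_pow, map_neg, map_one, kmat]

theorem isLinear_kvec : IsLinear (kmat u) (kvec u b) := fun k i => by
  rw [kvec, dt_algebraMap, pderiv_cvec h0 hu]
  simp only [map_add, map_sum, map_mul, map_pow, map_neg, map_one, kmat, kvec]

theorem isTau_bra0 : IsTau (dressing u) (bra0 u) := by
  refine ⟨by rwa [constantCoeff_bra0], ?_, fun k => ?_⟩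
  · rw [two_mul_pderiv_bra0_mul_inv h0, dressing_eq h0, dressB, coeff_add, one_eq_mono, coeff_mono,
      if_neg (by omega), zero_add]
    simpa [kmat] using tail_coeff (kmat u 0) 0
  · have h2 : pderiv ℂ k (2 : TSeries) = 0 := by
      rw [← Nat.cast_ofNat (R := TSeries), Derivation.map_natCast]
    rw [dressing_eq h0, res_laxPow_dressB (isRiccati_kmat h0 hu), neg_neg, kmat, dt_algebraMap,
      ← two_mul_pderiv_bra0_mul_inv h0, (pderiv ℂ k).leibniz 2, h2, smul_zero, add_zero, smul_eq_mul]

theorem isEigenfunction_eigen : IsEigenfunction (dressing u) (eigen u b) := fun k => by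
  rw [dressing_eq h0, eigen_eq_cvec]
  have := applyPos_laxPow_dressB (isRiccati_kmat h0 hu) (isLinear_kvec h0 hu b) k
  simp only [kvec] at this
  rw [this, dt_algebraMap]

theorem isSEP_omega : IsSEP (dressing u) (eigen u b) (eigen u b) (omega u b) := by
  refine ⟨by simpa [eigen_eq_cvec] using pderiv_omega h0 hu b 0, fun k => ?_⟩
  rw [dressing_eq h0, eigen_eq_cvec, pos_laxPow_dressB (isRiccati_kmat h0 hu)]
  have := concomitant_laxPos (isRiccati_kmat h0 hu) (isLinear_kvec h0 hu b) k
  rw [concomitant] at this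
  rw [PDO.res]
  simp only [kvec] at this
  rw [this, pderiv_omega h0 hu]
  simp only [map_sum, map_mul, map_pow, map_neg, map_one]

end

/-! ### The coefficients of `(1 - x)^{-1/2}` -/

/-- The coefficients of `(1 - x)^{-1/2}`. -/
noncomputable def invSqrtCoeff (n : ℕ) : ℂ := (n.centralBinom : ℂ) / 4 ^ n

theorem invSqrtCoeff_zero : invSqrtCoeff 0 = 1 := by simp [invSqrtCoeff]

theorem two_mul_succ_mul_invSqrtCoeff (n : ℕ) :
    2 * ((n : ℂ) + 1) * invSqrtCoeff (n + 1) = (2 * n + 1) * invSqrtCoeff n := by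
  have h : ((n : ℂ) + 1) * (n + 1).centralBinom = 2 * (2 * n + 1) * n.centralBinom := by
    exact_mod_cast n.succ_mul_centralBinom_succ
  rw [invSqrtCoeff, invSqrtCoeff, pow_succ]
  field_simp
  linear_combination 2 * h

theorem norm_invSqrtCoeff (n : ℕ) : ‖invSqrtCoeff n‖ = n.centralBinom / 4 ^ n := by
  rw [invSqrtCoeff, norm_div, norm_pow]
  simp

theorem norm_invSqrtCoeff_le_one (n : ℕ) : ‖invSqrtCoeff n‖ ≤ 1 := by
  rw [norm_invSqrtCoeff, div_le_one (by positivity)]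
  exact_mod_cast n.centralBinom_le_four_pow

/-- This harmonic lower bound excludes absolute convergence on the boundary |x| = 1. At n = 0 the
left side is 0 by the convention for division. -/
theorem le_norm_invSqrtCoeff (n : ℕ) : (1 / 2) * (1 / (n : ℝ)) ≤ ‖invSqrtCoeff n‖ := by
  rcases Nat.eq_zero_or_pos n with rfl | hn
  · simp
  · rw [norm_invSqrtCoeff, one_div_mul_one_div,
      div_le_div_iff₀ (by positivity) (by positivity), one_mul]
    have := n.four_pow_le_two_mul_self_mul_centralBinom hn
    have h : (4 : ℝ) ^ n ≤ 2 * n * n.centralBinom := by exact_mod_cast this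
    linarith

theorem sum_invSqrtCoeff_mul (N : ℕ) :
    ∑ p ∈ antidiagonal N, invSqrtCoeff p.1 * invSqrtCoeff p.2 = 1 := by
  induction N with
  | zero => simp [invSqrtCoeff_zero]
  | succ N ih =>
    have key : ∀ M : ℕ, ∑ p ∈ antidiagonal M, 2 * (p.1 : ℂ) * (invSqrtCoeff p.1 * invSqrtCoeff p.2) =
        M * ∑ p ∈ antidiagonal M, invSqrtCoeff p.1 * invSqrtCoeff p.2 := by
      intro M
      have h1 : ∑ p ∈ antidiagonal M, (p.2 : ℂ) * (invSqrtCoeff p.1 * invSqrtCoeff p.2) =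
          ∑ p ∈ antidiagonal M, (p.1 : ℂ) * (invSqrtCoeff p.1 * invSqrtCoeff p.2) := by
        rw [← Finset.Nat.sum_antidiagonal_swap]
        exact Finset.sum_congr rfl fun p _ => by
          rw [Prod.fst_swap, Prod.snd_swap, mul_comm (invSqrtCoeff p.2)]
      have h2 : ∀ p ∈ antidiagonal M, (M : ℂ) * (invSqrtCoeff p.1 * invSqrtCoeff p.2) =
          p.1 * (invSqrtCoeff p.1 * invSqrtCoeff p.2) +
            p.2 * (invSqrtCoeff p.1 * invSqrtCoeff p.2) := by
        intro p hp
        rw [← mem_antidiagonal.mp hp]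
        push_cast
        ring
      rw [Finset.mul_sum, Finset.sum_congr rfl h2, Finset.sum_add_distrib, h1,
        ← Finset.sum_add_distrib]
      exact Finset.sum_congr rfl fun p _ => by ring
    have h3 := key (N + 1)
    rw [Finset.Nat.sum_antidiagonal_succ] at h3
    simp only [Nat.cast_zero, mul_zero, zero_mul, zero_add] at h3
    have h4 : ∑ p ∈ antidiagonal N,
        2 * ((p.1 + 1 : ℕ) : ℂ) * (invSqrtCoeff (p.1 + 1) * invSqrtCoeff p.2) = N + 1 := by
      have h5 : ∀ p ∈ antidiagonal N,
          2 * ((p.1 + 1 : ℕ) : ℂ) * (invSqrtCoeff (p.1 + 1) * invSqrtCoeff p.2) =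
          2 * (p.1 : ℂ) * (invSqrtCoeff p.1 * invSqrtCoeff p.2) +
            invSqrtCoeff p.1 * invSqrtCoeff p.2 := by
        intro p _
        push_cast
        linear_combination invSqrtCoeff p.2 * two_mul_succ_mul_invSqrtCoeff p.1
      rw [Finset.sum_congr rfl h5, Finset.sum_add_distrib, key, ih]
      ring
    rw [h4] at h3
    have h6 : ((N : ℂ) + 1) ≠ 0 := by exact_mod_cast N.succ_ne_zero
    apply mul_left_cancel₀ h6
    rw [mul_one]
    push_cast at h3
    exact h3.symm

/-! ### Sequences decaying faster than any power -/

/-- The products of the sequence with all powers of the index are summable. -/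
def Rapid (s : ℕ → ℂ) : Prop := ∀ r : ℕ, Summable fun n : ℕ => (n : ℂ) ^ r * s n

theorem Rapid.summable {s : ℕ → ℂ} (h : Rapid s) : Summable s := by simpa using h 0

theorem Rapid.zero : Rapid fun _ => 0 := fun r => by simp

theorem Rapid.add {s t : ℕ → ℂ} (hs : Rapid s) (ht : Rapid t) : Rapid fun n => s n + t n :=
  fun r => by simpa only [mul_add] using (hs r).add (ht r)

theorem Rapid.const_mul {s : ℕ → ℂ} (hs : Rapid s) (c : ℂ) : Rapid fun n => c * s n :=
  fun r => by simpa only [mul_left_comm] using (hs r).mul_left c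

theorem Rapid.natCast_mul {s : ℕ → ℂ} (hs : Rapid s) : Rapid fun n => (n : ℂ) * s n :=
  fun r => by simpa only [pow_succ, mul_assoc] using hs (r + 1)

theorem Rapid.sum {ι : Type*} {I : Finset ι} {s : ι → ℕ → ℂ} (hs : ∀ i ∈ I, Rapid (s i)) :
    Rapid fun n => ∑ i ∈ I, s i n := fun r => by
  simpa only [Finset.mul_sum] using summable_sum fun i hi => hs i hi r

/-- (n+1)^r expands into powers of n, so rapid decay survives a shift of the index. -/
theorem Rapid.of_succ {s t : ℕ → ℂ} (hs : Rapid s) (h : ∀ n, t (n + 1) = s n) : Rapid t := by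
  intro r
  rw [← summable_nat_add_iff 1]
  simp only [h, Nat.cast_add, Nat.cast_one, add_pow, one_pow, mul_one, Finset.sum_mul]
  refine summable_sum fun i _ => ?_
  simpa only [mul_right_comm] using (hs i).mul_right ((r.choose i : ℕ) : ℂ)

theorem rapid_invSqrtCoeff_mul_pow {x : ℂ} (hx : ‖x‖ < 1) :
    Rapid fun n => invSqrtCoeff n * x ^ n := by
  intro r
  refine Summable.of_norm_bounded (summable_pow_mul_geometric_of_norm_lt_one r hx).norm fun n => ?_
  rw [norm_mul, norm_mul, norm_mul]
  exact mul_le_mul_of_nonneg_left (mul_le_of_le_one_left (norm_nonneg _)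
    (norm_invSqrtCoeff_le_one n)) (norm_nonneg _)

theorem norm_lt_one_of_summable {x : ℂ} (h : Summable fun n => invSqrtCoeff n * x ^ n) :
    ‖x‖ < 1 := by
  by_contra! hx
  apply Real.not_summable_one_div_natCast
  rw [← summable_mul_left_iff (by norm_num : (1 / 2 : ℝ) ≠ 0)]
  refine Summable.of_nonneg_of_le (fun n => by positivity) (fun n => ?_) h.norm
  rw [norm_mul, norm_pow]
  exact (le_norm_invSqrtCoeff n).trans (le_mul_of_one_le_right (norm_nonneg _) (one_le_pow₀ hx))

/-! ### The exponential series of `β² / 2` -/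

/-- The terms of the series `e^{β²/2} u`. -/
noncomputable def expTerm (b : ℤ →₀ ℂ) (u : Fock) (n : ℕ) : Fock :=
  ((n.factorial : ℂ))⁻¹ • (halfSq b)^[n] u

theorem halfSq_iterate (b : ℤ →₀ ℂ) (u : Fock) (n : ℕ) :
    (halfSq b)^[n] u = ((1 / 2 : ℂ) ^ n) • (field b)^[2 * n] u := by
  induction n with
  | zero => simp
  | succ n ih =>
    rw [Function.iterate_succ_apply', ih, halfSq, map_smul, map_smul, smul_smul, pow_succ',
      mul_add_one, Function.iterate_succ_apply', Function.iterate_succ_apply']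

theorem expTerm_eq (b : ℤ →₀ ℂ) (u : Fock) (n : ℕ) :
    expTerm b u n = (((n.factorial : ℂ))⁻¹ * (1 / 2) ^ n) • (field b)^[2 * n] u := by
  rw [expTerm, halfSq_iterate, smul_smul]

theorem succ_mul_expTerm_factor (n : ℕ) :
    2 * ((n : ℂ) + 1) * ((((n + 1).factorial : ℂ))⁻¹ * (1 / 2) ^ (n + 1)) =
      ((n.factorial : ℂ))⁻¹ * (1 / 2) ^ n := by
  have h : ((n : ℂ) + 1) ≠ 0 := by exact_mod_cast n.succ_ne_zero
  rw [Nat.factorial_succ, pow_succ]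
  push_cast
  field_simp

theorem corr_smul (I : List ℕ) (c : ℂ) (f : Fock) : corr I (c • f) = C c * corr I f := by
  ext α
  have h : ∀ α, expHeis (c • f) α = c • expHeis f α := by
    intro α
    induction α using finsupp_induction with
    | h0 => simp only [expHeis_zero]
    | hs α k ih =>
      have h1 : (α k + 1 : ℂ) ≠ 0 := by exact_mod_cast (α k).succ_ne_zero
      apply smul_right_injective Fock h1
      simp only
      rw [expHeis_add_single, ih, ← heisLin_apply, map_smul, smul_comm, expHeis_add_single,
        heisLin_apply]
  rw [coeff_corr, coeff_C_mul, coeff_corr, h, map_smul, vac,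
    ← coeff_zero_eq_constantCoeff_apply, map_smul]
  rfl

section

variable {u : Fock} (h0 : vac u ≠ 0) (hu : bil u u = 0) (b : ℤ →₀ ℂ)
include h0 hu

/-- The factor 2n+1 of the moment recursion over the 2(n+1) from 1/(n! 2^n) is the ratio of
consecutive coefficients of (1-x)^{-1/2}. -/
theorem bra0_expTerm (n : ℕ) :
    bra0 (expTerm b u n) = C (invSqrtCoeff n) * omega u b ^ n * bra0 u := by
  induction n with
  | zero => simp [expTerm, invSqrtCoeff_zero]
  | succ n ih =>
    have h1 : ((2 * ((n : ℂ) + 1))) ≠ 0 :=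
      mul_ne_zero two_ne_zero (by exact_mod_cast n.succ_ne_zero)
    have h2 : (C (2 * ((n : ℂ) + 1)) : TSeries) ≠ 0 := by
      intro h
      apply h1
      simpa using congrArg constantCoeff h
    apply mul_left_cancel₀ h2
    have h3 : C (2 * ((n : ℂ) + 1)) * bra0 (expTerm b u (n + 1)) =
        C (2 * (n : ℂ) + 1) * omega u b * bra0 (expTerm b u n) := by
      rw [expTerm_eq, expTerm_eq, bra0_eq_corr, bra0_eq_corr, corr_smul, corr_smul, ← mul_assoc,
        ← map_mul, succ_mul_expTerm_factor, ← bra0_eq_corr, ← bra0_eq_corr, mul_add_one,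
        bra0_iterate_add_two h0 hu b]
      simp only [map_add, map_mul, map_natCast, map_one, Nat.cast_add, Nat.cast_mul, Nat.cast_one,
        Nat.cast_ofNat, show (C (2 : ℂ) : TSeries) = 2 from map_ofNat C 2]
      ring
    rw [h3, ih, pow_succ]
    have h4 := congrArg (C : ℂ → TSeries) (two_mul_succ_mul_invSqrtCoeff n)
    rw [map_mul C (2 * ((n : ℂ) + 1)), map_mul C (2 * (n : ℂ) + 1)] at h4
    linear_combination -(omega u b ^ n * omega u b * bra0 u) * h4

theorem vac_expTerm (n : ℕ) : vac (expTerm b u n) =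
    invSqrtCoeff n * constantCoeff (omega u b) ^ n * vac u := by
  rw [← constantCoeff_bra0, bra0_expTerm h0 hu]
  simp [constantCoeff_bra0]

theorem bra0_iterate_odd (n : ℕ) : bra0 ((field b)^[2 * n + 1] u) = 0 := by
  induction n with
  | zero => exact bra0_field h0 hu b
  | succ n ih =>
    rw [show 2 * (n + 1) + 1 = 2 * n + 1 + 2 by ring, bra0_iterate_add_two h0 hu b, ih, mul_zero]

theorem vac_field_expTerm (n : ℕ) : vac (field b (expTerm b u n)) = 0 := by
  rw [expTerm_eq, map_smul, ← Function.iterate_succ_apply' (field b), ← constantCoeff_bra0,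
    bra0_eq_corr, corr_smul, ← bra0_eq_corr, bra0_iterate_odd h0 hu b, mul_zero, map_zero]

omit h0 in
theorem bil_expTerm_succ (n : ℕ) : bil (expTerm b u (n + 1)) u =
    (-1 : ℂ) • tmul (field b (expTerm b u n)) (field b u) := by
  rw [expTerm_eq, bil_smul_left, bil_iterate_field b hu, expTerm_eq, map_smul, tmul_smul_left,
    show 2 * (n + 1) - 1 = 2 * n + 1 by omega, Function.iterate_succ_apply', smul_neg, smul_smul,
    neg_smul, one_smul]
  congr 2
  rw [← succ_mul_expTerm_factor n]
  push_cast
  ring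

omit h0 in
theorem bil_field_expTerm (n : ℕ) : bil (field b (expTerm b u n)) u =
    (-(2 * (n : ℂ) + 1)) • tmul (expTerm b u n) (field b u) := by
  rw [expTerm_eq, map_smul, ← Function.iterate_succ_apply' (field b), bil_smul_left,
    bil_iterate_field b hu, tmul_smul_left, Nat.succ_sub_one, smul_neg, neg_smul, smul_comm]
  push_cast
  rfl

end

/-! ### Convergence of the exponential series of β²/2 -/

theorem vac_mul_coeff_d {f h g k : Fock} {c : ℂ} (hb : bil f h = c • tmul g k) (j : ℕ)
    (m : ℕ →₀ ℕ) : vac h * coeff m (d j f) =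
      coeff m (bil f (d j h) 0) + -vac (d j k) * (c * coeff m g) := by
  have h1 := op2_d_bil j f h
  rw [hb, op2_smul, op2_tmul] at h1
  have h2 := congrArg (coeff m) (congrFun h1 0)
  simp only [Pi.smul_apply, Pi.sub_apply, tmul, map_smul, map_sub, smul_eq_mul] at h2
  simp only [vac, ← coeff_zero_eq_constantCoeff_apply]
  linear_combination h2

/-- With the vacuum in the second slot only creation operators act in the first, so the coefficient
at m involves only monomials of degree one less. -/
theorem rapid_coeff_bil {s : ℕ → Fock} (h : Fock) {m : ℕ →₀ ℕ}
    (hs : ∀ k, m k ≠ 0 → Rapid fun n => coeff (m - Finsupp.single k 1) (s n)) :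
    Rapid fun n => coeff m (bil (s n) h 0) := by
  simp only [coeff_bil _ h (below_bd m) (m' := 0) (fun _ _ => rfl), coeff_bilBox]
  refine Rapid.sum fun k _ => ?_
  rcases lt_or_ge k 0 with hk | hk
  · have : coeff 0 (phi (-k - 1) h) = 0 := vac_phi_nonneg (by omega) h
    simpa [this] using Rapid.zero
  · lift k to ℕ using hk
    simp only [phi_natCast, coeff_X_mul_eq]
    by_cases hm : m k = 0
    · simpa [hm] using Rapid.zero
    · simpa [hm] using (hs k hm).const_mul _

section

variable {u : Fock} (h0 : vac u ≠ 0) (hu : bil u u = 0) (b : ℤ →₀ ℂ)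
include h0

theorem rapid_coeff_add_single {s : ℕ → Fock} {m : ℕ →₀ ℕ} {j : ℕ}
    (h : Rapid fun n => vac u * coeff m (d j (s n))) :
    Rapid fun n => coeff (m + Finsupp.single j 1) (s n) := by
  have h1 : (m j + 1 : ℂ) ≠ 0 := by exact_mod_cast (m j).succ_ne_zero
  have h2 := h.const_mul ((vac u)⁻¹ * (m j + 1 : ℂ)⁻¹)
  convert h2 using 2 with n
  rw [coeff_d]
  field_simp

include hu

/-- `vac_mul_coeff_d` expresses a coefficient by coefficients of lower degree. It sends the terms of
e^{β²/2} u to β times the preceding terms, and those back to the terms with a factor 2n+1. Hence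
both families are treated together, and the induction needs decay faster than any power rather than
mere summability. -/
theorem rapid_coeff_expTerm (hω : ‖constantCoeff (omega u b)‖ < 1) (m : ℕ →₀ ℕ) :
    (Rapid fun n => coeff m (expTerm b u n)) ∧
      Rapid fun n => coeff m (field b (expTerm b u n)) := by
  induction hN : m.degree using Nat.strong_induction_on generalizing m with
  | _ N ih =>
  by_cases hm : m = 0
  · subst hm
    have e1 : ∀ f : Fock, coeff 0 f = vac f := fun f => coeff_zero_eq_constantCoeff_apply f
    simp only [e1, vac_field_expTerm h0 hu, vac_expTerm h0 hu]
    refine ⟨?_, Rapid.zero⟩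
    simpa only [mul_comm (vac u)] using (rapid_invSqrtCoeff_mul_pow hω).const_mul (vac u)
  · obtain ⟨j, hj⟩ := Finsupp.ne_iff.mp hm
    obtain ⟨m, rfl⟩ : ∃ m', m = m' + Finsupp.single j 1 := by
      refine ⟨m - Finsupp.single j 1, (tsub_add_cancel_of_le ?_).symm⟩
      simpa [Nat.one_le_iff_ne_zero] using hj
    have hdeg : m.degree < N := by
      rw [← hN, map_add, Finsupp.degree_single]
      exact Nat.lt_succ_self _
    have hsub : ∀ k, m k ≠ 0 → (m - Finsupp.single k 1).degree < N := by
      intro k hk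
      refine lt_of_le_of_lt ?_ hdeg
      have : m - Finsupp.single k 1 + Finsupp.single k 1 = m :=
        tsub_add_cancel_of_le (by simpa [Nat.one_le_iff_ne_zero] using hk)
      conv_rhs => rw [← this, map_add]
      exact Nat.le_add_right _ _
    obtain ⟨hE, hO⟩ := ih _ hdeg m rfl
    constructor
    · apply rapid_coeff_add_single h0
      have hbil : Rapid fun n => coeff m (bil (expTerm b u n) (d j u) 0) :=
        rapid_coeff_bil _ fun k hk => (ih _ (hsub k hk) _ rfl).1
      have h1 : Rapid fun n => vac u * coeff m (d j (expTerm b u n)) -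
          coeff m (bil (expTerm b u n) (d j u) 0) := by
        -- The recursion links the term n+1 to n and says nothing about the initial term, hence the
        -- shift.
        refine (hO.const_mul (vac (d j (field b u)))).of_succ fun n => ?_
        rw [vac_mul_coeff_d (bil_expTerm_succ hu b n)]
        ring
      simpa using h1.add hbil
    · apply rapid_coeff_add_single h0
      have hbil : Rapid fun n => coeff m (bil (field b (expTerm b u n)) (d j u) 0) :=
        rapid_coeff_bil _ fun k hk => (ih _ (hsub k hk) _ rfl).2
      simp only [vac_mul_coeff_d (bil_field_expTerm hu b _)]
      refine hbil.add (Rapid.const_mul ?_ _)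
      have := (hE.natCast_mul.const_mul (-2)).add (hE.const_mul (-1))
      convert this using 2 with n
      ring

theorem exists_hasExp_iff :
    (∃ v, HasExp (halfSq b) u v) ↔ ‖constantCoeff (omega u b)‖ < 1 := by
  constructor
  · rintro ⟨v, hv⟩
    have h := ((hasExp_iff _ _ _).mp hv 0).summable
    have h1 : ∀ n, coeff 0 (((n.factorial : ℂ))⁻¹ • (halfSq b)^[n] u) =
        invSqrtCoeff n * constantCoeff (omega u b) ^ n * vac u := fun n => by
      rw [← vac_expTerm h0 hu b n, coeff_zero_eq_constantCoeff_apply]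
      rfl
    simp only [h1] at h
    exact norm_lt_one_of_summable ((summable_mul_right_iff h0).mp h)
  · intro hω
    exact ⟨fun m => ∑' n, coeff m (expTerm b u n), (hasExp_iff _ _ _).mpr fun m =>
      (rapid_coeff_expTerm h0 hu b hω m).1.summable.hasSum⟩

end

/-! ### Coefficientwise convergence of series of times -/

theorem HasSumF.unique {s : ℕ → Fock} {f g : Fock} (hf : HasSumF s f) (hg : HasSumF s g) :
    f = g := by
  ext m
  exact (hf m).unique (hg m)

theorem HasSumF.const_mul {s : ℕ → TSeries} {f : TSeries} (h : HasSumF s f) (g : TSeries) :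
    HasSumF (fun n => g * s n) (g * f) := by
  classical
  intro m
  simp only [coeff_mul]
  exact hasSum_sum fun p _ => (h p.2).mul_left _

theorem HasSumF.cauchy {s t : ℕ → TSeries} {f g : TSeries} (hs : HasSumF s f) (ht : HasSumF t g) :
    HasSumF (fun n => ∑ p ∈ antidiagonal n, s p.1 * t p.2) (f * g) := by
  classical
  intro m
  have h := hasSum_sum (s := antidiagonal m) fun p _ => hasSum_cauchy (hs p.1) (ht p.2)
  rw [coeff_mul]
  convert h using 1
  funext n
  rw [map_sum, Finset.sum_comm]
  exact Finset.sum_congr rfl fun p _ => coeff_mul _ _ _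

theorem HasSumF.of_succ {s : ℕ → TSeries} {f : TSeries} (h : HasSumF (fun n => s (n + 1)) f) :
    HasSumF s (f + s 0) := by
  intro m
  rw [map_add]
  simpa using (hasSum_nat_add_iff (f := fun n => coeff m (s n)) 1).mp (h m)

theorem HasSumF.expHeis {s : ℕ → Fock} {f : Fock} (h : HasSumF s f) (α : ℕ →₀ ℕ) :
    HasSumF (fun n => expHeis (s n) α) (expHeis f α) := by
  have key : ∀ (f : Fock) (α : ℕ →₀ ℕ) (k : ℕ), CKP.expHeis f (α + Finsupp.single k 1) =
      ((α k : ℂ) + 1)⁻¹ • heis ((2 * k + 1 : ℕ)) (CKP.expHeis f α) := by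
    intro f α k
    have h1 : (α k + 1 : ℂ) ≠ 0 := by exact_mod_cast (α k).succ_ne_zero
    rw [← expHeis_add_single, smul_smul, inv_mul_cancel₀ h1, one_smul]
  induction α using finsupp_induction with
  | h0 => simpa only [expHeis_zero] using h
  | hs α k ih =>
    simp only [key, heis_eq_quad]
    exact (ih.quad (heisKernel_band _) 0).smul _

theorem HasSumF.dl {s : ℕ → Fock} {f : Fock} (h : HasSumF s f) (I : List ℕ) :
    HasSumF (fun n => dl I (s n)) (dl I f) := by
  induction I with
  | nil => simpa using h
  | cons i I ih => simpa using ih.d i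

theorem HasSumF.corr {s : ℕ → Fock} {f : Fock} (h : HasSumF s f) (I : List ℕ) :
    HasSumF (fun n => corr I (s n)) (corr I f) := by
  intro α
  simpa only [coeff_corr, vac, coeff_zero_eq_constantCoeff_apply] using (h.expHeis α).dl I 0

/-! ### The transformed vacuum expectation values -/

section

variable {u v : Fock} (h0 : vac u ≠ 0) (hu : bil u u = 0) {b : ℤ →₀ ℂ}
  (hv : HasExp (halfSq b) u v)
include h0 hu hv

theorem hasSumF_bra0 :
    HasSumF (fun n => C (invSqrtCoeff n) * omega u b ^ n * bra0 u) (bra0 v) := by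
  have h : HasSumF (expTerm b u) v := (hasExp_iff _ _ _).mp hv
  simpa only [← bra0_eq_corr, bra0_expTerm h0 hu] using h.corr []

/-- The Cauchy square of ∑ a_n Ω^n is S = ∑ Ω^n, and comparing S with its shift gives S = Ω S + 1.
-/
theorem sq_bra0_mul : bra0 v ^ 2 * (1 - omega u b) = bra0 u ^ 2 := by
  have h1 : HasSumF (fun n => C (invSqrtCoeff n) * omega u b ^ n) ((bra0 u)⁻¹ * bra0 v) := by
    have h := (hasSumF_bra0 h0 hu hv).const_mul (bra0 u)⁻¹
    convert h using 2 with n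
    linear_combination -(C (invSqrtCoeff n) * omega u b ^ n) * bra0_mul_inv h0
  have h2 : HasSumF (fun n => omega u b ^ n)
      (((bra0 u)⁻¹ * bra0 v) * ((bra0 u)⁻¹ * bra0 v)) := by
    have h := h1.cauchy h1
    convert h using 2 with n
    have h3 : ∀ p ∈ antidiagonal n, C (invSqrtCoeff p.1) * omega u b ^ p.1 *
        (C (invSqrtCoeff p.2) * omega u b ^ p.2) =
        C (invSqrtCoeff p.1 * invSqrtCoeff p.2) * omega u b ^ n := by
      intro p hp
      rw [← mem_antidiagonal.mp hp, map_mul, pow_add]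
      ring
    rw [Finset.sum_congr rfl h3, ← Finset.sum_mul, ← map_sum, sum_invSqrtCoeff_mul, map_one,
      one_mul]
  have h3 := h2.const_mul (omega u b)
  simp only [← pow_succ'] at h3
  have h4 := h2.unique (HasSumF.of_succ (s := fun n => omega u b ^ n) h3)
  rw [pow_zero] at h4
  have h5 := bra0_mul_inv h0
  linear_combination bra0 u ^ 2 * h4 -
    (1 - omega u b) * bra0 v ^ 2 * (bra0 u * (bra0 u)⁻¹ + 1) * h5

theorem vac_ne_zero_of_hasExp : vac v ≠ 0 := by
  intro h
  have h1 := congrArg constantCoeff (sq_bra0_mul h0 hu hv)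
  rw [map_mul, map_pow, map_pow, constantCoeff_bra0, constantCoeff_bra0, h, zero_pow two_ne_zero,
    zero_mul] at h1
  exact h0 (pow_eq_zero_iff two_ne_zero |>.mp h1.symm)

theorem one_sub_omega_ne_zero : 1 - omega u b ≠ 0 := by
  intro h
  have h1 := sq_bra0_mul h0 hu hv
  rw [h, mul_zero] at h1
  exact bra0_ne_zero h0 (pow_eq_zero_iff two_ne_zero |>.mp h1.symm)

omit hv in
theorem corr_two_expTerm_succ (n i j : ℕ) : corr [i, j] (expTerm b u (n + 1)) =
    bra0 (expTerm b u (n + 1)) * bmat u i j +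
      C (2 * (n : ℂ) + 1) * bra0 (expTerm b u n) * (cvec u b i * cvec u b j) := by
  simp only [expTerm_eq, bra0_eq_corr, corr_smul, corr_two_iterate h0 hu b]
  rw [← succ_mul_expTerm_factor n, show 2 * (n + 1) - 1 = 2 * n + 1 by omega,
    show 2 * (n + 1) - 2 = 2 * n by omega]
  simp only [map_add, map_mul, map_natCast, map_one, Nat.cast_add, Nat.cast_mul, Nat.cast_one,
        Nat.cast_ofNat, show (C (2 : ℂ) : TSeries) = 2 from map_ofNat C 2]
  ring

/-- With x_n = a_n Ω^n τ c_i c_j, the bracket is ∑ (2n+1) x_n and Ω times it is ∑ 2n x_n, by the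
recursion for a_n. The difference ∑ x_n is the right-hand side. -/
theorem one_sub_omega_mul_corr (i j : ℕ) :
    (1 - omega u b) * (corr [i, j] v - bra0 v * bmat u i j) =
      bra0 v * (cvec u b i * cvec u b j) := by
  have h : HasSumF (expTerm b u) v := (hasExp_iff _ _ _).mp hv
  set D := corr [i, j] v - bra0 v * bmat u i j with hD
  set x : ℕ → TSeries := fun n =>
    C (invSqrtCoeff n) * omega u b ^ n * bra0 u * (cvec u b i * cvec u b j) with hx
  have h1 : HasSumF (fun n => corr [i, j] (expTerm b u n) - bra0 (expTerm b u n) * bmat u i j) D := by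
    have h2 := (h.corr [i, j]).add (((h.corr []).const_mul (bmat u i j)).smul (-1))
    convert h2 using 1
    · funext n
      rw [neg_one_smul, ← bra0_eq_corr]
      ring
    · rw [neg_one_smul, ← bra0_eq_corr]
      ring
  have h2 : HasSumF (fun n => C (2 * (n : ℂ) + 1) * x n) D := by
    intro m
    have h3 := (hasSum_nat_add_iff' 1).mpr (h1 m)
    have h4 : corr [i, j] (expTerm b u 0) - bra0 (expTerm b u 0) * bmat u i j = 0 := by
      have : expTerm b u 0 = u := by simp [expTerm]
      rw [this, corr_eq_bmat h0, sub_self]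
    beta_reduce at h3
    rw [Finset.sum_range_one, h4, map_zero, sub_zero] at h3
    have h5 : ∀ n, corr [i, j] (expTerm b u (n + 1)) - bra0 (expTerm b u (n + 1)) * bmat u i j =
        C (2 * (n : ℂ) + 1) * x n := by
      intro n
      rw [corr_two_expTerm_succ h0 hu, bra0_expTerm h0 hu b n, hx]
      ring
    simpa only [h5] using h3
  have h3 : HasSumF (fun n => C (2 * (n : ℂ)) * x n) (omega u b * D) := by
    have h4 := h2.const_mul (omega u b)
    have h5 := HasSumF.of_succ (s := fun n => C (2 * (n : ℂ)) * x n) (f := omega u b * D) (by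
      convert h4 using 2 with n
      have h6 := congrArg (C : ℂ → TSeries) (two_mul_succ_mul_invSqrtCoeff n)
      rw [map_mul C (2 * ((n : ℂ) + 1)), map_mul C (2 * (n : ℂ) + 1)] at h6
      simp only [hx, Nat.cast_add, Nat.cast_one, pow_succ]
      linear_combination (omega u b ^ n * omega u b * bra0 u * (cvec u b i * cvec u b j)) * h6)
    simpa using h5
  have h4 := h2.add (h3.smul (-1))
  have h5 := (hasSumF_bra0 h0 hu hv).const_mul (cvec u b i * cvec u b j)
  have h6 : D + (-1 : ℂ) • (omega u b * D) = cvec u b i * cvec u b j * bra0 v := by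
    refine h4.unique ?_
    convert h5 using 2 with n
    rw [neg_one_smul, map_add, map_one, hx]
    ring
  rw [neg_one_smul] at h6
  linear_combination h6

/-- Only row 0 of the rank one correction of B is needed, since that row determines the dressing
operator. -/
theorem bmat_hasExp (j : ℕ) : (1 - omega u b) * (bmat v 0 j - bmat u 0 j) =
    cvec u b 0 * cvec u b j := by
  have h := vac_ne_zero_of_hasExp h0 hu hv
  have h1 := one_sub_omega_mul_corr h0 hu hv 0 j
  rw [corr_eq_bmat h] at h1
  apply mul_left_cancel₀ (bra0_ne_zero h)
  linear_combination h1

theorem darboux_mul_dressing (hq : eigen u b ≠ 0) :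
    darboux (algebraMap TSeries K (eigen u b)) (algebraMap TSeries K (omega u b - 1)) *
      dressing u = dressing v := by
  have hinj := IsFractionRing.injective TSeries K
  have h1 : 1 - algebraMap TSeries K (omega u b) ≠ 0 := by
    rw [← map_one (algebraMap TSeries K), ← map_sub]
    exact (map_ne_zero_iff _ hinj).mpr (one_sub_omega_ne_zero h0 hu hv)
  rw [eigen_eq_cvec] at hq ⊢
  rw [dressing_eq h0, dressing_eq (vac_ne_zero_of_hasExp h0 hu hv), map_sub, map_one]
  refine darboux_mul_dressB (isLinear_kvec h0 hu b) ?_ h1 ((map_ne_zero_iff _ hinj).mpr hq) ?_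
  · rw [dt_algebraMap, pderiv_omega h0 hu]
    simp [kvec]
  · intro j
    have h2 := congrArg (algebraMap TSeries K) (bmat_hasExp h0 hu hv j)
    simp only [map_mul, map_sub, map_one] at h2
    rw [div_mul_eq_mul_div, kvec, kvec, ← h2, mul_div_cancel_left₀ _ h1, kmat, kmat]
    ring

end

end CKP

theorem mainTheorem3 (u : CKP.Fock) (hu : CKP.SpVac u) (h0 : CKP.vac u ≠ 0) (b : ℤ →₀ ℂ) :
    CKP.IsTau (CKP.dressing u) (CKP.bra0 u) ∧
    CKP.IsEigenfunction (CKP.dressing u) (CKP.eigen u b) ∧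
    ∃ Ω : CKP.TSeries,
      CKP.IsSEP (CKP.dressing u) (CKP.eigen u b) (CKP.eigen u b) Ω ∧
      (∀ m : ℕ, CKP.bra0 ((CKP.field b)^[2 * m] u) =
        ((Nat.doubleFactorial (2 * m - 1) : ℕ) : CKP.TSeries) * Ω ^ m * CKP.bra0 u) ∧
      ((∃ v, CKP.HasExp (CKP.halfSq b) u v) ↔ ‖MvPowerSeries.constantCoeff Ω‖ < 1) ∧
      ∀ v, CKP.HasExp (CKP.halfSq b) u v →
        CKP.bra0 v ^ 2 * (1 - Ω) = CKP.bra0 u ^ 2 ∧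
        (CKP.eigen u b ≠ 0 →
          CKP.IsTau
            (CKP.darboux (algebraMap CKP.TSeries CKP.K (CKP.eigen u b))
              (algebraMap CKP.TSeries CKP.K (Ω - 1)) * CKP.dressing u)
            (CKP.bra0 v)) := by
  have hb := hu.bil_self
  refine ⟨CKP.isTau_bra0 h0 hb, CKP.isEigenfunction_eigen h0 hb b, CKP.omega u b,
    CKP.isSEP_omega h0 hb b, CKP.bra0_iterate h0 hb b, CKP.exists_hasExp_iff h0 hb b,
    fun v hv => ⟨CKP.sq_bra0_mul h0 hb hv, fun hq => ?_⟩⟩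
  rw [CKP.darboux_mul_dressing h0 hb hv hq]
  -- The transformed operator is now the dressing operator of v. As β²/2 comes from c_∞, v satisfies
  -- the bilinear identity, and the tau function statement holds for it as for u.
  obtain ⟨a, ha⟩ := CKP.exists_op_eq_halfSq b
  exact CKP.isTau_bra0 (CKP.vac_ne_zero_of_hasExp h0 hb hv) (hu.exp a (ha ▸ hv)).bil_self
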